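/- **Part 1 (gradient systems).** Let $H$ be a separable real Hilbert space and let $X$ be a Banach space that is densely and compactly embedded in $H$ (the domain $X=D(V')$). Let $V:X\to\mathbb R$ be a $C^2$ functional whose derivative is represented in $H$, $DV(u)v=\langle V'(u),v\rangle_H$ for $u,v\in X$, with $V':X\to H$ of class $C^1$; write $V''(u):X\to H$ for the derivative of $V'$ at $u$ and $\Phi=\{\psi\in X: V'(\psi)=0\}$. Assume that for every $\psi\in\Phi$ the operator $V''(\psi)$ is Fredholm of index zero and has a self-adjoint extension in $H$ with discrete spectrum, compact resolvent and a complete set of eigenfunctions. Assume moreover hypothesis $(H_R)$: whenever $\psi\in\Phi$ is not isolated in $\Phi$ (branching occurs at $\psi$) and $k=\dim\ker V''(\psi)\ge 1$, there is a $k$-dimensional $C^1$ surface in $X$ through $\psi$ that consists of equilibria. Let $u\in C((0,\infty);X)$ be differentiable as an $H$-valued function and satisfy $u_t=V'(u)$ for all $t>0$. Suppose that $u$ is bounded in $X$ and has the smoothing property of smooth flows: if $s_n\to\infty$ and $u(s_n)$ converges in $H$, then $u(s_n)$ converges in $X$. Then there is a single equilibrium $\psi\in\Phi$ with $u(t)\to\psi$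 in $X$ as $t\to\infty$. If $\ker V''(\psi)=\{0\}$ or $\psi$ is not isolated in $\Phi$ (that is, unless $\psi$ is an isolated degenerate equilibrium), the convergence is exponential: $\|u(t)-\psi\|_H\le Ce^{-\delta t}$ for all $t>0$, with some constants $C$ and $\delta>0$. **Part 2 (parabolic equations of order $2m$).** Let $m,N\ge1$, let $\Omega\subset\mathbb R^N$ be a bounded open set and let $f\in C^1(\mathbb R)$. Let $D=\{u\in H^m_0(\Omega):\Delta^m u\in L^2(\Omega)\}$ with the graph norm $\max(\|u\|_{L^2},\|\Delta^m u\|_{L^2})$ (so $D=H^{2m}(\Omega)\cap H_0^m(\Omega)$ if $\partial\Omega$ is smooth), and let $\Phi_M$ be the set of $\psi\in D$ with $|\psi|\le M$ a.e. and $(-1)^{m+1}\Delta^m\psi+f(\psi)=0$. Call $\psi$ a branching point if, for some $M$, it is an accumulation point of $\Phi_M$ in $D$. Assume $(H_R)$: whenever $\psi\in\bigcup_M\Phi_M$ is a branching point and $k=\dim\ker\big((-1)^{m+1}\Delta^m+f'(\psi)\big)\ge1$ (kernel in $D$), there are $M$ and a $k$-dimensional $C^1$ surface in $D$ through $\psi$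 that is contained in $\Phi_M$. Let $u\in C((0,\infty);D)$ be differentiable as an $L^2(\Omega)$-valued function, satisfy $$u_t=(-1)^{m+1}\Delta^m u+f(u),\qquad t>0,$$ and let $|u(t)|\le M$ a.e. in $\Omega$ for all $t>0$. Then there is $\psi\in\Phi_M$ with $u(t)\to\psi$ in $D$ as $t\to\infty$. If the kernel of $(-1)^{m+1}\Delta^m+f'(\psi)$ is trivial or $\psi$ is a branching point, then $\|u(t)-\psi\|_{L^2(\Omega)}\le Ce^{-\delta t}$ for all $t>0$, with some constants $C$ and $\delta>0$. -/

import Mathlib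

open Filter Topology MeasureTheory
open scoped ContDiff Laplacian InnerProductSpace

noncomputable section

namespace GradientFlow

/-! ### Gradient systems in a Hilbert space -/

section Abstract

variable {H X : Type*} [NormedAddCommGroup H] [InnerProductSpace ℝ H]
  [NormedAddCommGroup X] [NormedSpace ℝ X]

/-- `ι : X → H` is the dense, compact embedding of the domain `X = D(V')` into `H`, the functional
`V` is of class `C²` on `X`, and `V' : X → H` is its gradient with respect to the inner product
of `H`; `V'` is of class `C¹`, so that the linearization `V''(u) = fderiv ℝ V' u` is a bounded
operator `X → H`. -/
structure IsGradientSystem (ι : X →L[ℝ] H) (V : X → ℝ) (V' : X → H) : Prop where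
  injective : Function.Injective ι
  denseRange : DenseRange ι
  compact : IsCompactOperator ι
  contDiff_functional : ContDiff ℝ 2 V
  gradient : ∀ u v : X, fderiv ℝ V u v = ⟪V' u, ι v⟫_ℝ
  contDiff_gradient : ContDiff ℝ 1 V'

/-- A Fredholm operator whose index `dim ker L - dim coker L` vanishes. -/
def IsFredholmIndexZero (L : X →L[ℝ] H) : Prop :=
  L.IsFredholm ∧ Module.finrank ℝ L.ker = Module.finrank ℝ (H ⧸ L.range)

/-- `R` is the resolvent `(A - c)⁻¹` of the unbounded operator `A`. -/
def IsResolvent (A : H →ₗ.[ℝ] H) (c : ℝ) (R : H →L[ℝ] H) : Prop :=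
  (∀ y : H, ∃ h : R y ∈ A.domain, A ⟨R y, h⟩ - c • R y = y) ∧
    ∀ x : A.domain, R (A x - c • (x : H)) = x

/-- The (real) spectrum of an unbounded operator. -/
def unboundedSpectrum (A : H →ₗ.[ℝ] H) : Set ℝ :=
  {c | ¬ ∃ R : H →L[ℝ] H, IsResolvent A c R}

/-- The eigenspace of an unbounded operator, as a subspace of `H`. -/
def unboundedEigenspace (A : H →ₗ.[ℝ] H) (c : ℝ) : Submodule ℝ H :=
  (LinearMap.ker (A.toFun - c • A.domain.subtype)).map A.domain.subtype

/-- The spectrum of `A` consists of isolated eigenvalues of finite multiplicity. -/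
def HasDiscreteSpectrum (A : H →ₗ.[ℝ] H) : Prop :=
  (∀ c : ℝ, ¬ AccPt c (𝓟 (unboundedSpectrum A))) ∧
    ∀ c ∈ unboundedSpectrum A,
      unboundedEigenspace A c ≠ ⊥ ∧ FiniteDimensional ℝ (unboundedEigenspace A c)

/-- `L : X → H`, regarded as an operator in `H` with domain `ι X`, has a self-adjoint extension
with discrete spectrum, compact resolvent and a complete set of eigenfunctions. -/
def HasDiscreteSelfAdjointExtension [CompleteSpace H] (ι L : X →L[ℝ] H) : Prop :=
  ∃ A : H →ₗ.[ℝ] H,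
    IsSelfAdjoint A ∧
    (∀ x : X, ∃ h : ι x ∈ A.domain, A ⟨ι x, h⟩ = L x) ∧
    HasDiscreteSpectrum A ∧
    (∃ c : ℝ, ∃ R : H →L[ℝ] H, IsResolvent A c R ∧ IsCompactOperator R) ∧
    (⨆ c : ℝ, unboundedEigenspace A c).topologicalClosure = ⊤

/-- The set of equilibria. -/
def equilibria (V' : X → H) : Set X := {ψ | V' ψ = 0}

/-- `S` contains a `k`-dimensional `C¹` surface through `ψ`, given by local coordinates
`μ ↦ ψ_μ`, `μ ∈ ℝᵏ` near `0`, `ψ_0 = ψ`. -/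
def HasSurfaceThrough (S : Set X) (ψ : X) (k : ℕ) : Prop :=
  ∃ p : EuclideanSpace ℝ (Fin k) → X,
    p 0 = ψ ∧ ContDiffAt ℝ 1 p 0 ∧ Function.Injective (fderiv ℝ p 0) ∧ ∀ᶠ μ in 𝓝 0, p μ ∈ S

/-- Resonance branching: at every equilibrium `ψ` at which branching occurs (that is, `ψ` is not
isolated among the equilibria) and `dim ker V''(ψ) = k ≥ 1`, the equilibria form a `k`-dimensional
surface through `ψ`. -/
def ResonanceBranching (V' : X → H) : Prop :=
  ∀ ψ ∈ equilibria V', AccPt ψ (𝓟 (equilibria V')) →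
    1 ≤ Module.finrank ℝ (fderiv ℝ V' ψ).ker →
    HasSurfaceThrough (equilibria V') ψ (Module.finrank ℝ (fderiv ℝ V' ψ).ker)

/-- A global orbit of `u_t = V'(u)`, `t > 0`, of a smooth flow. The last condition is the smoothing
property of such flows: along the orbit, as `t → ∞`, convergence in `H` implies convergence
in the domain `X`. -/
structure IsSmoothOrbit (ι : X →L[ℝ] H) (V' : X → H) (u : ℝ → X) : Prop where
  continuousOn : ContinuousOn u (Set.Ioi 0)
  equation : ∀ t > 0, HasDerivAt (fun s => ι (u s)) (V' (u t)) t
  smoothing : ∀ s : ℕ → ℝ, Tendsto s atTop atTop →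
    CauchySeq (fun n => ι (u (s n))) → CauchySeq (fun n => u (s n))

/-- `v(t)` converges to `a` exponentially fast. -/
def ConvergesExponentially (v : ℝ → H) (a : H) : Prop :=
  ∃ C δ : ℝ, 0 < δ ∧ ∀ t > 0, ‖v t - a‖ ≤ C * Real.exp (-(δ * t))

end Abstract

/-! ### The parabolic equation `u_t = (-1)^(m+1) Δ^m u + f(u)` with Dirichlet conditions -/

section Polyharmonic

variable {N : ℕ}

/-- The real space `L²(Ω)`. -/
abbrev L2 (Ω : Set (EuclideanSpace ℝ (Fin N))) : Type := Lp ℝ 2 (volume.restrict Ω)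

/-- Test functions: smooth, with compact support in `Ω`. -/
structure IsTest (Ω : Set (EuclideanSpace ℝ (Fin N))) (φ : EuclideanSpace ℝ (Fin N) → ℝ) :
    Prop where
  contDiff : ContDiff ℝ ∞ φ
  hasCompactSupport : HasCompactSupport φ
  tsupport_subset : tsupport φ ⊆ Ω

/-- `u ∈ H₀ᵐ(Ω)`: `u` is a limit of test functions in the norm of `Hᵐ(Ω)`. -/
def MemH0 (Ω : Set (EuclideanSpace ℝ (Fin N))) (m : ℕ) (u : L2 Ω) : Prop :=
  ∃ φ : ℕ → EuclideanSpace ℝ (Fin N) → ℝ,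
    (∀ n, IsTest Ω (φ n)) ∧
    Tendsto (fun n => eLpNorm (fun x => φ n x - u x) 2 (volume.restrict Ω)) atTop (𝓝 0) ∧
    ∀ k ≤ m, Tendsto (fun q : ℕ × ℕ =>
      eLpNorm (iteratedFDeriv ℝ k (φ q.1 - φ q.2)) 2 (volume.restrict Ω)) atTop (𝓝 0)

/-- The `m`-th power of the Laplacian of a smooth function. -/
def iterLaplacian (m : ℕ) (φ : EuclideanSpace ℝ (Fin N) → ℝ) : EuclideanSpace ℝ (Fin N) → ℝ :=
  (fun g : EuclideanSpace ℝ (Fin N) → ℝ => Δ g)^[m] φ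

/-- `g = (-1)^(m+1) Δ^m u` in the sense of distributions in `Ω`. -/
def IsWeakPolyharmonic (Ω : Set (EuclideanSpace ℝ (Fin N))) (m : ℕ) (u g : L2 Ω) : Prop :=
  ∀ φ, IsTest Ω φ →
    ∫ x in Ω, g x * φ x = (-1) ^ (m + 1) * ∫ x in Ω, u x * iterLaplacian m φ x

theorem MemH0.zero (Ω : Set (EuclideanSpace ℝ (Fin N))) (m : ℕ) : MemH0 Ω m 0 := by
  refine ⟨fun _ => 0, fun n => ⟨contDiff_const, HasCompactSupport.zero, by simp [tsupport]⟩, ?_, ?_⟩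
  · have : eLpNorm ((0 : EuclideanSpace ℝ (Fin N) → ℝ) - ((0 : L2 Ω) : _ → ℝ)) 2
        (volume.restrict Ω) = 0 := by
      rw [eLpNorm_congr_ae (g := 0)]
      · simp
      · filter_upwards [Lp.coeFn_zero ℝ 2 (volume.restrict Ω)] with x hx
        rw [Pi.sub_apply, hx]
        simp
    exact tendsto_const_nhds.congr fun n => this.symm
  · intro k _
    simp only [sub_self]
    have : iteratedFDeriv ℝ k (0 : EuclideanSpace ℝ (Fin N) → ℝ) = 0 := by
      ext1 x
      simp
    simp [this]

theorem IsTest.add {Ω : Set (EuclideanSpace ℝ (Fin N))} {φ χ : EuclideanSpace ℝ (Fin N) → ℝ}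
    (hφ : IsTest Ω φ) (hχ : IsTest Ω χ) : IsTest Ω (φ + χ) :=
  ⟨hφ.contDiff.add hχ.contDiff, hφ.hasCompactSupport.add hχ.hasCompactSupport,
    (tsupport_add φ χ).trans (Set.union_subset hφ.tsupport_subset hχ.tsupport_subset)⟩

theorem IsTest.const_smul {Ω : Set (EuclideanSpace ℝ (Fin N))}
    {φ : EuclideanSpace ℝ (Fin N) → ℝ} (c : ℝ) (hφ : IsTest Ω φ) : IsTest Ω (c • φ) :=
  ⟨hφ.contDiff.const_smul c,
    hφ.hasCompactSupport.mono (Function.support_const_smul_subset c φ),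
    (closure_mono (Function.support_const_smul_subset c φ)).trans hφ.tsupport_subset⟩

theorem IsTest.continuous_iteratedFDeriv {Ω : Set (EuclideanSpace ℝ (Fin N))}
    {φ χ : EuclideanSpace ℝ (Fin N) → ℝ} (hφ : IsTest Ω φ) (hχ : IsTest Ω χ) (k : ℕ) :
    Continuous (iteratedFDeriv ℝ k (φ - χ)) :=
  (hφ.contDiff.sub hχ.contDiff).continuous_iteratedFDeriv (by exact_mod_cast le_top)

theorem MemH0.add {Ω : Set (EuclideanSpace ℝ (Fin N))} {m : ℕ} {u v : L2 Ω}
    (hu : MemH0 Ω m u) (hv : MemH0 Ω m v) : MemH0 Ω m (u + v) := by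
  obtain ⟨φ, hφ, hφu, hφc⟩ := hu
  obtain ⟨χ, hχ, hχv, hχc⟩ := hv
  refine ⟨fun n => φ n + χ n, fun n => (hφ n).add (hχ n), ?_, ?_⟩
  · refine tendsto_of_tendsto_of_tendsto_of_le_of_le tendsto_const_nhds
      (by simpa using hφu.add hχv) (fun n => zero_le) (fun n => ?_)
    have h : (φ n + χ n - ((u + v : L2 Ω) : _ → ℝ)) =ᵐ[volume.restrict Ω]
        (φ n - (u : _ → ℝ)) + (χ n - (v : _ → ℝ)) := by
      filter_upwards [Lp.coeFn_add u v] with x hx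
      simp only [Pi.sub_apply, Pi.add_apply] at hx ⊢
      rw [hx]; ring
    change eLpNorm (φ n + χ n - ((u + v : L2 Ω) : _ → ℝ)) 2 (volume.restrict Ω) ≤ _
    rw [eLpNorm_congr_ae h]
    exact eLpNorm_add_le
      ((hφ n).contDiff.continuous.aestronglyMeasurable.sub (Lp.aestronglyMeasurable u))
      ((hχ n).contDiff.continuous.aestronglyMeasurable.sub (Lp.aestronglyMeasurable v))
      (by norm_num)
  · intro k hk
    refine tendsto_of_tendsto_of_tendsto_of_le_of_le tendsto_const_nhds
      (by simpa using (hφc k hk).add (hχc k hk)) (fun q => zero_le) (fun q => ?_)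
    have h : iteratedFDeriv ℝ k (φ q.1 + χ q.1 - (φ q.2 + χ q.2)) =
        iteratedFDeriv ℝ k (φ q.1 - φ q.2) + iteratedFDeriv ℝ k (χ q.1 - χ q.2) := by
      rw [← iteratedFDeriv_add]
      · congr 1; abel
      · exact ((hφ _).contDiff.sub (hφ _).contDiff).of_le (by exact_mod_cast le_top)
      · exact ((hχ _).contDiff.sub (hχ _).contDiff).of_le (by exact_mod_cast le_top)
    change eLpNorm (iteratedFDeriv ℝ k (φ q.1 + χ q.1 - (φ q.2 + χ q.2))) 2
      (volume.restrict Ω) ≤ _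
    rw [h]
    exact eLpNorm_add_le
      ((hφ _).continuous_iteratedFDeriv (hφ _) k).aestronglyMeasurable
      ((hχ _).continuous_iteratedFDeriv (hχ _) k).aestronglyMeasurable (by norm_num)

theorem MemH0.const_smul {Ω : Set (EuclideanSpace ℝ (Fin N))} {m : ℕ} {u : L2 Ω} (c : ℝ)
    (hu : MemH0 Ω m u) : MemH0 Ω m (c • u) := by
  obtain ⟨φ, hφ, hφu, hφc⟩ := hu
  refine ⟨fun n => c • φ n, fun n => (hφ n).const_smul c, ?_, ?_⟩
  · have h : ∀ n, eLpNorm (c • φ n - ((c • u : L2 Ω) : _ → ℝ)) 2 (volume.restrict Ω) =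
        ‖c‖ₑ * eLpNorm (φ n - (u : _ → ℝ)) 2 (volume.restrict Ω) := by
      intro n
      rw [← eLpNorm_const_smul]
      refine eLpNorm_congr_ae ?_
      filter_upwards [Lp.coeFn_smul c u] with x hx
      simp only [Pi.sub_apply, Pi.smul_apply] at hx ⊢
      rw [hx, smul_sub]
    have h' := ENNReal.Tendsto.const_mul (a := ‖c‖ₑ) hφu (Or.inr (by simp))
    rw [mul_zero] at h'
    exact h'.congr fun n => (h n).symm
  · intro k hk
    have h : ∀ q : ℕ × ℕ, eLpNorm (iteratedFDeriv ℝ k (c • φ q.1 - c • φ q.2)) 2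
        (volume.restrict Ω) =
        ‖c‖ₑ * eLpNorm (iteratedFDeriv ℝ k (φ q.1 - φ q.2)) 2 (volume.restrict Ω) := by
      intro q
      rw [← eLpNorm_const_smul, ← smul_sub]
      congr 1
      ext1 x
      exact iteratedFDeriv_const_smul_apply
        (((hφ _).contDiff.sub (hφ _).contDiff).of_le (by exact_mod_cast le_top)).contDiffAt
    simp only [h]
    simpa using ENNReal.Tendsto.const_mul (hφc k hk) (Or.inr (by simp))

theorem IsTest.laplacian {Ω : Set (EuclideanSpace ℝ (Fin N))}
    {φ : EuclideanSpace ℝ (Fin N) → ℝ} (hφ : IsTest Ω φ) : IsTest Ω (Δ φ) := by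
  have hs : tsupport (Δ φ) ⊆ tsupport φ := by
    refine closure_minimal (fun x hx => ?_) (isClosed_tsupport φ)
    by_contra hx'
    apply hx
    have h0 : iteratedFDeriv ℝ 2 φ x = 0 := by
      by_contra h
      exact hx' (support_iteratedFDeriv_subset (𝕜 := ℝ) 2 h)
    rw [InnerProductSpace.laplacian_eq_iteratedFDeriv_stdOrthonormalBasis]
    simp [h0]
  refine ⟨?_, hφ.hasCompactSupport.mono' ((subset_tsupport _).trans hs),
    hs.trans hφ.tsupport_subset⟩
  rw [InnerProductSpace.laplacian_eq_iteratedFDeriv_stdOrthonormalBasis]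
  refine ContDiff.sum fun i _ => ?_
  have h : ContDiff ℝ ∞ (iteratedFDeriv ℝ 2 φ) :=
    hφ.contDiff.iteratedFDeriv_right (m := ∞) (i := 2) (by norm_cast)
  exact (ContinuousMultilinearMap.apply ℝ (fun _ : Fin 2 => EuclideanSpace ℝ (Fin N)) ℝ
    ![stdOrthonormalBasis ℝ (EuclideanSpace ℝ (Fin N)) i,
      stdOrthonormalBasis ℝ (EuclideanSpace ℝ (Fin N)) i]).contDiff.comp h

theorem IsTest.iterLaplacian {Ω : Set (EuclideanSpace ℝ (Fin N))} (m : ℕ)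
    {φ : EuclideanSpace ℝ (Fin N) → ℝ} (hφ : IsTest Ω φ) : IsTest Ω (iterLaplacian m φ) := by
  induction m generalizing φ with
  | zero => exact hφ
  | succ m ih => exact ih hφ.laplacian

theorem IsTest.integrable_mul {Ω : Set (EuclideanSpace ℝ (Fin N))}
    {φ : EuclideanSpace ℝ (Fin N) → ℝ} (hφ : IsTest Ω φ) (u : L2 Ω) :
    Integrable (fun x => u x * φ x) (volume.restrict Ω) :=
  MemLp.integrable_mul (p := 2) (q := 2) (Lp.memLp u) (hφ.contDiff.continuous.memLp_of_hasCompactSupport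
    hφ.hasCompactSupport)

theorem IsWeakPolyharmonic.zero (Ω : Set (EuclideanSpace ℝ (Fin N))) (m : ℕ) :
    IsWeakPolyharmonic Ω m 0 0 := by
  intro φ _
  have h : ∀ χ : EuclideanSpace ℝ (Fin N) → ℝ, ∫ x in Ω, ((0 : L2 Ω) : _ → ℝ) x * χ x = 0 := by
    intro χ
    rw [integral_congr_ae (g := fun _ => (0 : ℝ))]
    · simp
    · filter_upwards [Lp.coeFn_zero ℝ 2 (volume.restrict Ω)] with x hx
      rw [hx]
      simp
  rw [h, h, mul_zero]

theorem IsWeakPolyharmonic.add {Ω : Set (EuclideanSpace ℝ (Fin N))} {m : ℕ} {u g v h : L2 Ω}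
    (hu : IsWeakPolyharmonic Ω m u g) (hv : IsWeakPolyharmonic Ω m v h) :
    IsWeakPolyharmonic Ω m (u + v) (g + h) := by
  intro φ hφ
  have key : ∀ (χ : EuclideanSpace ℝ (Fin N) → ℝ), IsTest Ω χ → ∀ a b : L2 Ω,
      ∫ x in Ω, ((a + b : L2 Ω) : _ → ℝ) x * χ x =
        (∫ x in Ω, a x * χ x) + ∫ x in Ω, b x * χ x := by
    intro χ hχ a b
    rw [← integral_add (hχ.integrable_mul a) (hχ.integrable_mul b)]
    refine integral_congr_ae ?_
    filter_upwards [Lp.coeFn_add a b] with x hx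
    rw [hx, Pi.add_apply, add_mul]
  rw [key φ hφ, key _ (hφ.iterLaplacian m), hu φ hφ, hv φ hφ, mul_add]

theorem IsWeakPolyharmonic.const_smul {Ω : Set (EuclideanSpace ℝ (Fin N))} {m : ℕ} {u g : L2 Ω}
    (c : ℝ) (hu : IsWeakPolyharmonic Ω m u g) : IsWeakPolyharmonic Ω m (c • u) (c • g) := by
  intro φ hφ
  have key : ∀ (χ : EuclideanSpace ℝ (Fin N) → ℝ) (a : L2 Ω),
      ∫ x in Ω, ((c • a : L2 Ω) : _ → ℝ) x * χ x = c * ∫ x in Ω, a x * χ x := by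
    intro χ a
    rw [← integral_const_mul]
    refine integral_congr_ae ?_
    filter_upwards [Lp.coeFn_smul c a] with x hx
    rw [hx, Pi.smul_apply, smul_eq_mul, mul_assoc]
  rw [key, key, hu φ hφ]
  ring

/-- The domain of the Dirichlet realization of `(-1)^(m+1) Δ^m` in `L²(Ω)`,
`{u ∈ H₀ᵐ(Ω) : Δ^m u ∈ L²(Ω)}` (this is `H²ᵐ(Ω) ∩ H₀ᵐ(Ω)` if `∂Ω` is smooth), with the graph norm:
`x = (u, (-1)^(m+1) Δ^m u)`. -/
def dirichletDomain (Ω : Set (EuclideanSpace ℝ (Fin N))) (m : ℕ) : Submodule ℝ (L2 Ω × L2 Ω) where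
  carrier := {x | MemH0 Ω m x.1 ∧ IsWeakPolyharmonic Ω m x.1 x.2}
  zero_mem' := ⟨MemH0.zero Ω m, IsWeakPolyharmonic.zero Ω m⟩
  add_mem' := fun hx hy => ⟨hx.1.add hy.1, hx.2.add hy.2⟩
  smul_mem' := fun c _ hx => ⟨hx.1.const_smul c, hx.2.const_smul c⟩

variable {Ω : Set (EuclideanSpace ℝ (Fin N))} {m : ℕ}

/-- The element of `L²(Ω)` underlying an element of the domain. -/
def toL2 (u : dirichletDomain Ω m) : L2 Ω := u.1.1

/-- The function `(-1)^(m+1) Δ^m u ∈ L²(Ω)`. -/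
def polyLaplacian (u : dirichletDomain Ω m) : L2 Ω := u.1.2

/-- `|u| ≤ M` almost everywhere in `Ω`. -/
def BoundedBy (M : ℝ) (u : dirichletDomain Ω m) : Prop :=
  ∀ᵐ x ∂(volume.restrict Ω), |toL2 u x| ≤ M

/-- The solutions of `(-1)^(m+1) Δ^m ψ + f(ψ) = 0` that are bounded by `M`. -/
def pdeEquilibria (Ω : Set (EuclideanSpace ℝ (Fin N))) (m : ℕ) (f : ℝ → ℝ) (M : ℝ) :
    Set (dirichletDomain Ω m) :=
  {ψ | BoundedBy M ψ ∧ ∀ᵐ x ∂(volume.restrict Ω), polyLaplacian ψ x + f (toL2 ψ x) = 0}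

/-- The kernel of the linearized operator `(-1)^(m+1) Δ^m + f'(ψ) I`. -/
def pdeKernel (f : ℝ → ℝ) (ψ : dirichletDomain Ω m) : Submodule ℝ (dirichletDomain Ω m) where
  carrier := {v | ∀ᵐ x ∂(volume.restrict Ω),
    polyLaplacian v x + deriv f (toL2 ψ x) * toL2 v x = 0}
  zero_mem' := by
    filter_upwards [Lp.coeFn_zero ℝ 2 (volume.restrict Ω)] with x hx
    change ((0 : L2 Ω) : _ → ℝ) x + _ * ((0 : L2 Ω) : _ → ℝ) x = 0
    rw [hx]
    simp
  add_mem' := by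
    intro v w hv hw
    filter_upwards [hv, hw, Lp.coeFn_add v.1.1 w.1.1, Lp.coeFn_add v.1.2 w.1.2] with x h1 h2 h3 h4
    change ((v.1.2 + w.1.2 : L2 Ω) : _ → ℝ) x + _ * ((v.1.1 + w.1.1 : L2 Ω) : _ → ℝ) x = 0
    simp only [polyLaplacian, toL2] at h1 h2 ⊢
    rw [h3, h4, Pi.add_apply, Pi.add_apply]
    linear_combination h1 + h2
  smul_mem' := by
    intro c v hv
    filter_upwards [hv, Lp.coeFn_smul c v.1.1, Lp.coeFn_smul c v.1.2] with x h1 h3 h4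
    change ((c • v.1.2 : L2 Ω) : _ → ℝ) x + _ * ((c • v.1.1 : L2 Ω) : _ → ℝ) x = 0
    simp only [polyLaplacian, toL2] at h1 ⊢
    rw [h3, h4, Pi.smul_apply, Pi.smul_apply, smul_eq_mul, smul_eq_mul]
    linear_combination c * h1

/-- `ψ` is a branching point: it is the limit of a uniformly bounded family of other equilibria. -/
def PdeBranchingAt (f : ℝ → ℝ) (ψ : dirichletDomain Ω m) : Prop :=
  ∃ M : ℝ, AccPt ψ (𝓟 (pdeEquilibria Ω m f M))

/-- Resonance branching for the equation `(-1)^(m+1) Δ^m ψ + f(ψ) = 0`. -/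
def PdeResonanceBranching (Ω : Set (EuclideanSpace ℝ (Fin N))) (m : ℕ) (f : ℝ → ℝ) : Prop :=
  ∀ M₀ : ℝ, ∀ ψ ∈ pdeEquilibria Ω m f M₀, PdeBranchingAt f ψ →
    1 ≤ Module.finrank ℝ (pdeKernel f ψ) →
    ∃ M : ℝ, HasSurfaceThrough (pdeEquilibria Ω m f M) ψ (Module.finrank ℝ (pdeKernel f ψ))

/-- A global solution of `u_t = (-1)^(m+1) Δ^m u + f(u)`, `t > 0`. -/
structure IsPdeOrbit (f : ℝ → ℝ) (u : ℝ → dirichletDomain Ω m) : Prop where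
  continuousOn : ContinuousOn u (Set.Ioi 0)
  equation : ∀ t > 0, ∃ g : L2 Ω, HasDerivAt (fun s => toL2 (u s)) g t ∧
    ∀ᵐ x ∂(volume.restrict Ω), g x = polyLaplacian (u t) x + f (toL2 (u t) x)

end Polyharmonic

end GradientFlow

end

set_option linter.unusedSectionVars false

namespace GradientFlow

/-! ### Convergence of orbits along which an energy is dissipated -/

section Dissipation

variable {H : Type*} [NormedAddCommGroup H] [InnerProductSpace ℝ H]

/-! The energy grows along an orbit at the rate `‖u_t‖²`, and the orbit is precompact in the domain.
So the energy converges to its value at any limit point, and limit points are equilibria. Let `ψ` be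
a limit point. If it is isolated among the equilibria, continuity in time suffices: an orbit that
kept leaving `ψ` would cross a small sphere around it at arbitrarily late times and produce another
equilibrium there (`PrecompactAtTop.tendsto_of_isolated`).

If the kernel is trivial or branching occurs, a surface of equilibria whose dimension is that of the
kernel passes through `ψ` (the point itself in dimension 0). Its tangent space lies in the kernel,
hence fills it. So every `x` near `ψ` has a partner `y` on the surface with `x - y` in a complement
of the kernel, where the linearization is bounded below; thus `‖x - y‖ ≤ C ‖V' x‖`. The energy is
constant on the surface and `V x - V y` is quadratic in `x - y`, which gives the Łojasiewicz
inequality `|V x - V ψ| ≤ C ‖V' x‖²` (`lojasiewicz_of_surface`). It bounds the remaining distance by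
the remaining energy and makes the latter decay exponentially (`exists_exp_bound_of_lojasiewicz`).

For gradient systems precompactness is the compact embedding combined with smoothing. For the
parabolic equation it is proved: on bounded solutions `f` may be replaced by a Lipschitz function,
the speed grows at most exponentially while the energy is bounded, so the speed tends to zero
(`tendsto_vectorField`); then the equation bounds `Δ^m u`, and the domain embeds compactly in `L²`,
which is shown by Fourier analysis (`exists_subseq_cauchySeq_resMap`). Superposition operators are
in general not differentiable on `L²`; measured in the graph norm and relative to uniformly bounded
functions they are (`eventually_norm_superposition_sub_le`), which is enough. -/

theorem sq_le_of_forall_two_mul_le {x a h : ℝ} (hx : 0 ≤ x) (ha : 0 ≤ a) (hh : 0 ≤ h)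
    (H : ∀ l > 0, 2 * x ≤ l * h + a / l) : x ^ 2 ≤ a * h := by
  rcases hx.eq_or_lt with rfl | hx
  · simpa using mul_nonneg ha hh
  rcases ha.eq_or_lt with rfl | ha
  · exfalso
    rcases hh.eq_or_lt with rfl | hh
    · have := H 1 one_pos
      linarith
    · have := H (x / h) (by positivity)
      rw [div_mul_cancel₀ _ hh.ne'] at this
      simp at this
      linarith
  have h1 := H (a / x) (by positivity)
  have h2 : a / (a / x) = x := by field_simp
  have h3 : a / x * h = a * h / x := by ring
  rw [h2, h3] at h1
  have h4 : x ≤ a * h / x := by linarith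
  rw [le_div_iff₀ hx] at h4
  nlinarith

/-- Testing against unit vectors reduces length estimates for curves to the monotonicity of scalar
functions, so the velocity, of which no continuity is assumed, is never integrated. -/
theorem norm_le_of_forall_inner_le {d : H} {c : ℝ} (hc : ∀ e : H, ‖e‖ = 1 → 2 * ⟪d, e⟫_ℝ ≤ c)
    (h0 : 0 ≤ c) : 2 * ‖d‖ ≤ c := by
  by_cases hd : d = 0
  · simpa [hd] using h0
  have hn : ‖d‖ ≠ 0 := norm_ne_zero_iff.2 hd
  have := hc (‖d‖⁻¹ • d) (by rw [norm_smul, norm_inv, norm_norm, inv_mul_cancel₀ hn])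
  rwa [real_inner_smul_right, real_inner_self_eq_norm_sq, pow_two, inv_mul_cancel_left₀ hn] at this

/-! ### A curve `v` with velocity `g` and energy gain `E' = ‖g‖²`. -/

variable {v g : ℝ → H} {E : ℝ → ℝ}

theorem monotoneOn_energy (hE : ∀ t > 0, HasDerivAt E (‖g t‖ ^ 2) t) :
    MonotoneOn E (Set.Ioi 0) := by
  refine monotoneOn_of_deriv_nonneg (convex_Ioi 0)
    (fun t ht => (hE t ht).continuousAt.continuousWithinAt) (fun t ht => ?_) (fun t ht => ?_)
  · rw [interior_Ioi] at ht
    exact (hE t ht).differentiableAt.differentiableWithinAt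
  · rw [interior_Ioi] at ht
    rw [(hE t ht).deriv]
    positivity

theorem energy_le_of_tendsto (hE : ∀ t > 0, HasDerivAt E (‖g t‖ ^ 2) t) {c : ℝ}
    (hc : Tendsto E atTop (𝓝 c)) {t : ℝ} (ht : 0 < t) : E t ≤ c :=
  ge_of_tendsto hc ((eventually_ge_atTop t).mono fun _ hs =>
    monotoneOn_energy hE ht (ht.trans_le hs) hs)

/-- The distance travelled in `H` is controlled by the gain of energy. -/
theorem norm_sub_sq_le_mul_energy_sub (hv : ∀ t > 0, HasDerivAt v (g t) t)
    (hE : ∀ t > 0, HasDerivAt E (‖g t‖ ^ 2) t) {s t : ℝ} (hs : 0 < s) (hst : s ≤ t) :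
    ‖v t - v s‖ ^ 2 ≤ (t - s) * (E t - E s) := by
  have hEst : E s ≤ E t := monotoneOn_energy hE hs (hs.trans_le hst) hst
  refine sq_le_of_forall_two_mul_le (norm_nonneg _) (sub_nonneg.2 hst) (sub_nonneg.2 hEst)
    fun l hl => ?_
  refine norm_le_of_forall_inner_le (fun e he => ?_)
    (add_nonneg (mul_nonneg hl.le (sub_nonneg.2 hEst)) (div_nonneg (sub_nonneg.2 hst) hl.le))
  -- This function decreases because `2‖g‖ ≤ l‖g‖² + 1/l`. Optimizing over `l` afterwards plays the
  -- role of the Cauchy–Schwarz inequality for `∫ ‖g‖`.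
  have hd : ∀ r > 0, HasDerivAt (fun r => 2 * ⟪v r, e⟫_ℝ - l * E r - r / l)
      (2 * ⟪g r, e⟫_ℝ - l * ‖g r‖ ^ 2 - 1 / l) r := by
    intro r hr
    have h1 := (hv r hr).inner ℝ (hasDerivAt_const r e)
    simp only [inner_zero_right, zero_add] at h1
    exact ((h1.const_mul 2).sub ((hE r hr).const_mul l)).sub ((hasDerivAt_id r).div_const l)
  have hanti : AntitoneOn (fun r => 2 * ⟪v r, e⟫_ℝ - l * E r - r / l) (Set.Icc s t) := by
    refine antitoneOn_of_deriv_nonpos (convex_Icc s t)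
      (fun r hr => (hd r (hs.trans_le hr.1)).continuousAt.continuousWithinAt)
      (fun r hr => ?_) (fun r hr => ?_)
    · rw [interior_Icc] at hr
      exact (hd r (hs.trans hr.1)).differentiableAt.differentiableWithinAt
    · rw [interior_Icc] at hr
      rw [(hd r (hs.trans hr.1)).deriv]
      have h1 : ⟪g r, e⟫_ℝ ≤ ‖g r‖ := by
        simpa [he] using real_inner_le_norm (g r) e
      have h2 : 0 ≤ (l * ‖g r‖ - 1) ^ 2 / l := by positivity
      have h3 : (l * ‖g r‖ - 1) ^ 2 / l = l * ‖g r‖ ^ 2 - 2 * ‖g r‖ + 1 / l := by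
        field_simp
        ring
      linarith
  have := hanti (Set.left_mem_Icc.2 hst) (Set.right_mem_Icc.2 hst) hst
  simp only at this
  rw [inner_sub_left, sub_div]
  linarith

/-- A weighted Cauchy–Schwarz inequality in disguise. The gap `c - E` decays at rate `1/C`; with a
weight growing at half that rate, `b = 1/(2C)`, one has `∫ exp(b(r-s)) ‖g‖² ≤ 2(c - E s)` and `∫
exp(-b(r-s)) ≤ 2C`. The bound does not depend on `t - s`. -/
theorem norm_sub_sq_le_of_lojasiewicz (hv : ∀ t > 0, HasDerivAt v (g t) t)
    (hE : ∀ t > 0, HasDerivAt E (‖g t‖ ^ 2) t) {c C : ℝ} (hc : Tendsto E atTop (𝓝 c))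
    (hC : 0 < C) {s t : ℝ} (hs : 0 < s) (hst : s ≤ t)
    (hloj : ∀ r ∈ Set.Ioo s t, c - E r ≤ C * ‖g r‖ ^ 2) :
    ‖v t - v s‖ ^ 2 ≤ 4 * C * (c - E s) := by
  have hEs : 0 ≤ c - E s := sub_nonneg.2 (energy_le_of_tendsto hE hc hs)
  have hEt : 0 ≤ c - E t := sub_nonneg.2 (energy_le_of_tendsto hE hc (hs.trans_le hst))
  refine sq_le_of_forall_two_mul_le (norm_nonneg _) (by positivity) hEs fun l hl => ?_
  refine norm_le_of_forall_inner_le (fun e he => ?_) (by positivity)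
  set b : ℝ := 1 / (2 * C) with hb
  have hb0 : 0 < b := by positivity
  -- With `y = exp(b(r-s))`, completing the square gives `F' ≤ -(l y ‖g‖ - 2)² / (2 l y) ≤ 0`.
  set F : ℝ → ℝ := fun r => 2 * ⟪v r, e⟫_ℝ + l * (Real.exp (b * (r - s)) * (c - E r)) +
    4 * C / l * Real.exp (-(b * (r - s))) with hF
  have hd : ∀ r > 0, HasDerivAt F
      (2 * ⟪g r, e⟫_ℝ + l * (Real.exp (b * (r - s)) * b * (c - E r) +
        Real.exp (b * (r - s)) * (-‖g r‖ ^ 2)) +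
        4 * C / l * (Real.exp (-(b * (r - s))) * -b)) r := by
    intro r hr
    have h1 := (hv r hr).inner ℝ (hasDerivAt_const r e)
    simp only [inner_zero_right, zero_add] at h1
    have h2 : HasDerivAt (fun r => b * (r - s)) b r := by
      simpa using ((hasDerivAt_id r).sub_const s).const_mul b
    exact ((h1.const_mul 2).add ((h2.exp.mul ((hE r hr).const_sub c)).const_mul l)).add
      (h2.neg.exp.const_mul _)
  have hanti : AntitoneOn F (Set.Icc s t) := by
    refine antitoneOn_of_deriv_nonpos (convex_Icc s t)
      (fun r hr => (hd r (hs.trans_le hr.1)).continuousAt.continuousWithinAt)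
      (fun r hr => ?_) (fun r hr => ?_)
    · rw [interior_Icc] at hr
      exact (hd r (hs.trans hr.1)).differentiableAt.differentiableWithinAt
    · rw [interior_Icc] at hr
      rw [(hd r (hs.trans hr.1)).deriv]
      have h1 : ⟪g r, e⟫_ℝ ≤ ‖g r‖ := by
        simpa [he] using real_inner_le_norm (g r) e
      rw [Real.exp_neg]
      set y := Real.exp (b * (r - s)) with hy
      have hy0 : 0 < y := Real.exp_pos _
      have h2 : b * (c - E r) ≤ ‖g r‖ ^ 2 / 2 := by
        have := mul_le_mul_of_nonneg_left (hloj r hr) hb0.le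
        have h3 : b * (C * ‖g r‖ ^ 2) = ‖g r‖ ^ 2 / 2 := by
          rw [hb]
          field_simp
        rwa [h3] at this
      have h4 : 4 * C / l * (y⁻¹ * -b) = -(2 / (l * y)) := by
        rw [hb]
        field_simp
        norm_num
      have h5 : l * (y * (b * (c - E r))) ≤ l * (y * (‖g r‖ ^ 2 / 2)) := by gcongr
      have h6 : 0 ≤ (l * y * ‖g r‖ - 2) ^ 2 / (2 * (l * y)) := by positivity
      have h7 : (l * y * ‖g r‖ - 2) ^ 2 / (2 * (l * y)) =
          l * y * ‖g r‖ ^ 2 / 2 - 2 * ‖g r‖ + 2 / (l * y) := by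
        field_simp
        ring
      rw [h4]
      nlinarith
  have := hanti (Set.left_mem_Icc.2 hst) (Set.right_mem_Icc.2 hst) hst
  simp only [hF, sub_self, mul_zero, neg_zero, Real.exp_zero, one_mul, mul_one] at this
  rw [inner_sub_left]
  have h1 : 0 ≤ l * (Real.exp (b * (t - s)) * (c - E t)) := by positivity
  have h2 : 0 ≤ 4 * C / l * Real.exp (-(b * (t - s))) := by positivity
  linarith

/-- Grönwall's inequality for the gap: `(c - E)' = -‖g‖² ≤ -(c - E)/C`. -/
theorem energy_gap_le_exp (hE : ∀ t > 0, HasDerivAt E (‖g t‖ ^ 2) t) {c C : ℝ}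
    (hC : 0 < C) {s t : ℝ} (hs : 0 < s) (hst : s ≤ t)
    (hloj : ∀ r ∈ Set.Ioo s t, c - E r ≤ C * ‖g r‖ ^ 2) :
    c - E t ≤ (c - E s) * Real.exp (-((t - s) / C)) := by
  have hd : ∀ r > 0, HasDerivAt (fun r => Real.exp ((r - s) / C) * (c - E r))
      (Real.exp ((r - s) / C) * (1 / C) * (c - E r) +
        Real.exp ((r - s) / C) * (-‖g r‖ ^ 2)) r := by
    intro r hr
    have h2 : HasDerivAt (fun r => (r - s) / C) (1 / C) r := by
      simpa using ((hasDerivAt_id r).sub_const s).div_const C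
    exact h2.exp.mul ((hE r hr).const_sub c)
  have hanti : AntitoneOn (fun r => Real.exp ((r - s) / C) * (c - E r)) (Set.Icc s t) := by
    refine antitoneOn_of_deriv_nonpos (convex_Icc s t)
      (fun r hr => (hd r (hs.trans_le hr.1)).continuousAt.continuousWithinAt)
      (fun r hr => ?_) (fun r hr => ?_)
    · rw [interior_Icc] at hr
      exact (hd r (hs.trans hr.1)).differentiableAt.differentiableWithinAt
    · rw [interior_Icc] at hr
      rw [(hd r (hs.trans hr.1)).deriv]
      have h1 : 1 / C * (c - E r) ≤ ‖g r‖ ^ 2 := by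
        rw [one_div, inv_mul_le_iff₀ hC]
        exact hloj r hr
      have := mul_le_mul_of_nonneg_left h1 (Real.exp_pos ((r - s) / C)).le
      linarith
  have := hanti (Set.left_mem_Icc.2 hst) (Set.right_mem_Icc.2 hst) hst
  simp only [sub_self, zero_div, Real.exp_zero, one_mul] at this
  rw [Real.exp_neg, ← div_eq_mul_inv, le_div_iff₀ (Real.exp_pos _)]
  linarith

/-- If the energy satisfies a Łojasiewicz inequality with exponent `1/2` near a limit point `a`,
then `v` converges to `a` exponentially. -/
theorem exists_exp_bound_of_lojasiewicz (hv : ∀ t > 0, HasDerivAt v (g t) t)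
    (hE : ∀ t > 0, HasDerivAt E (‖g t‖ ^ 2) t) {c C : ℝ} (hc : Tendsto E atTop (𝓝 c))
    {a : H} (ha : MapClusterPt a atTop v)
    (hloj : ∀ᶠ t in atTop ⊓ comap v (𝓝 a), c - E t ≤ C * ‖g t‖ ^ 2) :
    ∃ K δ T : ℝ, 0 < δ ∧ ∀ t ≥ T, ‖v t - a‖ ≤ K * Real.exp (-(δ * t)) := by
  obtain ⟨D, hD0, hD⟩ : ∃ D > 0, ∀ᶠ t in atTop ⊓ comap v (𝓝 a), c - E t ≤ D * ‖g t‖ ^ 2 := by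
    refine ⟨max C 1, by positivity, hloj.mono fun t ht => ht.trans ?_⟩
    gcongr
    exact le_max_left _ _
  rw [((atTop_basis.inf ((Metric.nhds_basis_ball).comap v)).eventually_iff)] at hD
  obtain ⟨⟨T, δ⟩, ⟨-, hδ⟩, hT⟩ := hD
  have hT : ∀ t ≥ T, ‖v t - a‖ < δ → c - E t ≤ D * ‖g t‖ ^ 2 := fun t ht h =>
    hT ⟨ht, by simpa [dist_eq_norm] using h⟩
  have hsmall : ∀ᶠ t in atTop, 4 * D * (c - E t) < (δ / 2) ^ 2 := by
    have : Tendsto (fun t => 4 * D * (c - E t)) atTop (𝓝 (4 * D * (c - c))) :=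
      (tendsto_const_nhds.sub hc).const_mul _
    rw [sub_self, mul_zero] at this
    exact this.eventually_lt_const (by positivity)
  have hfreq : ∀ ε > 0, ∃ᶠ t in atTop, ‖v t - a‖ < ε := fun ε hε => by
    have := mapClusterPt_iff_frequently.1 ha _ (Metric.ball_mem_nhds a hε)
    exact this.mono fun t ht => by simpa [dist_eq_norm] using ht
  -- A late time at which `v` is within `δ/2` of `a` and so little energy remains that `v` can
  -- travel less than `δ/2` while the inequality holds.
  obtain ⟨s, ⟨hs1, hsT, hs0, hs2⟩⟩ := ((hfreq (δ / 2) (by positivity)).and_eventually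
    ((eventually_ge_atTop T).and ((eventually_gt_atTop 0).and hsmall))).exists
  have hvc : ContinuousOn v (Set.Ici s) := fun t ht =>
    (hv t (hs0.trans_le ht)).continuousAt.continuousWithinAt
  -- First exit time: before the first `r` at distance at least `δ` the inequality holds, so `v` is
  -- displaced by less than `δ/2` up to `r`, a contradiction.
  have hnear : ∀ t ≥ s, ‖v t - a‖ < δ := by
    by_contra! hcon
    obtain ⟨t, hts, ht⟩ := hcon
    set S : Set ℝ := Set.Ici s ∩ (fun t => ‖v t - a‖) ⁻¹' Set.Ici δ with hS
    have hScl : IsClosed S :=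
      (hvc.sub continuousOn_const).norm.preimage_isClosed_of_isClosed isClosed_Ici isClosed_Ici
    have hSb : BddBelow S := ⟨s, fun r hr => hr.1⟩
    have hmem : sInf S ∈ S := hScl.csInf_mem ⟨t, hts, ht⟩ hSb
    set r := sInf S with hr
    have h1 := norm_sub_sq_le_of_lojasiewicz hv hE hc hD0 hs0 hmem.1 (fun q hq => by
      refine hT q (hsT.trans hq.1.le) ?_
      by_contra hq'
      exact absurd (csInf_le hSb ⟨hq.1.le, not_lt.1 hq'⟩) (not_le.2 hq.2))
    have h2 : ‖v r - v s‖ < δ / 2 :=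
      lt_of_pow_lt_pow_left₀ 2 (by positivity) (h1.trans_lt hs2)
    have h3 : ‖v r - a‖ ≤ ‖v r - v s‖ + ‖v s - a‖ := norm_sub_le_norm_sub_add_norm_sub _ _ _
    have h4 : δ ≤ ‖v r - a‖ := hmem.2
    linarith
  have hall : ∀ t ≥ s, c - E t ≤ D * ‖g t‖ ^ 2 := fun t ht => hT t (hsT.trans ht) (hnear t ht)
  -- Later times at which `v` comes back arbitrarily close to `a` turn the bound on the distance
  -- travelled into a bound on the distance to `a`.
  have hdist : ∀ t ≥ s, ‖v t - a‖ ≤ √(4 * D * (c - E t)) := by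
    intro t ht
    refine le_of_forall_pos_le_add fun ε hε => ?_
    obtain ⟨r, hr1, hr2⟩ := ((hfreq ε hε).and_eventually (eventually_ge_atTop t)).exists
    have h1 := norm_sub_sq_le_of_lojasiewicz hv hE hc hD0 (hs0.trans_le ht) hr2
      (fun q hq => hall q (ht.trans hq.1.le))
    have h2 : ‖v t - v r‖ ≤ √(4 * D * (c - E t)) := by
      rw [norm_sub_rev]
      exact Real.le_sqrt_of_sq_le h1
    have h3 : ‖v t - a‖ ≤ ‖v t - v r‖ + ‖v r - a‖ := norm_sub_le_norm_sub_add_norm_sub _ _ _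
    linarith
  -- The square root halves the decay rate `1/D` of the gap; `exp (s / D)` moves the time origin
  -- from `s` to `0`.
  refine ⟨√(4 * D * ((c - E s) * Real.exp (s / D))), 1 / (2 * D), s, by positivity,
    fun t ht => (hdist t ht).trans ?_⟩
  have hEs : 0 ≤ c - E s := sub_nonneg.2 (energy_le_of_tendsto hE hc hs0)
  have h1 := energy_gap_le_exp (c := c) hE hD0 hs0 ht (fun q hq => hall q hq.1.le)
  refine Real.sqrt_le_iff.2 ⟨by positivity, ?_⟩
  rw [mul_pow, Real.sq_sqrt (by positivity), ← Real.exp_nat_mul]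
  calc 4 * D * (c - E t) ≤ 4 * D * ((c - E s) * Real.exp (-((t - s) / D))) := by gcongr
    _ = 4 * D * ((c - E s) * Real.exp (s / D)) * Real.exp ((2 : ℕ) * -(1 / (2 * D) * t)) := by
      rw [mul_assoc (4 * D), mul_assoc (c - E s), ← Real.exp_add]
      congr 3
      push_cast
      field_simp
      ring

theorem convergesExponentially_of_eventually {a : H}
    (hv : ∃ K δ T : ℝ, 0 < δ ∧ ∀ t ≥ T, ‖v t - a‖ ≤ K * Real.exp (-(δ * t)))
    (hb : ∃ B, ∀ t > 0, ‖v t‖ ≤ B) : ConvergesExponentially v a := by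
  obtain ⟨K, δ, T, hδ, hT⟩ := hv
  obtain ⟨B, hB⟩ := hb
  have hK : 0 ≤ K := by
    have := (norm_nonneg _).trans (hT T le_rfl)
    exact nonneg_of_mul_nonneg_left this (Real.exp_pos _)
  have hB0 : 0 ≤ B := (norm_nonneg _).trans (hB 1 one_pos)
  -- The second summand covers `0 < t ≤ T`, where only boundedness is available.
  refine ⟨K + (B + ‖a‖) * Real.exp (δ * |T|), δ, hδ, fun t ht => ?_⟩
  rw [add_mul]
  rcases le_total T t with h | h
  · exact (hT t h).trans (le_add_of_nonneg_right (by positivity))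
  · refine le_trans ?_ (le_add_of_nonneg_left (by positivity))
    rw [mul_assoc, ← Real.exp_add]
    have h1 : 1 ≤ Real.exp (δ * |T| + -(δ * t)) := by
      refine Real.one_le_exp ?_
      have := mul_le_mul_of_nonneg_left (h.trans (le_abs_self T)) hδ.le
      linarith
    calc ‖v t - a‖ ≤ ‖v t‖ + ‖a‖ := norm_sub_le _ _
      _ ≤ (B + ‖a‖) * 1 := by rw [mul_one]; gcongr; exact hB t ht
      _ ≤ _ := by gcongr

end Dissipation

/-! ### Orbits that are precompact at infinity -/

section Precompact

variable {H X : Type*} [NormedAddCommGroup H] [InnerProductSpace ℝ H]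
  [NormedAddCommGroup X] [NormedSpace ℝ X]

/-- Every sequence of times tending to infinity has a subsequence along which `u` converges. -/
def PrecompactAtTop (u : ℝ → X) : Prop :=
  ∀ s : ℕ → ℝ, Tendsto s atTop atTop →
    ∃ x, ∃ φ : ℕ → ℕ, StrictMono φ ∧ Tendsto (fun n => u (s (φ n))) atTop (𝓝 x)

theorem PrecompactAtTop.exists_mapClusterPt {u : ℝ → X} (hu : PrecompactAtTop u) :
    ∃ x, MapClusterPt x atTop u := by
  obtain ⟨x, φ, hφ, hx⟩ := hu (fun n => (n : ℝ)) tendsto_natCast_atTop_atTop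
  exact ⟨x, hx.mapClusterPt.of_comp (tendsto_natCast_atTop_atTop.comp hφ.tendsto_atTop)⟩

/-- At late times closeness to `ψ` in `H` forces closeness in `X`: a subsequential limit in `X` has
image `ι ψ`, hence equals `ψ` by injectivity. This transfers neighbourhoods in `X` to arguments
carried out in `H`. -/
theorem PrecompactAtTop.tendsto_comap {u : ℝ → X} (hu : PrecompactAtTop u) {ι : X →L[ℝ] H}
    (hι : Function.Injective ι) (ψ : X) :
    Tendsto u (atTop ⊓ comap (fun t => ι (u t)) (𝓝 (ι ψ))) (𝓝 ψ) := by
  refine tendsto_of_subseq_tendsto fun s hs => ?_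
  rw [tendsto_inf, tendsto_comap_iff] at hs
  obtain ⟨x, φ, hφ, hx⟩ := hu s hs.1
  have h1 : Tendsto (fun n => ι (u (s (φ n)))) atTop (𝓝 (ι x)) := (ι.continuous.tendsto x).comp hx
  have h2 : Tendsto (fun n => ι (u (s (φ n)))) atTop (𝓝 (ι ψ)) := hs.2.comp hφ.tendsto_atTop
  rw [hι (tendsto_nhds_unique h2 h1)]
  exact ⟨φ, hx⟩

theorem PrecompactAtTop.tendsto_of_tendsto {u : ℝ → X} (hu : PrecompactAtTop u) {ι : X →L[ℝ] H}
    (hι : Function.Injective ι) {ψ : X}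
    (h : Tendsto (fun t => ι (u t)) atTop (𝓝 (ι ψ))) : Tendsto u atTop (𝓝 ψ) :=
  (hu.tendsto_comap hι ψ).mono_left (le_inf le_rfl h.le_comap)

/-- A limit point that is isolated among the limit points is the limit. -/
theorem PrecompactAtTop.tendsto_of_isolated {u : ℝ → X} (hu : PrecompactAtTop u)
    (hc : ContinuousOn u (Set.Ioi 0)) {Φ : Set X} (hΦ : ∀ x, MapClusterPt x atTop u → x ∈ Φ)
    {ψ : X} (hψ : MapClusterPt ψ atTop u) (hiso : ¬ AccPt ψ (𝓟 Φ)) :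
    Tendsto u atTop (𝓝 ψ) := by
  rw [accPt_iff_frequently, not_frequently, Metric.eventually_nhds_iff] at hiso
  obtain ⟨ρ, hρ, hball⟩ := hiso
  have hval : ∀ x, MapClusterPt x atTop u → dist x ψ < ρ → x = ψ := by
    intro x hx hd
    by_contra hne
    exact hball hd ⟨hne, hΦ x hx⟩
  by_contra hnot
  rw [Metric.tendsto_nhds] at hnot
  push Not at hnot
  obtain ⟨ε, hε, hfar⟩ := hnot
  -- The orbit enters the ball of radius `r` and leaves it at arbitrarily late times, so it meets
  -- the sphere. A limit point on the sphere lies in `Φ` within distance `ρ` of `ψ` and differs from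
  -- `ψ`, which isolation forbids.
  set r := min ε (ρ / 2) with hr
  have hr0 : 0 < r := lt_min hε (by positivity)
  have hcross : ∀ n : ℕ, ∃ t ≥ (n : ℝ) + 1, dist (u t) ψ = r := by
    intro n
    obtain ⟨a, ha1, ha2⟩ := ((mapClusterPt_iff_frequently.1 hψ _
      (Metric.ball_mem_nhds ψ hr0)).and_eventually (eventually_ge_atTop ((n : ℝ) + 1))).exists
    obtain ⟨b, hb1, hb2⟩ := (hfar.and_eventually (eventually_ge_atTop a)).exists
    have hn : (0 : ℝ) < (n : ℝ) + 1 := by positivity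
    have hcont : ContinuousOn (fun t => dist (u t) ψ) (Set.Icc a b) :=
      (continuous_id.dist continuous_const).comp_continuousOn
        (hc.mono fun t (ht : t ∈ Set.Icc a b) => hn.trans_le (ha2.trans ht.1))
    obtain ⟨t, ht, htr⟩ := intermediate_value_Icc hb2 hcont
      ⟨(Metric.mem_ball.1 ha1).le, (min_le_left _ _).trans hb1⟩
    exact ⟨t, ha2.trans ht.1, htr⟩
  choose t ht1 ht2 using hcross
  have htt : Tendsto t atTop atTop :=
    tendsto_atTop_mono (fun n => (le_add_of_nonneg_right zero_le_one).trans (ht1 n))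
      tendsto_natCast_atTop_atTop
  obtain ⟨x, φ, hφ, hx⟩ := hu t htt
  have hxr : dist x ψ = r :=
    tendsto_nhds_unique (hx.dist tendsto_const_nhds) (by simp [ht2])
  have hxc : MapClusterPt x atTop u :=
    hx.mapClusterPt.of_comp (htt.comp hφ.tendsto_atTop)
  have := hval x hxc (by rw [hxr]; exact (min_le_right _ _).trans_lt (by linarith))
  rw [this, dist_self] at hxr
  exact hr0.ne hxr

/-- Convergence to a limit point near which a Łojasiewicz inequality holds along the orbit. -/
theorem PrecompactAtTop.tendsto_of_lojasiewicz {u : ℝ → X} (hu : PrecompactAtTop u)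
    {ι : X →L[ℝ] H} (hι : Function.Injective ι) {g : ℝ → H} {E : ℝ → ℝ}
    (hv : ∀ t > 0, HasDerivAt (fun s => ι (u s)) (g t) t)
    (hE : ∀ t > 0, HasDerivAt E (‖g t‖ ^ 2) t) {c C : ℝ} (hc : Tendsto E atTop (𝓝 c))
    {ψ : X} (hψ : MapClusterPt ψ atTop u)
    (hloj : ∀ᶠ t in atTop ⊓ comap u (𝓝 ψ), c - E t ≤ C * ‖g t‖ ^ 2)
    (hb : ∃ B, ∀ t > 0, ‖ι (u t)‖ ≤ B) :
    Tendsto u atTop (𝓝 ψ) ∧ ConvergesExponentially (fun t => ι (u t)) (ι ψ) := by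
  have hle : atTop ⊓ comap (fun t => ι (u t)) (𝓝 (ι ψ)) ≤ atTop ⊓ comap u (𝓝 ψ) :=
    le_inf inf_le_left (hu.tendsto_comap hι ψ).le_comap
  have hexp := exists_exp_bound_of_lojasiewicz (C := C) hv hE hc
    (hψ.continuousAt_comp ι.continuous.continuousAt) (hloj.filter_mono hle)
  refine ⟨hu.tendsto_of_tendsto hι ?_, convergesExponentially_of_eventually hexp hb⟩
  obtain ⟨K, δ, T, hδ, hT⟩ := hexp
  rw [tendsto_iff_norm_sub_tendsto_zero]
  refine squeeze_zero' (Eventually.of_forall fun t => norm_nonneg _)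
    ((eventually_ge_atTop T).mono hT) ?_
  have : Tendsto (fun t : ℝ => Real.exp (-(δ * t))) atTop (𝓝 0) :=
    Real.tendsto_exp_neg_atTop_nhds_zero.comp (tendsto_id.const_mul_atTop hδ)
  simpa using this.const_mul K

end Precompact

/-! ### The Łojasiewicz inequality at a point of resonance branching -/

section Lojasiewicz

variable {H X : Type*} [NormedAddCommGroup H] [NormedSpace ℝ H]
  [NormedAddCommGroup X] [NormedSpace ℝ X]

/-- The kernel of `L` is finite dimensional and `L` is bounded below on a closed complement
of its kernel. -/
def IsSemiFredholm (L : X →L[ℝ] H) : Prop :=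
  FiniteDimensional ℝ L.ker ∧ ∃ P : X →L[ℝ] L.ker, (∀ x : L.ker, P x = x) ∧
    ∃ C : ℝ, ∀ w, P w = 0 → ‖w‖ ≤ C * ‖L w‖

/-- On a closed complement of its kernel a Fredholm operator is an isomorphism onto its range, and
the bounded inverse gives the lower bound. -/
theorem isSemiFredholm_of_isFredholm {L : X →L[ℝ] H} (hL : L.IsFredholm) : IsSemiFredholm L := by
  refine ⟨hL.finite_ker, ?_⟩
  obtain ⟨dom₁, h_dom⟩ := hL.closedComplemented_ker.exists_isTopCompl
  obtain ⟨codom₀, h_codom⟩ := hL.closedComplemented_range.exists_isTopCompl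
  set pkg := hL.fredholmPackage h_dom h_codom with hpkg
  refine ⟨L.ker.projectionOntoL dom₁ h_dom, fun x => by simp, ?_⟩
  obtain ⟨K, hK⟩ : ∃ K : NNReal, AntilipschitzWith K pkg.equiv := ⟨_, pkg.equiv.antilipschitz⟩
  refine ⟨K, fun w hw => ?_⟩
  have hw1 : w ∈ dom₁ := (Submodule.projectionOntoL_apply_eq_zero_iff h_dom).1 hw
  have h1 : pkg.decDom.proj w = ⟨w, hw1⟩ :=
    Submodule.projectionOntoL_apply_left h_dom.symm ⟨w, hw1⟩
  have h2 : L w = (pkg.equiv (pkg.decDom.proj w) : H) := by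
    conv_lhs => rw [pkg.eq_equiv]
    rfl
  have h3 := ZeroHomClass.bound_of_antilipschitz pkg.equiv hK (pkg.decDom.proj w)
  rw [h2]
  calc ‖w‖ = ‖pkg.decDom.proj w‖ := by rw [h1]; rfl
    _ ≤ _ := h3

/-- This makes a nondegenerate equilibrium the case `k = 0` of resonance branching. -/
theorem hasSurfaceThrough_zero {S : Set X} {ψ : X} (hψ : ψ ∈ S) : HasSurfaceThrough S ψ 0 :=
  ⟨fun _ => ψ, rfl, contDiffAt_const, Function.injective_of_subsingleton _,
    Eventually.of_forall fun _ => hψ⟩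

/-- Since `G` vanishes on the surface, tangent vectors lie in `L.ker`, and by dimension they span
it. So `P` restricted to the surface is a local chart, and each `x` near `ψ` has a partner `p μ`
with `P x = P (p μ)`; the difference lies in the complement, where `L` is bounded below and
dominates the remainder of `G`. The hypotheses are relative to `S` because a superposition operator
is differentiable only relative to bounded functions; for smooth gradient systems `S` is everything.
-/
theorem lojasiewicz_of_surface {L : X →L[ℝ] H} (hL : IsSemiFredholm L) {S Φ : Set X} {V : X → ℝ}
    {G : X → H} {ψ : X} (hΦ : ∀ y ∈ Φ, G y = 0) (hΦS : Φ ⊆ S) (hψ : ψ ∈ Φ)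
    (hG : ∀ ε > 0, ∀ᶠ q : X × X in 𝓝 (ψ, ψ), q.1 ∈ S → q.2 ∈ Φ →
      ‖G q.1 - G q.2 - L (q.1 - q.2)‖ ≤ ε * ‖q.1 - q.2‖)
    {K : ℝ} (hV : ∀ᶠ q : X × X in 𝓝 (ψ, ψ), q.1 ∈ S → q.2 ∈ Φ →
      |V q.1 - V q.2| ≤ K * ‖q.1 - q.2‖ ^ 2)
    (hp : HasSurfaceThrough Φ ψ (Module.finrank ℝ L.ker)) :
    ∃ C, ∀ᶠ x in 𝓝 ψ, x ∈ S → |V x - V ψ| ≤ C * ‖G x‖ ^ 2 := by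
  obtain ⟨hfin, P, hP, C, hC⟩ := hL
  obtain ⟨p, hp0, hpd, hpi, hpΦ⟩ := hp
  set A := fderiv ℝ p 0 with hA
  have hstrict : HasStrictFDerivAt p A 0 := hpd.hasStrictFDerivAt one_ne_zero
  have hcont : Tendsto p (𝓝 0) (𝓝 ψ) := by
    have := hstrict.continuousAt.tendsto
    rwa [hp0] at this
  -- the derivative of the parametrization takes values in the kernel
  have hLA : L ∘L A = 0 := by
    have h1 : HasFDerivAt (fun μ => L (p μ - ψ)) (L ∘L A) 0 := by
      exact L.hasFDerivAt.comp (0 : EuclideanSpace ℝ _) (hstrict.hasFDerivAt.sub_const ψ)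
    have h2 : HasFDerivAt (fun μ => L (p μ - ψ)) (0 : _ →L[ℝ] H) 0 := by
      rw [hasFDerivAt_iff_isLittleO_nhds_zero]
      simp only [zero_add, hp0, sub_self, map_zero, sub_zero, zero_apply]
      have h3 : (fun μ => L (p μ - ψ)) =o[𝓝 0] fun μ => p μ - ψ := by
        rw [Asymptotics.isLittleO_iff]
        intro ε hε
        have h4 : Tendsto (fun μ => (p μ, ψ)) (𝓝 0) (𝓝 (ψ, ψ)) :=
          hcont.prodMk_nhds tendsto_const_nhds
        filter_upwards [h4.eventually (hG ε hε), hpΦ] with μ h5 h6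
        have := h5 (hΦS h6) hψ
        simp only [hΦ _ h6, hΦ _ hψ, sub_zero, zero_sub, norm_neg] at this
        exact this
      have h5 : (fun μ => p μ - ψ) =O[𝓝 0] fun μ => μ := by
        have := hstrict.hasFDerivAt.isBigO_sub
        simpa [hp0] using this
      exact h3.trans_isBigO h5
    exact h1.unique h2
  have hAker : ∀ μ, A μ ∈ L.ker := fun μ => by
    have := DFunLike.congr_fun hLA μ
    simpa using this
  -- the energy is constant on the surface
  have hVp : ∀ᶠ μ in 𝓝 0, V (p μ) = V ψ := by
    obtain ⟨k, s, hs, hk⟩ := hstrict.exists_lipschitzOnWith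
    have h1 : ∀ᶠ q : X × X in 𝓝 ψ ×ˢ 𝓝 ψ, q.1 ∈ S → q.2 ∈ Φ →
      |V q.1 - V q.2| ≤ K * ‖q.1 - q.2‖ ^ 2 := by rwa [← nhds_prod_eq]
    obtain ⟨W, hW, hWV⟩ := eventually_prod_self_iff'.1 h1
    have hU : ∀ᶠ μ in 𝓝 0, μ ∈ s ∧ p μ ∈ Φ ∧ p μ ∈ W :=
      (eventually_mem_set.2 hs).and (hpΦ.and (hcont.eventually hW))
    obtain ⟨r, hr, hball⟩ := Metric.eventually_nhds_iff_ball.1 hU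
    have hest : ∀ μ ∈ Metric.ball (0 : EuclideanSpace ℝ (Fin (Module.finrank ℝ L.ker))) r,
        ∀ ν ∈ Metric.ball (0 : EuclideanSpace ℝ (Fin (Module.finrank ℝ L.ker))) r,
        ‖V (p ν) - V (p μ)‖ ≤ |K| * k ^ 2 * ‖ν - μ‖ ^ 2 := by
      intro μ hμ ν hν
      obtain ⟨a1, a2, a3⟩ := hball μ hμ
      obtain ⟨b1, b2, b3⟩ := hball ν hν
      have h2 := hWV _ b3 _ a3 (hΦS b2) a2
      have h3 := hk.norm_sub_le b1 a1
      rw [Real.norm_eq_abs]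
      calc _ ≤ K * ‖p ν - p μ‖ ^ 2 := h2
        _ ≤ |K| * (k * ‖ν - μ‖) ^ 2 := by
          gcongr
          exact le_abs_self K
        _ = _ := by ring
    -- The quadratic bound holds between any two points of the surface, so the energy has zero
    -- derivative all along it.
    have hder : ∀ μ ∈ Metric.ball (0 : EuclideanSpace ℝ (Fin (Module.finrank ℝ L.ker))) r,
        HasFDerivAt (fun μ => V (p μ)) (0 : _ →L[ℝ] ℝ) μ := by
      intro μ hμ
      rw [hasFDerivAt_iff_isLittleO]
      have h2 : (fun ν => V (p ν) - V (p μ) - (0 : _ →L[ℝ] ℝ) (ν - μ)) =O[𝓝 μ]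
          fun ν => ‖ν - μ‖ ^ 2 := by
        refine Asymptotics.IsBigO.of_bound (|K| * k ^ 2) ?_
        filter_upwards [Metric.isOpen_ball.mem_nhds hμ] with ν hν
        simpa using hest μ hμ ν hν
      refine h2.trans_isLittleO ?_
      have h3 : (fun x : EuclideanSpace ℝ (Fin (Module.finrank ℝ L.ker)) => ‖x‖ ^ 2) =o[𝓝 0]
          fun x => x := Asymptotics.isLittleO_norm_pow_id one_lt_two
      have h4 : Tendsto (fun ν => ν - μ) (𝓝 μ) (𝓝 0) := by
        have := (continuous_sub_right μ).tendsto μ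
        rwa [sub_self] at this
      exact h3.comp_tendsto h4
    filter_upwards [Metric.ball_mem_nhds _ hr] with μ hμ
    rw [← hp0]
    exact (convex_ball _ r).is_const_of_fderivWithin_eq_zero (𝕜 := ℝ) (f := fun μ => V (p μ))
      (fun x hx => (hder x hx).differentiableAt.differentiableWithinAt)
      (fun x hx => by
        rw [fderivWithin_of_isOpen Metric.isOpen_ball hx]
        exact (hder x hx).fderiv) hμ (Metric.mem_ball_self hr)
  -- coordinates on the surface
  have hB : ∃ B : EuclideanSpace ℝ (Fin (Module.finrank ℝ L.ker)) ≃L[ℝ] L.ker,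
      (B : _ →L[ℝ] L.ker) = P ∘L A := by
    have hinj : Function.Injective (P ∘L A) := by
      rw [injective_iff_map_eq_zero]
      intro μ hμ
      have h1 : P (A μ) = ⟨A μ, hAker μ⟩ := hP ⟨A μ, hAker μ⟩
      rw [ContinuousLinearMap.comp_apply, h1, Subtype.ext_iff] at hμ
      exact hpi (by simpa using hμ)
    refine ⟨(LinearEquiv.ofInjectiveOfFinrankEq (P ∘L A : _ →ₗ[ℝ] L.ker) hinj
      (by simp)).toContinuousLinearEquiv, ?_⟩
    ext μ
    rfl
  obtain ⟨B, hB⟩ := hB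
  have hPp : HasStrictFDerivAt (fun μ => P (p μ)) (B : _ →L[ℝ] L.ker) 0 := by
    rw [hB]
    exact P.hasStrictFDerivAt.comp (0 : EuclideanSpace ℝ _) hstrict
  have hmap : map (fun μ => P (p μ)) (𝓝 0) = 𝓝 (P ψ) := by
    have := hPp.map_nhds_eq_of_equiv
    rwa [hp0] at this
  -- the main estimate
  have hC1 : 0 < |C| + 1 := by positivity
  -- With this `ε` the remainder of `G` costs at most half of `‖x - p μ‖` and can be absorbed; `|C|
  -- + 1` replaces `C`, whose sign is unknown.
  set ε := 1 / (2 * (|C| + 1)) with hε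
  have hε0 : 0 < ε := by positivity
  have hev : ∀ᶠ q : X × X in 𝓝 ψ ×ˢ 𝓝 ψ, (q.1 ∈ S → q.2 ∈ Φ →
      ‖G q.1 - G q.2 - L (q.1 - q.2)‖ ≤ ε * ‖q.1 - q.2‖) ∧ (q.1 ∈ S → q.2 ∈ Φ →
      |V q.1 - V q.2| ≤ K * ‖q.1 - q.2‖ ^ 2) := by
    rw [← nhds_prod_eq]
    exact (hG ε hε0).and hV
  obtain ⟨W, hW, hWV⟩ := eventually_prod_self_iff'.1 hev
  have hU : {μ | p μ ∈ Φ ∧ p μ ∈ W ∧ V (p μ) = V ψ} ∈ 𝓝 (0 : EuclideanSpace ℝ _) :=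
    hpΦ.and ((hcont.eventually hW).and hVp)
  -- By the inverse function theorem the parameters near `0`, whose points `p μ` are near `ψ`,
  -- already realize every value of `P` near `P ψ`.
  have hPU : (fun μ => P (p μ)) '' {μ | p μ ∈ Φ ∧ p μ ∈ W ∧ V (p μ) = V ψ} ∈ 𝓝 (P ψ) := by
    rw [← hmap]
    exact image_mem_map hU
  refine ⟨|K| * (2 * (|C| + 1)) ^ 2, ?_⟩
  filter_upwards [P.continuous.continuousAt.eventually hPU, hW] with x hx hxW hxS
  obtain ⟨μ, ⟨hμΦ, hμW, hμV⟩, hμ⟩ := hx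
  obtain ⟨h1, h2⟩ := hWV _ hxW _ hμW
  replace h1 := h1 hxS hμΦ
  replace h2 := h2 hxS hμΦ
  simp only [hΦ _ hμΦ, sub_zero] at h1
  have h3 : ‖x - p μ‖ ≤ (|C| + 1) * ‖L (x - p μ)‖ := by
    refine (hC _ (by rw [map_sub, sub_eq_zero]; exact hμ.symm)).trans ?_
    gcongr
    linarith [le_abs_self C]
  have h4 : ‖x - p μ‖ ≤ 2 * (|C| + 1) * ‖G x‖ := by
    have h5 : ‖L (x - p μ)‖ ≤ ‖G x‖ + ε * ‖x - p μ‖ := by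
      have := norm_sub_norm_le (L (x - p μ)) (G x)
      rw [norm_sub_rev] at this
      linarith
    have h6 : (|C| + 1) * (ε * ‖x - p μ‖) = ‖x - p μ‖ / 2 := by
      rw [hε]
      field_simp
    have h7 := mul_le_mul_of_nonneg_left h5 hC1.le
    rw [mul_add, h6] at h7
    linarith
  rw [← hμV]
  calc |V x - V (p μ)| ≤ K * ‖x - p μ‖ ^ 2 := h2
    _ ≤ |K| * (2 * (|C| + 1) * ‖G x‖) ^ 2 := by
      gcongr
      exact le_abs_self K
    _ = _ := by ring

end Lojasiewicz

/-! ### Smooth gradient systems -/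

section GradientSystem

variable {H X : Type*} [NormedAddCommGroup H] [InnerProductSpace ℝ H]
  [NormedAddCommGroup X] [NormedSpace ℝ X]

theorem tendsto_of_monotoneOn_of_mapClusterPt {E : ℝ → ℝ} (hE : MonotoneOn E (Set.Ioi 0)) {c : ℝ}
    (hc : MapClusterPt c atTop E) : Tendsto E atTop (𝓝 c) := by
  rw [tendsto_order]
  constructor
  · intro a ha
    obtain ⟨s, hs, hs0⟩ := ((mapClusterPt_iff_frequently.1 hc _
      (lt_mem_nhds ha)).and_eventually (eventually_gt_atTop 0)).exists
    filter_upwards [eventually_ge_atTop s] with t ht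
    exact lt_of_lt_of_le hs (hE hs0 (hs0.trans_le ht) ht)
  · intro a ha
    filter_upwards [eventually_gt_atTop 0] with t ht
    refine lt_of_le_of_lt ?_ ha
    by_contra hcon
    push Not at hcon
    obtain ⟨s, hs, hst⟩ := ((mapClusterPt_iff_frequently.1 hc _
      (gt_mem_nhds hcon)).and_eventually (eventually_ge_atTop t)).exists
    exact absurd hs (not_lt.2 (hE ht (lt_of_lt_of_le ht hst) hst))

theorem mul_le_energy_sub {g : ℝ → H} {E : ℝ → ℝ} (hE : ∀ t > 0, HasDerivAt E (‖g t‖ ^ 2) t)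
    {s t d : ℝ} (hs : 0 < s) (hst : s ≤ t) (hd : ∀ r ∈ Set.Ioo s t, d ≤ ‖g r‖ ^ 2) :
    d * (t - s) ≤ E t - E s := by
  refine (convex_Icc s t).mul_sub_le_image_sub_of_le_deriv
    (fun r hr => (hE r (hs.trans_le hr.1)).continuousAt.continuousWithinAt) (fun r hr => ?_)
    (fun r hr => ?_) s (Set.left_mem_Icc.2 hst) t (Set.right_mem_Icc.2 hst) hst
  · rw [interior_Icc] at hr
    exact (hE r (hs.trans hr.1)).differentiableAt.differentiableWithinAt
  · rw [interior_Icc] at hr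
    rw [(hE r (hs.trans hr.1)).deriv]
    exact hd r hr

/-- If `G ψ ≠ 0`, an orbit that is late and near `ψ` stays near it for a unit of time, since its
displacement is controlled by the small energy gain; but then it gains at least `d²` in energy,
while `E` converges. -/
theorem eq_zero_of_mapClusterPt {u : ℝ → X} (hu : PrecompactAtTop u) {ι : X →L[ℝ] H}
    (hι : Function.Injective ι) {G : X → H} (hG : Continuous G) {E : ℝ → ℝ}
    (hv : ∀ t > 0, HasDerivAt (fun s => ι (u s)) (G (u t)) t)
    (hE : ∀ t > 0, HasDerivAt E (‖G (u t)‖ ^ 2) t) {c : ℝ} (hc : Tendsto E atTop (𝓝 c))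
    {ψ : X} (hψ : MapClusterPt ψ atTop u) : G ψ = 0 := by
  by_contra hne
  set d := ‖G ψ‖ / 2 with hd
  have hd0 : 0 < d := half_pos (norm_pos_iff.2 hne)
  have hU : ∀ᶠ x in 𝓝 ψ, d < ‖G x‖ :=
    hG.norm.continuousAt.eventually_const_lt (half_lt_self (norm_pos_iff.2 hne))
  have hev := (hu.tendsto_comap hι ψ).eventually hU
  rw [((atTop_basis.inf ((Metric.nhds_basis_ball).comap _)).eventually_iff)] at hev
  obtain ⟨⟨T, δ⟩, ⟨-, hδ⟩, hT⟩ := hev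
  have hT : ∀ t ≥ T, ‖ι (u t) - ι ψ‖ < δ → d < ‖G (u t)‖ := fun t ht h =>
    hT ⟨ht, by simpa [dist_eq_norm] using h⟩
  have hdiff : Tendsto (fun t => E (t + 1) - E t) atTop (𝓝 0) := by
    have := (hc.comp (tendsto_atTop_add_const_right atTop (1 : ℝ) tendsto_id)).sub hc
    rwa [sub_self] at this
  have hsmall := hdiff.eventually_lt_const
    (show (0 : ℝ) < min ((δ / 2) ^ 2) (d ^ 2) by positivity)
  have hcl := mapClusterPt_iff_frequently.1 (hψ.continuousAt_comp ι.continuous.continuousAt)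
    _ (Metric.ball_mem_nhds (ι ψ) (half_pos hδ))
  obtain ⟨t, ht1, ht2, ht0, htT⟩ := (hcl.and_eventually (hsmall.and
    ((eventually_gt_atTop 0).and (eventually_ge_atTop T)))).exists
  have ht1 : ‖ι (u t) - ι ψ‖ < δ / 2 := by simpa [dist_eq_norm] using ht1
  have h1 : d ^ 2 * (t + 1 - t) ≤ E (t + 1) - E t := by
    refine mul_le_energy_sub hE ht0 (by linarith) fun r hr => ?_
    have h2 := norm_sub_sq_le_mul_energy_sub hv hE ht0 hr.1.le
    have h3 : E r ≤ E (t + 1) := monotoneOn_energy hE (ht0.trans hr.1) (by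
      exact ht0.trans (lt_add_one t)) hr.2.le
    have h4 : E t ≤ E r := monotoneOn_energy hE ht0 (ht0.trans hr.1) hr.1.le
    have h5 : ‖ι (u r) - ι (u t)‖ < δ / 2 := by
      refine lt_of_pow_lt_pow_left₀ 2 (by positivity) (h2.trans_lt ?_)
      calc (r - t) * (E r - E t) ≤ 1 * (E r - E t) := by
            gcongr
            linarith [hr.2]
        _ < (δ / 2) ^ 2 := by
            have := ht2.trans_le (min_le_left _ _)
            linarith
    have h6 : ‖ι (u r) - ι ψ‖ ≤ ‖ι (u r) - ι (u t)‖ + ‖ι (u t) - ι ψ‖ :=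
      norm_sub_le_norm_sub_add_norm_sub _ _ _
    have h7 := hT r (htT.trans hr.1.le) (by linarith)
    gcongr
  have := ht2.trans_le (min_le_right _ _)
  linarith

/-! ### Energy, compactness and convergence for gradient systems. -/

variable {ι : X →L[ℝ] H} {V : X → ℝ} {V' : X → H}

/-- The point is that the error carries the `H`-norm of the increment, the only norm in which orbits
are differentiable. -/
theorem IsGradientSystem.abs_sub_sub_inner_le (hS : IsGradientSystem ι V V') {x y : X} {ε : ℝ}
    (h : ∀ z ∈ segment ℝ y x, ‖V' z - V' y‖ ≤ ε) :
    |V x - V y - ⟪V' y, ι (x - y)⟫_ℝ| ≤ ε * ‖ι (x - y)‖ := by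
  have hV : Differentiable ℝ V := hS.contDiff_functional.differentiable two_ne_zero
  have hd : ∀ θ : ℝ, HasDerivAt (fun θ : ℝ => V (y + θ • (x - y)) - θ * ⟪V' y, ι (x - y)⟫_ℝ)
      (⟪V' (y + θ • (x - y)) - V' y, ι (x - y)⟫_ℝ) θ := by
    intro θ
    have h1 : HasDerivAt (fun θ : ℝ => y + θ • (x - y)) (x - y) θ := by
      simpa using ((hasDerivAt_id θ).smul_const (x - y)).const_add y
    have h2 := (hV (y + θ • (x - y))).hasFDerivAt.comp_hasDerivAt θ h1
    rw [hS.gradient] at h2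
    have h3 := (hasDerivAt_id θ).mul_const ⟪V' y, ι (x - y)⟫_ℝ
    rw [one_mul] at h3
    rw [inner_sub_left]
    exact h2.sub h3
  have := norm_image_sub_le_of_norm_deriv_le_segment_01' (C := ε * ‖ι (x - y)‖)
    (fun θ _ => (hd θ).hasDerivWithinAt) (fun θ hθ => by
      refine (norm_inner_le_norm _ _).trans ?_
      gcongr
      refine h _ ?_
      rw [segment_eq_image']
      exact ⟨θ, ⟨hθ.1, hθ.2.le⟩, rfl⟩)
  simp only [one_smul, zero_smul, add_zero, add_sub_cancel, one_mul, zero_mul, sub_zero,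
    Real.norm_eq_abs] at this
  rwa [sub_right_comm] at this

/-- The chain rule on `X` does not apply, as `u` is merely continuous there. Instead the functional
`⟪V' (u t), ι ·⟫` is split off, which is differentiable along `u`, and the rest is `o(‖ι (u s) - ι
(u t)‖)`. -/
theorem IsGradientSystem.hasDerivAt_energy (hS : IsGradientSystem ι V V') {u : ℝ → X}
    (hu : IsSmoothOrbit ι V' u) {t : ℝ} (ht : 0 < t) :
    HasDerivAt (fun s => V (u s)) (‖V' (u t)‖ ^ 2) t := by
  have hc : ContinuousAt u t := hu.continuousOn.continuousAt (Ioi_mem_nhds ht)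
  have hv := hu.equation t ht
  have h1 : HasDerivAt (fun s => ⟪V' (u t), ι (u s)⟫_ℝ) (‖V' (u t)‖ ^ 2) t := by
    have := (hasDerivAt_const t (V' (u t))).inner ℝ hv
    simpa only [inner_zero_left, add_zero, real_inner_self_eq_norm_sq] using this
  have h2 : HasDerivAt (fun s => V (u s) - ⟪V' (u t), ι (u s)⟫_ℝ) 0 t := by
    rw [hasDerivAt_iff_isLittleO]
    have h3 : (fun s => V (u s) - ⟪V' (u t), ι (u s)⟫_ℝ - (V (u t) - ⟪V' (u t), ι (u t)⟫_ℝ) -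
        (s - t) • (0 : ℝ)) =o[𝓝 t] fun s => ι (u s) - ι (u t) := by
      rw [Asymptotics.isLittleO_iff]
      intro ε hε
      have h4 : ∀ᶠ x in 𝓝 (u t), ‖V' x - V' (u t)‖ < ε := by
        have := hS.contDiff_gradient.continuous.continuousAt.eventually
          (Metric.ball_mem_nhds (V' (u t)) hε)
        simpa [dist_eq_norm] using this
      obtain ⟨r, hr, hball⟩ := Metric.eventually_nhds_iff_ball.1 h4
      filter_upwards [hc.eventually (Metric.ball_mem_nhds (u t) hr)] with s hs
      have := hS.abs_sub_sub_inner_le (x := u s) (y := u t) (ε := ε) (fun z hz =>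
        (hball z ((convex_ball (u t) r).segment_subset (Metric.mem_ball_self hr) hs hz)).le)
      rw [map_sub, inner_sub_right] at this
      rw [Real.norm_eq_abs, smul_zero, sub_zero]
      convert this using 2
      ring
    exact h3.trans_isBigO hv.isBigO_sub
  refine ((h2.add h1).congr_deriv (zero_add _)).congr_of_eventuallyEq
    (Eventually.of_forall fun s => ?_)
  simp

/-- The compact embedding yields a subsequence converging in `H`; smoothing makes it Cauchy in `X`.
-/
theorem IsGradientSystem.precompactAtTop [CompleteSpace X] (hS : IsGradientSystem ι V V')
    {u : ℝ → X} (hu : IsSmoothOrbit ι V' u) (hb : Bornology.IsBounded (u '' Set.Ioi 0)) :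
    PrecompactAtTop u := by
  intro s hs
  obtain ⟨K, hK, hKu⟩ := hS.compact.image_subset_compact_of_bounded hb
  have hev : ∀ᶠ n in atTop, ι (u (s n)) ∈ K := by
    filter_upwards [hs.eventually_gt_atTop 0] with n hn
    exact hKu ⟨_, ⟨_, hn, rfl⟩, rfl⟩
  obtain ⟨a, -, φ, hφ, ha⟩ := hK.tendsto_subseq' hev.frequently
  obtain ⟨x, hx⟩ := cauchySeq_tendsto_of_complete
    (hu.smoothing (s ∘ φ) (hs.comp hφ.tendsto_atTop) ha.cauchySeq)
  exact ⟨x, φ, hφ, hx⟩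

/-- `DV` is locally Lipschitz and vanishes at equilibria, so `V` varies quadratically away from
them; `V'` is strictly differentiable at `ψ`. -/
theorem IsGradientSystem.lojasiewicz (hS : IsGradientSystem ι V V') {ψ : X}
    (hψ : ψ ∈ equilibria V') (hF : (fderiv ℝ V' ψ).IsFredholm)
    (hsurf : HasSurfaceThrough (equilibria V') ψ (Module.finrank ℝ (fderiv ℝ V' ψ).ker)) :
    ∃ C, ∀ᶠ x in 𝓝 ψ, |V x - V ψ| ≤ C * ‖V' x‖ ^ 2 := by
  have hstrict : HasStrictFDerivAt V' (fderiv ℝ V' ψ) ψ :=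
    hS.contDiff_gradient.contDiffAt.hasStrictFDerivAt one_ne_zero
  have hV : Differentiable ℝ V := hS.contDiff_functional.differentiable two_ne_zero
  have hDV : ContDiffAt ℝ 1 (fderiv ℝ V) ψ :=
    (hS.contDiff_functional.fderiv_right (m := 1) (by norm_num)).contDiffAt
  obtain ⟨k, s, hs, hk⟩ := hDV.exists_lipschitzOnWith
  obtain ⟨r, hr, hball⟩ := Metric.mem_nhds_iff.1 hs
  have := lojasiewicz_of_surface (S := Set.univ) (K := k) (V := V)
    (isSemiFredholm_of_isFredholm hF) (fun y hy => hy) (Set.subset_univ _) hψ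
    (fun ε hε => by
      filter_upwards [hstrict.isLittleO.def hε] with q hq _ _
      exact hq)
    (by
      rw [nhds_prod_eq]
      filter_upwards [prod_mem_prod (Metric.ball_mem_nhds ψ hr) (Metric.ball_mem_nhds ψ hr)]
        with q hq _ hqΦ
      have h0 : fderiv ℝ V q.2 = 0 := by
        ext v
        rw [hS.gradient, show V' q.2 = 0 from hqΦ]
        simp
      have hseg : segment ℝ q.2 q.1 ⊆ Metric.ball ψ r :=
        (convex_ball ψ r).segment_subset hq.2 hq.1
      have hmv := (convex_segment q.2 q.1).norm_image_sub_le_of_norm_fderiv_le (𝕜 := ℝ) (f := V)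
        (C := k * ‖q.1 - q.2‖) (fun z _ => hV z) (fun z hz => by
          have h1 := hk.norm_sub_le (hball (hseg hz)) (hball hq.2)
          rw [h0, sub_zero] at h1
          refine h1.trans ?_
          gcongr
          obtain ⟨a, b, ha, hb, hab, rfl⟩ := hz
          have hz : a • q.2 + b • q.1 - q.2 = b • (q.1 - q.2) := by
            rw [eq_sub_of_add_eq hab, sub_smul, one_smul, smul_sub]
            abel
          rw [hz, norm_smul, Real.norm_of_nonneg hb]
          exact mul_le_of_le_one_left (norm_nonneg _) (by linarith))
        (left_mem_segment ℝ _ _) (right_mem_segment ℝ _ _)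
      rw [Real.norm_eq_abs] at hmv
      rw [pow_two, ← mul_assoc]
      exact hmv)
    hsurf
  simpa using this

theorem IsGradientSystem.exists_tendsto [CompleteSpace H] [CompleteSpace X]
    (hS : IsGradientSystem ι V V')
    (hF : ∀ ψ ∈ equilibria V', (fderiv ℝ V' ψ).IsFredholm) (hR : ResonanceBranching V')
    {u : ℝ → X} (hu : IsSmoothOrbit ι V' u) (hb : Bornology.IsBounded (u '' Set.Ioi 0)) :
    ∃ ψ ∈ equilibria V', Tendsto u atTop (𝓝 ψ) ∧
      ((fderiv ℝ V' ψ).ker = ⊥ ∨ AccPt ψ (𝓟 (equilibria V')) →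
        ConvergesExponentially (fun t => ι (u t)) (ι ψ)) := by
  have hpre := hS.precompactAtTop hu hb
  have hE : ∀ t > 0, HasDerivAt (fun s => V (u s)) (‖V' (u t)‖ ^ 2) t :=
    fun t ht => hS.hasDerivAt_energy hu ht
  have hlim : ∀ x, MapClusterPt x atTop u → Tendsto (fun t => V (u t)) atTop (𝓝 (V x)) :=
    fun x hx => tendsto_of_monotoneOn_of_mapClusterPt (monotoneOn_energy hE)
      (hx.continuousAt_comp hS.contDiff_functional.continuous.continuousAt)
  have heq : ∀ x, MapClusterPt x atTop u → x ∈ equilibria V' := fun x hx =>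
    eq_zero_of_mapClusterPt hpre hS.injective hS.contDiff_gradient.continuous hu.equation hE
      (hlim x hx) hx
  obtain ⟨ψ, hψ⟩ := hpre.exists_mapClusterPt
  refine ⟨ψ, heq ψ hψ, ?_⟩
  -- Either the Łojasiewicz inequality is available, or `ψ` is isolated and degenerate and converges
  -- without a rate.
  by_cases hcase : (fderiv ℝ V' ψ).ker = ⊥ ∨ AccPt ψ (𝓟 (equilibria V'))
  · have hsurf : HasSurfaceThrough (equilibria V') ψ
        (Module.finrank ℝ (fderiv ℝ V' ψ).ker) := by
      by_cases hk : Module.finrank ℝ (fderiv ℝ V' ψ).ker = 0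
      · rw [hk]
        exact hasSurfaceThrough_zero (heq ψ hψ)
      · refine hR ψ (heq ψ hψ) (hcase.resolve_left fun h => hk ?_) (Nat.one_le_iff_ne_zero.2 hk)
        rw [h]
        exact finrank_bot ℝ X
    obtain ⟨C, hC⟩ := hS.lojasiewicz (heq ψ hψ) (hF ψ (heq ψ hψ)) hsurf
    have hloj : ∀ᶠ t in atTop ⊓ comap u (𝓝 ψ), V ψ - V (u t) ≤ C * ‖V' (u t)‖ ^ 2 := by
      refine Eventually.filter_mono inf_le_right ((hC.comap u).mono fun t ht => ?_)
      rw [abs_sub_comm] at ht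
      exact (le_abs_self _).trans ht
    obtain ⟨B, hB⟩ := hb.exists_norm_le
    have := hpre.tendsto_of_lojasiewicz hS.injective hu.equation hE (hlim ψ hψ) hψ hloj
      ⟨‖ι‖ * B, fun t ht => (ι.le_opNorm _).trans (by
        gcongr
        exact hB _ ⟨t, ht, rfl⟩)⟩
    exact ⟨this.1, fun _ => this.2⟩
  · push Not at hcase
    exact ⟨hpre.tendsto_of_isolated hu.continuousOn heq hψ hcase.2,
      fun h => absurd h (by push Not; exact hcase)⟩

end GradientSystem

/-! ### Energy forms of Schwartz functions -/

section Schwartz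

open scoped SchwartzMap FourierTransform LineDeriv

variable {N : ℕ}

/-- The complexification of a real Schwartz function. -/
noncomputable def complexify (f : 𝓢(EuclideanSpace ℝ (Fin N), ℝ)) :
    𝓢(EuclideanSpace ℝ (Fin N), ℂ) :=
  f.postcompCLM Complex.ofRealCLM

theorem complexify_apply (f : 𝓢(EuclideanSpace ℝ (Fin N), ℝ)) (x : EuclideanSpace ℝ (Fin N)) :
    complexify f x = (f x : ℂ) := rfl

/-- The partial derivative of `f` with respect to the coordinates `α 0, …, α (k - 1)`. -/
noncomputable def partialDeriv {F : Type*} [NormedAddCommGroup F] [NormedSpace ℝ F] {k : ℕ}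
    (α : Fin k → Fin N) (f : 𝓢(EuclideanSpace ℝ (Fin N), F)) : 𝓢(EuclideanSpace ℝ (Fin N), F) :=
  ∂^{fun j => EuclideanSpace.basisFun (Fin N) ℝ (α j)} f

theorem partialDeriv_apply {F : Type*} [NormedAddCommGroup F] [NormedSpace ℝ F] {k : ℕ}
    (α : Fin k → Fin N) (f : 𝓢(EuclideanSpace ℝ (Fin N), F)) (x : EuclideanSpace ℝ (Fin N)) :
    partialDeriv α f x =
      iteratedFDeriv ℝ k f x fun j => EuclideanSpace.basisFun (Fin N) ℝ (α j) :=
  SchwartzMap.iteratedLineDerivOp_eq_iteratedFDeriv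

theorem partialDeriv_complexify {k : ℕ} (α : Fin k → Fin N)
    (f : 𝓢(EuclideanSpace ℝ (Fin N), ℝ)) :
    partialDeriv α (complexify f) = complexify (partialDeriv α f) := by
  ext x
  rw [partialDeriv_apply, complexify_apply, partialDeriv_apply]
  have h : (complexify f : EuclideanSpace ℝ (Fin N) → ℂ) = Complex.ofRealCLM ∘ f := rfl
  rw [h, Complex.ofRealCLM.iteratedFDeriv_comp_left (f.smooth k).contDiffAt le_rfl]
  rfl

theorem laplacian_complexify (f : 𝓢(EuclideanSpace ℝ (Fin N), ℝ)) :
    Δ (complexify f) = complexify (Δ f) := by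
  ext x
  rw [SchwartzMap.laplacian_apply, complexify_apply, SchwartzMap.laplacian_apply]
  have h : (complexify f : EuclideanSpace ℝ (Fin N) → ℂ) = Complex.ofRealCLM ∘ f := rfl
  rw [h, (f.smooth 2).contDiffAt.laplacian_CLM_comp_left]
  rfl

theorem iterate_laplacian_complexify (m : ℕ) (f : 𝓢(EuclideanSpace ℝ (Fin N), ℝ)) :
    (fun h : 𝓢(EuclideanSpace ℝ (Fin N), ℂ) => Δ h)^[m] (complexify f) =
      complexify ((fun h : 𝓢(EuclideanSpace ℝ (Fin N), ℝ) => Δ h)^[m] f) := by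
  induction m generalizing f with
  | zero => rfl
  | succ m ih => rw [Function.iterate_succ_apply, Function.iterate_succ_apply,
      laplacian_complexify, ih]

theorem iterLaplacian_coe (m : ℕ) (f : 𝓢(EuclideanSpace ℝ (Fin N), ℝ)) :
    iterLaplacian m (f : EuclideanSpace ℝ (Fin N) → ℝ) =
      ((fun h : 𝓢(EuclideanSpace ℝ (Fin N), ℝ) => Δ h)^[m] f : 𝓢(_, ℝ)) := by
  induction m generalizing f with
  | zero => rfl
  | succ m ih =>
    rw [iterLaplacian, Function.iterate_succ_apply, Function.iterate_succ_apply, ← ih]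
    have h : Δ (f : EuclideanSpace ℝ (Fin N) → ℝ) = (Δ f : 𝓢(_, ℝ)) :=
      funext fun x => (SchwartzMap.laplacian_apply f x).symm
    simp only [h, iterLaplacian]

theorem fourier_lineDeriv_apply (f : 𝓢(EuclideanSpace ℝ (Fin N), ℂ))
    (v ξ : EuclideanSpace ℝ (Fin N)) :
    𝓕 (∂_{v} f) ξ = 2 * Real.pi * Complex.I * (⟪ξ, v⟫_ℝ : ℂ) * 𝓕 f ξ := by
  have h : (inner ℝ · v : EuclideanSpace ℝ (Fin N) → ℝ).HasTemperateGrowth := by fun_prop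
  rw [SchwartzMap.fourier_lineDerivOp_eq, smul_apply,
    SchwartzMap.smulLeftCLM_apply_apply h]
  simp only [smul_eq_mul, Complex.real_smul]
  ring

theorem fourier_partialDeriv_apply {k : ℕ} (α : Fin k → Fin N)
    (f : 𝓢(EuclideanSpace ℝ (Fin N), ℂ)) (ξ : EuclideanSpace ℝ (Fin N)) :
    𝓕 (partialDeriv α f) ξ = (∏ j, 2 * Real.pi * Complex.I *
      (⟪ξ, EuclideanSpace.basisFun (Fin N) ℝ (α j)⟫_ℝ : ℂ)) * 𝓕 f ξ := by
  induction k with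
  | zero => simp [partialDeriv]
  | succ k ih =>
    rw [partialDeriv, LineDeriv.iteratedLineDerivOp_succ_left, fourier_lineDeriv_apply,
      Fin.prod_univ_succ, mul_assoc (2 * Real.pi * Complex.I * _)]
    congr 1
    exact ih (Fin.tail α)

theorem fourier_laplacian_apply (f : 𝓢(EuclideanSpace ℝ (Fin N), ℂ))
    (ξ : EuclideanSpace ℝ (Fin N)) :
    𝓕 (Δ f) ξ = -(((2 * Real.pi * ‖ξ‖) ^ 2 : ℝ) : ℂ) * 𝓕 f ξ := by
  rw [SchwartzMap.laplacian_eq_sum (EuclideanSpace.basisFun (Fin N) ℝ),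
    FourierTransform.fourier_sum, sum_apply]
  simp only [fourier_lineDeriv_apply]
  rw [mul_pow, ← OrthonormalBasis.sum_sq_inner_left (EuclideanSpace.basisFun (Fin N) ℝ) ξ]
  push_cast
  rw [Finset.mul_sum, ← Finset.sum_neg_distrib, Finset.sum_mul]
  refine Finset.sum_congr rfl fun i _ => ?_
  linear_combination (2 * Real.pi * (⟪ξ, EuclideanSpace.basisFun (Fin N) ℝ i⟫_ℝ : ℂ)) ^ 2 *
    𝓕 f ξ * Complex.I_sq

theorem fourier_iterate_laplacian_apply (m : ℕ) (f : 𝓢(EuclideanSpace ℝ (Fin N), ℂ))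
    (ξ : EuclideanSpace ℝ (Fin N)) :
    𝓕 ((fun h : 𝓢(EuclideanSpace ℝ (Fin N), ℂ) => Δ h)^[m] f) ξ =
      (-1) ^ m * (((2 * Real.pi * ‖ξ‖) ^ (2 * m) : ℝ) : ℂ) * 𝓕 f ξ := by
  induction m with
  | zero => simp
  | succ m ih =>
    rw [Function.iterate_succ_apply', fourier_laplacian_apply, ih]
    push_cast
    ring

theorem integral_mul_eq_integral_fourier (f g : 𝓢(EuclideanSpace ℝ (Fin N), ℝ)) :
    ((∫ x, f x * g x : ℝ) : ℂ) =
      ∫ ξ, ⟪𝓕 (complexify f) ξ, 𝓕 (complexify g) ξ⟫_ℂ := by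
  rw [SchwartzMap.integral_inner_fourier_fourier, ← integral_complex_ofReal]
  refine integral_congr_ae (Eventually.of_forall fun x => ?_)
  simp only [complexify_apply, RCLike.inner_apply, Complex.conj_ofReal, Complex.ofReal_mul]
  ring

theorem integrable_inner_schwartz (f g : 𝓢(EuclideanSpace ℝ (Fin N), ℂ)) :
    Integrable (fun ξ => ⟪f ξ, g ξ⟫_ℂ) := by
  have h := MemLp.integrable_mul (p := 2) (q := 2) (f.memLp 2 volume).star (g.memLp 2 volume)
  refine h.congr (Eventually.of_forall fun ξ => ?_)
  simp [RCLike.inner_apply, mul_comm]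

/-- The form `∑ ∫ ∂^α f ∂^α g`, the sum being over all `α` of length `k`. -/
noncomputable def energyForm (k : ℕ) (f g : 𝓢(EuclideanSpace ℝ (Fin N), ℝ)) : ℝ :=
  ∑ α : Fin k → Fin N, ∫ x, partialDeriv α f x * partialDeriv α g x

/-- Summing over all `k`-tuples of directions, rather than over multi-indices, produces exactly the
expansion of `(∑ ξᵢ²)^k`, with no multinomial weights. -/
theorem inner_fourier_partialDeriv {k : ℕ} (f g : 𝓢(EuclideanSpace ℝ (Fin N), ℂ))
    (ξ : EuclideanSpace ℝ (Fin N)) :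
    ∑ α : Fin k → Fin N, ⟪𝓕 (partialDeriv α f) ξ, 𝓕 (partialDeriv α g) ξ⟫_ℂ =
      (((2 * Real.pi * ‖ξ‖) ^ (2 * k) : ℝ) : ℂ) * ⟪𝓕 f ξ, 𝓕 g ξ⟫_ℂ := by
  have h : ∀ α : Fin k → Fin N, ⟪𝓕 (partialDeriv α f) ξ, 𝓕 (partialDeriv α g) ξ⟫_ℂ =
      (∏ j, (((2 * Real.pi) ^ 2 * ⟪ξ, EuclideanSpace.basisFun (Fin N) ℝ (α j)⟫_ℝ ^ 2 : ℝ) : ℂ)) *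
        ⟪𝓕 f ξ, 𝓕 g ξ⟫_ℂ := by
    intro α
    rw [fourier_partialDeriv_apply, fourier_partialDeriv_apply]
    simp only [RCLike.inner_apply, map_mul, map_prod, Complex.conj_ofReal, Complex.conj_I,
      map_ofNat]
    rw [mul_mul_mul_comm, ← Finset.prod_mul_distrib]
    congr 1
    refine Finset.prod_congr rfl fun j _ => ?_
    push_cast
    linear_combination -(2 * Real.pi *
      (⟪ξ, EuclideanSpace.basisFun (Fin N) ℝ (α j)⟫_ℝ : ℂ)) ^ 2 * Complex.I_sq
  rw [Finset.sum_congr rfl fun α _ => h α, ← Finset.sum_mul, pow_mul, mul_pow _ ‖ξ‖,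
    ← OrthonormalBasis.sum_sq_inner_left (EuclideanSpace.basisFun (Fin N) ℝ) ξ, Finset.mul_sum,
    Complex.ofReal_pow, Complex.ofReal_sum]
  congr 1
  exact (Fintype.sum_pow (fun i : Fin N => (((2 * Real.pi) ^ 2 *
    ⟪ξ, EuclideanSpace.basisFun (Fin N) ℝ i⟫_ℝ ^ 2 : ℝ) : ℂ)) k).symm

theorem energyForm_eq_integral_fourier (k : ℕ) (f g : 𝓢(EuclideanSpace ℝ (Fin N), ℝ)) :
    (energyForm k f g : ℂ) = ∫ ξ, (((2 * Real.pi * ‖ξ‖) ^ (2 * k) : ℝ) : ℂ) *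
      ⟪𝓕 (complexify f) ξ, 𝓕 (complexify g) ξ⟫_ℂ := by
  rw [energyForm, Complex.ofReal_sum]
  simp only [integral_mul_eq_integral_fourier, ← partialDeriv_complexify]
  rw [← integral_finsetSum _ fun α _ => integrable_inner_schwartz _ _]
  simp only [inner_fourier_partialDeriv]

/-- Both sides have the Fourier symbol `(2π‖ξ‖)^(2m)`; Plancherel replaces `m` integrations by
parts. -/
theorem energyForm_eq (m : ℕ) (f g : 𝓢(EuclideanSpace ℝ (Fin N), ℝ)) :
    energyForm m f g = (-1) ^ m * ∫ x, f x * iterLaplacian m g x := by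
  have h : (energyForm m f g : ℂ) = (((-1) ^ m * ∫ x, f x * iterLaplacian m g x : ℝ) : ℂ) := by
    rw [energyForm_eq_integral_fourier, iterLaplacian_coe, Complex.ofReal_mul,
      integral_mul_eq_integral_fourier, ← iterate_laplacian_complexify, ← integral_const_mul]
    refine integral_congr_ae (Eventually.of_forall fun ξ => ?_)
    simp only [fourier_iterate_laplacian_apply, RCLike.inner_apply]
    have : ((-1 : ℂ) ^ m) * (-1) ^ m = 1 := by rw [← mul_pow]; simp
    push_cast
    linear_combination -((2 * Real.pi * ‖ξ‖) ^ (2 * m) * 𝓕 (complexify g) ξ *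
      (starRingEnd ℂ) (𝓕 (complexify f) ξ)) * this
  exact_mod_cast h

theorem integrable_weighted_fourier (k : ℕ) (f : 𝓢(EuclideanSpace ℝ (Fin N), ℝ)) :
    Integrable (fun ξ => (2 * Real.pi * ‖ξ‖) ^ (2 * k) * ‖𝓕 (complexify f) ξ‖ ^ 2) := by
  have h : Integrable (fun ξ => ∑ α : Fin k → Fin N,
      ⟪𝓕 (partialDeriv α (complexify f)) ξ, 𝓕 (partialDeriv α (complexify f)) ξ⟫_ℂ) :=
    integrable_finsetSum _ fun α _ => integrable_inner_schwartz _ _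
  simp only [inner_fourier_partialDeriv] at h
  refine h.re.congr (Eventually.of_forall fun ξ => ?_)
  simp only [inner_self_eq_norm_sq_to_K]
  rw [← RCLike.ofReal_re (K := ℂ) ((2 * Real.pi * ‖ξ‖) ^ (2 * k) * _)]
  congr 1
  push_cast
  rfl

theorem energyForm_self_eq (k : ℕ) (f : 𝓢(EuclideanSpace ℝ (Fin N), ℝ)) :
    energyForm k f f = ∫ ξ, (2 * Real.pi * ‖ξ‖) ^ (2 * k) * ‖𝓕 (complexify f) ξ‖ ^ 2 := by
  have h := energyForm_eq_integral_fourier k f f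
  simp only [inner_self_eq_norm_sq_to_K] at h
  have h2 : ∀ ξ : EuclideanSpace ℝ (Fin N), (((2 * Real.pi * ‖ξ‖) ^ (2 * k) : ℝ) : ℂ) *
      ((‖𝓕 (complexify f) ξ‖ : ℝ) : ℂ) ^ 2 =
        (((2 * Real.pi * ‖ξ‖) ^ (2 * k) * ‖𝓕 (complexify f) ξ‖ ^ 2 : ℝ) : ℂ) := by
    intro ξ
    push_cast
    rfl
  have h3 : (energyForm k f f : ℂ) =
      ∫ ξ, (((2 * Real.pi * ‖ξ‖) ^ (2 * k) * ‖𝓕 (complexify f) ξ‖ ^ 2 : ℝ) : ℂ) := by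
    rw [h]
    exact integral_congr_ae (Eventually.of_forall h2)
  rw [integral_complex_ofReal] at h3
  exact_mod_cast h3

/-- On the Fourier side this is `a^(2k) ≤ 1 + a^(2m)` for `a ≥ 0`. -/
theorem energyForm_self_le {k m : ℕ} (hkm : k ≤ m) (f : 𝓢(EuclideanSpace ℝ (Fin N), ℝ)) :
    energyForm k f f ≤ energyForm 0 f f + energyForm m f f := by
  rw [energyForm_self_eq, energyForm_self_eq, energyForm_self_eq,
    ← integral_add (integrable_weighted_fourier 0 f) (integrable_weighted_fourier m f)]
  refine integral_mono (integrable_weighted_fourier k f)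
    ((integrable_weighted_fourier 0 f).add (integrable_weighted_fourier m f)) fun ξ => ?_
  simp only [mul_zero, pow_zero, one_mul]
  rw [← one_add_mul]
  gcongr
  set a := 2 * Real.pi * ‖ξ‖ with ha
  have ha0 : 0 ≤ a := by positivity
  rcases le_total a 1 with h | h
  · exact (pow_le_one₀ ha0 h).trans (le_add_of_nonneg_right (by positivity))
  · exact (pow_le_pow_right₀ h (by omega)).trans (le_add_of_nonneg_left zero_le_one)

theorem energyForm_zero (f : 𝓢(EuclideanSpace ℝ (Fin N), ℝ)) :
    energyForm 0 f f = ∫ x, f x ^ 2 := by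
  simp only [energyForm, Finset.univ_unique, Finset.sum_singleton, partialDeriv,
    LineDeriv.iteratedLineDerivOp_fin_zero, pow_two]

end Schwartz

/-! ### The form domain `H₀ᵐ(Ω)` -/

section FormDomain

open scoped SchwartzMap FourierTransform LineDeriv

variable {N : ℕ}

/-- The space in which the `m`-th derivatives of a function take their values. -/
abbrev DerivSpace (N m : ℕ) : Type :=
  PiLp 2 fun _ : Fin m → Fin N => Lp ℝ 2 (volume : Measure (EuclideanSpace ℝ (Fin N)))

/-- The family of all partial derivatives of order `m`. -/
noncomputable def derivMap (m : ℕ) : 𝓢(EuclideanSpace ℝ (Fin N), ℝ) →ₗ[ℝ] DerivSpace N m :=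
  (WithLp.linearEquiv 2 ℝ _).symm.toLinearMap ∘ₗ LinearMap.pi fun α =>
    (SchwartzMap.toLpCLM ℝ ℝ 2 volume ∘L
      LineDeriv.iteratedLineDerivOpCLM ℝ 𝓢(EuclideanSpace ℝ (Fin N), ℝ)
        (fun j => EuclideanSpace.basisFun (Fin N) ℝ (α j)) : _ →ₗ[ℝ] _)

theorem derivMap_apply (m : ℕ) (f : 𝓢(EuclideanSpace ℝ (Fin N), ℝ)) (α : Fin m → Fin N) :
    derivMap m f α = (partialDeriv α f).toLp 2 := rfl

theorem inner_derivMap (m : ℕ) (f g : 𝓢(EuclideanSpace ℝ (Fin N), ℝ)) :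
    ⟪derivMap m f, derivMap m g⟫_ℝ = energyForm m f g := by
  rw [PiLp.inner_apply, energyForm]
  refine Finset.sum_congr rfl fun α _ => ?_
  rw [derivMap_apply, derivMap_apply, L2.inner_def]
  refine integral_congr_ae ?_
  filter_upwards [(partialDeriv α f).coeFn_toLp 2 volume,
    (partialDeriv α g).coeFn_toLp 2 volume] with x h1 h2
  rw [h1, h2, real_inner_eq_re_inner, RCLike.inner_apply]
  simp [mul_comm]

theorem norm_derivMap_sq (m : ℕ) (f : 𝓢(EuclideanSpace ℝ (Fin N), ℝ)) :
    ‖derivMap m f‖ ^ 2 = energyForm m f f := by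
  rw [← inner_derivMap, real_inner_self_eq_norm_sq]

variable (Ω : Set (EuclideanSpace ℝ (Fin N)))

/-- The restriction of a Schwartz function to `Ω`. -/
noncomputable def resMap : 𝓢(EuclideanSpace ℝ (Fin N), ℝ) →ₗ[ℝ] L2 Ω :=
  (LpToLpRestrictCLM (EuclideanSpace ℝ (Fin N)) ℝ ℝ volume 2 Ω ∘L
    SchwartzMap.toLpCLM ℝ ℝ 2 volume : _ →ₗ[ℝ] _)

theorem coeFn_resMap (f : 𝓢(EuclideanSpace ℝ (Fin N), ℝ)) :
    resMap Ω f =ᵐ[volume.restrict Ω] f :=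
  (LpToLpRestrictCLM_coeFn ℝ Ω _).trans (ae_restrict_of_ae (f.coeFn_toLp 2 volume))

/-- The test functions, as Schwartz functions. -/
def testSpace : Submodule ℝ 𝓢(EuclideanSpace ℝ (Fin N), ℝ) where
  carrier := {f | IsTest Ω f}
  zero_mem' := ⟨contDiff_const, HasCompactSupport.zero, by
    rw [show ((0 : 𝓢(EuclideanSpace ℝ (Fin N), ℝ)) : EuclideanSpace ℝ (Fin N) → ℝ) = 0 from rfl,
      tsupport, Function.support_zero, closure_empty]
    exact Set.empty_subset _⟩
  add_mem' := fun hf hg => IsTest.add hf hg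
  smul_mem' := fun c _ hf => IsTest.const_smul c hf

variable {Ω}

/-- A test function as a Schwartz function. -/
noncomputable def IsTest.toSchwartz {φ : EuclideanSpace ℝ (Fin N) → ℝ} (hφ : IsTest Ω φ) :
    𝓢(EuclideanSpace ℝ (Fin N), ℝ) :=
  hφ.hasCompactSupport.toSchwartzMap hφ.contDiff

theorem IsTest.toSchwartz_mem {φ : EuclideanSpace ℝ (Fin N) → ℝ} (hφ : IsTest Ω φ) :
    hφ.toSchwartz ∈ testSpace Ω := hφ

theorem IsTest.eq_zero_of_notMem {φ : EuclideanSpace ℝ (Fin N) → ℝ} (hφ : IsTest Ω φ)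
    {x : EuclideanSpace ℝ (Fin N)} (hx : x ∉ Ω) : φ x = 0 :=
  image_eq_zero_of_notMem_tsupport fun h => hx (hφ.tsupport_subset h)

theorem inner_resMap (u : L2 Ω) {f : 𝓢(EuclideanSpace ℝ (Fin N), ℝ)} :
    ⟪u, resMap Ω f⟫_ℝ = ∫ x in Ω, u x * f x := by
  rw [L2.inner_def]
  refine integral_congr_ae ?_
  filter_upwards [coeFn_resMap Ω f] with x h
  rw [h, real_inner_eq_re_inner, RCLike.inner_apply]
  simp [mul_comm]

theorem inner_resMap_resMap (f : 𝓢(EuclideanSpace ℝ (Fin N), ℝ))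
    {g : 𝓢(EuclideanSpace ℝ (Fin N), ℝ)} (hg : g ∈ testSpace Ω) :
    ⟪resMap Ω f, resMap Ω g⟫_ℝ = ∫ x, f x * g x := by
  rw [inner_resMap, ← setIntegral_eq_integral_of_forall_compl_eq_zero (s := Ω)
    (f := fun x => f x * g x)]
  · refine integral_congr_ae ?_
    filter_upwards [coeFn_resMap Ω f] with x h
    rw [h]
  · intro x hx
    rw [IsTest.eq_zero_of_notMem hg hx, mul_zero]

theorem norm_resMap_sq {f : 𝓢(EuclideanSpace ℝ (Fin N), ℝ)} (hf : f ∈ testSpace Ω) :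
    ‖resMap Ω f‖ ^ 2 = energyForm 0 f f := by
  rw [← real_inner_self_eq_norm_sq, inner_resMap_resMap f hf, energyForm_zero]
  simp only [pow_two]

/-- The iterated Laplacian of Schwartz functions. -/
noncomputable def schwartzLaplacian (m : ℕ) (f : 𝓢(EuclideanSpace ℝ (Fin N), ℝ)) :
    𝓢(EuclideanSpace ℝ (Fin N), ℝ) :=
  (fun h : 𝓢(EuclideanSpace ℝ (Fin N), ℝ) => Δ h)^[m] f

theorem coe_schwartzLaplacian (m : ℕ) (f : 𝓢(EuclideanSpace ℝ (Fin N), ℝ)) :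
    (schwartzLaplacian m f : EuclideanSpace ℝ (Fin N) → ℝ) = iterLaplacian m f :=
  (iterLaplacian_coe m f).symm

theorem schwartzLaplacian_mem (m : ℕ) {f : 𝓢(EuclideanSpace ℝ (Fin N), ℝ)}
    (hf : f ∈ testSpace Ω) : schwartzLaplacian m f ∈ testSpace Ω := by
  change IsTest Ω _
  rw [coe_schwartzLaplacian]
  exact IsTest.iterLaplacian m hf

theorem isWeakPolyharmonic_iff {m : ℕ} {u g : L2 Ω} :
    IsWeakPolyharmonic Ω m u g ↔ ∀ f ∈ testSpace Ω,
      ⟪g, resMap Ω f⟫_ℝ = (-1) ^ (m + 1) * ⟪u, resMap Ω (schwartzLaplacian m f)⟫_ℝ := by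
  simp only [inner_resMap, coe_schwartzLaplacian]
  exact ⟨fun h f hf => h f hf, fun h φ hφ => h hφ.toSchwartz hφ.toSchwartz_mem⟩

variable (Ω) in
/-- The closure of the graph of `derivMap` on the test functions. -/
noncomputable def formGraph (m : ℕ) : Submodule ℝ (L2 Ω × DerivSpace N m) :=
  ((testSpace Ω).map ((resMap Ω).prod (derivMap m))).topologicalClosure

theorem mem_formGraph_iff {m : ℕ} {x : L2 Ω × DerivSpace N m} :
    x ∈ formGraph Ω m ↔ ∃ f : ℕ → 𝓢(EuclideanSpace ℝ (Fin N), ℝ), (∀ n, f n ∈ testSpace Ω) ∧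
      Tendsto (fun n => resMap Ω (f n)) atTop (𝓝 x.1) ∧
      Tendsto (fun n => derivMap m (f n)) atTop (𝓝 x.2) := by
  rw [formGraph, ← SetLike.mem_coe, Submodule.topologicalClosure_coe, mem_closure_iff_seq_limit]
  constructor
  · rintro ⟨y, hy, hyx⟩
    choose f hf hfy using hy
    refine ⟨f, hf, ?_, ?_⟩
    · exact ((continuous_fst.tendsto x).comp hyx).congr fun n => by simp [← hfy n]
    · exact ((continuous_snd.tendsto x).comp hyx).congr fun n => by simp [← hfy n]
  · rintro ⟨f, hf, h1, h2⟩
    exact ⟨fun n => (resMap Ω (f n), derivMap m (f n)), fun n => ⟨f n, hf n, rfl⟩,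
      h1.prodMk_nhds h2⟩

/-- Green's formula. The distributional equation is tested with a fixed `f` while `u` is
approximated, so no Laplacian of the approximants has to converge; afterwards `v` is approximated.
-/
theorem inner_eq_of_mem_formGraph {m : ℕ} {u g : L2 Ω} {w : DerivSpace N m}
    (huw : (u, w) ∈ formGraph Ω m) (hg : IsWeakPolyharmonic Ω m u g) {v : L2 Ω}
    {z : DerivSpace N m} (hvz : (v, z) ∈ formGraph Ω m) : ⟪g, v⟫_ℝ = -⟪w, z⟫_ℝ := by
  rw [isWeakPolyharmonic_iff] at hg
  have key : ∀ f ∈ testSpace Ω, ⟪g, resMap Ω f⟫_ℝ = -⟪w, derivMap m f⟫_ℝ := by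
    intro f hf
    obtain ⟨h, hh, h1, h2⟩ := mem_formGraph_iff.1 huw
    have h3 : Tendsto (fun n => (-1) ^ m * ⟪resMap Ω (h n), resMap Ω (schwartzLaplacian m f)⟫_ℝ)
        atTop (𝓝 ((-1) ^ m * ⟪u, resMap Ω (schwartzLaplacian m f)⟫_ℝ)) :=
      (h1.inner tendsto_const_nhds).const_mul _
    have h4 : Tendsto (fun n => ⟪derivMap m (h n), derivMap m f⟫_ℝ) atTop
        (𝓝 ⟪w, derivMap m f⟫_ℝ) := h2.inner tendsto_const_nhds
    have h5 := tendsto_nhds_unique (h3.congr fun n => by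
      rw [inner_resMap_resMap _ (schwartzLaplacian_mem m hf), coe_schwartzLaplacian,
        ← energyForm_eq, inner_derivMap]) h4
    rw [hg f hf, ← h5]
    ring
  obtain ⟨f, hf, h1, h2⟩ := mem_formGraph_iff.1 hvz
  exact tendsto_nhds_unique ((tendsto_const_nhds.inner h1).congr fun n => key _ (hf n))
    (tendsto_const_nhds.inner h2).neg

/-- `MemH0` is phrased with full derivative tensors and `formGraph` with partial derivatives; the
estimates from here on compare the two. -/
theorem norm_multilinear_le {k : ℕ}
    (A : ContinuousMultilinearMap ℝ (fun _ : Fin k => EuclideanSpace ℝ (Fin N)) ℝ) :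
    ‖A‖ ≤ ∑ α : Fin k → Fin N, ‖A fun j => EuclideanSpace.basisFun (Fin N) ℝ (α j)‖ := by
  refine A.opNorm_le_bound (Finset.sum_nonneg fun _ _ => norm_nonneg _) fun v => ?_
  have hv : v = fun j => ∑ i, v j i • EuclideanSpace.basisFun (Fin N) ℝ i := by
    funext j
    exact ((EuclideanSpace.basisFun (Fin N) ℝ).sum_repr (v j)).symm
  have h1 : A v = ∑ α : Fin k → Fin N, (∏ j, v j (α j)) *
      A fun j => EuclideanSpace.basisFun (Fin N) ℝ (α j) := by
    conv_lhs => rw [hv]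
    rw [A.map_sum]
    refine Finset.sum_congr rfl fun α _ => ?_
    rw [A.map_smul_univ, smul_eq_mul]
  rw [h1, Finset.sum_mul]
  refine (norm_sum_le _ _).trans (Finset.sum_le_sum fun α _ => ?_)
  rw [norm_mul, mul_comm, norm_prod]
  gcongr with j
  exact PiLp.norm_apply_le (v j) (α j)

theorem norm_partialDeriv_le {k : ℕ} (α : Fin k → Fin N)
    (f : 𝓢(EuclideanSpace ℝ (Fin N), ℝ)) (x : EuclideanSpace ℝ (Fin N)) :
    ‖partialDeriv α f x‖ ≤ ‖iteratedFDeriv ℝ k f x‖ := by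
  rw [partialDeriv_apply]
  refine ((iteratedFDeriv ℝ k f x).le_opNorm _).trans ?_
  simp

theorem eLpNorm_partialDeriv_le {k : ℕ} (α : Fin k → Fin N)
    {f : 𝓢(EuclideanSpace ℝ (Fin N), ℝ)} (hf : f ∈ testSpace Ω) :
    eLpNorm (partialDeriv α f) 2 volume ≤
      eLpNorm (iteratedFDeriv ℝ k f) 2 (volume.restrict Ω) := by
  have h0 : ∀ x ∉ Ω, partialDeriv α f x = 0 := by
    intro x hx
    rw [partialDeriv_apply]
    have : iteratedFDeriv ℝ k f x = 0 := by
      by_contra h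
      exact hx ((IsTest.tsupport_subset hf) (support_iteratedFDeriv_subset (𝕜 := ℝ) k h))
    rw [this]
    rfl
  have h1 : eLpNorm (partialDeriv α f) 2 volume =
      eLpNorm (partialDeriv α f) 2 (volume.restrict Ω) := by
    refine (eLpNorm_restrict_eq_of_support_subset fun x hx => ?_).symm
    by_contra h
    exact hx (h0 x h)
  rw [h1]
  exact eLpNorm_mono (norm_partialDeriv_le α f)

theorem enorm_derivMap_le {m : ℕ} {f : 𝓢(EuclideanSpace ℝ (Fin N), ℝ)} (hf : f ∈ testSpace Ω) :
    ‖derivMap m f‖ₑ ≤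
      Fintype.card (Fin m → Fin N) * eLpNorm (iteratedFDeriv ℝ m f) 2 (volume.restrict Ω) := by
  have h1 : ‖derivMap m f‖ ≤ ∑ α : Fin m → Fin N, ‖derivMap m f α‖ := by
    refine le_of_sq_le_sq ?_ (Finset.sum_nonneg fun _ _ => norm_nonneg _)
    rw [PiLp.norm_sq_eq_of_L2]
    exact Finset.sum_sq_le_sq_sum_of_nonneg fun _ _ => norm_nonneg _
  calc ‖derivMap m f‖ₑ = ENNReal.ofReal ‖derivMap m f‖ := (ofReal_norm _).symm
    _ ≤ ENNReal.ofReal (∑ α : Fin m → Fin N, ‖derivMap m f α‖) := ENNReal.ofReal_le_ofReal h1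
    _ = ∑ α : Fin m → Fin N, ‖derivMap m f α‖ₑ := by
      rw [ENNReal.ofReal_sum_of_nonneg fun _ _ => norm_nonneg _]
      simp only [ofReal_norm]
    _ ≤ ∑ α : Fin m → Fin N, eLpNorm (iteratedFDeriv ℝ m f) 2 (volume.restrict Ω) := by
      refine Finset.sum_le_sum fun α _ => ?_
      rw [derivMap_apply, Lp.enorm_def,
        eLpNorm_congr_ae ((partialDeriv α f).coeFn_toLp 2 volume)]
      exact eLpNorm_partialDeriv_le α hf
    _ = _ := by rw [Finset.sum_const, nsmul_eq_mul, Finset.card_univ]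

/-- `MemH0` asks for Cauchy sequences in all orders up to `m`, whereas the form graph controls only
the orders `0` and `m`; the intermediate ones follow by interpolation. -/
theorem eLpNorm_iteratedFDeriv_le {k m : ℕ} (hkm : k ≤ m)
    {f : 𝓢(EuclideanSpace ℝ (Fin N), ℝ)} (hf : f ∈ testSpace Ω) :
    eLpNorm (iteratedFDeriv ℝ k f) 2 (volume.restrict Ω) ≤
      Fintype.card (Fin k → Fin N) * (‖resMap Ω f‖ₑ + ‖derivMap m f‖ₑ) := by
  have h1 : ∀ α : Fin k → Fin N, eLpNorm (partialDeriv α f) 2 (volume.restrict Ω) ≤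
      ‖resMap Ω f‖ₑ + ‖derivMap m f‖ₑ := by
    intro α
    have h2 : ‖derivMap k f‖ ≤ ‖resMap Ω f‖ + ‖derivMap m f‖ := by
      refine le_of_sq_le_sq ?_ (by positivity)
      have := energyForm_self_le hkm f
      rw [← norm_resMap_sq hf, ← norm_derivMap_sq, ← norm_derivMap_sq] at this
      nlinarith [norm_nonneg (resMap Ω f), norm_nonneg (derivMap m f)]
    have h3 : ‖(partialDeriv α f).toLp 2 volume‖ ≤ ‖derivMap k f‖ :=
      PiLp.norm_apply_le (derivMap k f) α
    calc eLpNorm (partialDeriv α f) 2 (volume.restrict Ω)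
        ≤ eLpNorm (partialDeriv α f) 2 volume := eLpNorm_mono_measure _ Measure.restrict_le_self
      _ = ‖(partialDeriv α f).toLp 2 volume‖ₑ := by
        rw [Lp.enorm_def]
        exact (eLpNorm_congr_ae ((partialDeriv α f).coeFn_toLp 2 volume)).symm
      _ ≤ _ := by
        rw [← ofReal_norm, ← ofReal_norm, ← ofReal_norm,
          ← ENNReal.ofReal_add (norm_nonneg _) (norm_nonneg _)]
        exact ENNReal.ofReal_le_ofReal (h3.trans h2)
  calc eLpNorm (iteratedFDeriv ℝ k f) 2 (volume.restrict Ω)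
      ≤ eLpNorm (∑ α : Fin k → Fin N, fun x => ‖partialDeriv α f x‖) 2 (volume.restrict Ω) := by
        refine eLpNorm_mono_real fun x => ?_
        rw [Finset.sum_apply]
        refine (norm_multilinear_le _).trans (le_of_eq ?_)
        simp only [partialDeriv_apply]
    _ ≤ ∑ α : Fin k → Fin N, eLpNorm (fun x => ‖partialDeriv α f x‖) 2 (volume.restrict Ω) :=
        eLpNorm_sum_le (fun α _ => (partialDeriv α f).continuous.norm.aestronglyMeasurable)
          (by norm_num)
    _ ≤ ∑ α : Fin k → Fin N, (‖resMap Ω f‖ₑ + ‖derivMap m f‖ₑ) := by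
        refine Finset.sum_le_sum fun α _ => ?_
        rw [eLpNorm_norm]
        exact h1 α
    _ = _ := by rw [Finset.sum_const, nsmul_eq_mul, Finset.card_univ]

end FormDomain

/-! ### Compactness of the embedding of the form domain -/

section Rellich

open scoped SchwartzMap FourierTransform LineDeriv

variable {N : ℕ} {Ω : Set (EuclideanSpace ℝ (Fin N))}

/-- The limit `w` of the `m`-th derivatives of the approximating test functions is carried along
with `u`, so that energy identities can be stated without approximation. -/
theorem memH0_iff {m : ℕ} {u : L2 Ω} :
    MemH0 Ω m u ↔ ∃ w : DerivSpace N m, (u, w) ∈ formGraph Ω m := by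
  constructor
  · rintro ⟨φ, hφ, h1, h2⟩
    set f : ℕ → 𝓢(EuclideanSpace ℝ (Fin N), ℝ) := fun n => (hφ n).toSchwartz with hf
    have hft : ∀ n, f n ∈ testSpace Ω := fun n => (hφ n).toSchwartz_mem
    have hres : Tendsto (fun n => resMap Ω (f n)) atTop (𝓝 u) := by
      rw [Lp.tendsto_Lp_iff_tendsto_eLpNorm']
      refine h1.congr fun n => eLpNorm_congr_ae ?_
      filter_upwards [coeFn_resMap Ω (f n)] with x hx
      rw [Pi.sub_apply, hx]
      rfl
    have hcau : CauchySeq fun n => derivMap m (f n) := by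
      rw [cauchySeq_iff_tendsto_dist_atTop_0]
      have h3 : Tendsto (fun q : ℕ × ℕ => ‖derivMap m (f q.1 - f q.2)‖ₑ) atTop (𝓝 0) := by
        have h4 := ENNReal.Tendsto.const_mul (h2 m le_rfl)
          (Or.inr (ENNReal.natCast_ne_top (Fintype.card (Fin m → Fin N))))
        rw [mul_zero] at h4
        refine tendsto_of_tendsto_of_tendsto_of_le_of_le tendsto_const_nhds h4
          (fun q => zero_le) fun q => ?_
        exact enorm_derivMap_le ((testSpace Ω).sub_mem (hft q.1) (hft q.2))
      refine ((ENNReal.tendsto_toReal ENNReal.zero_ne_top).comp h3).congr fun q => ?_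
      rw [Function.comp_apply, toReal_enorm, map_sub, dist_eq_norm]
    obtain ⟨w, hw⟩ := cauchySeq_tendsto_of_complete hcau
    exact ⟨w, mem_formGraph_iff.2 ⟨f, hft, hres, hw⟩⟩
  · rintro ⟨w, hw⟩
    obtain ⟨f, hf, h1, h2⟩ := mem_formGraph_iff.1 hw
    refine ⟨fun n => f n, hf, ?_, fun k hk => ?_⟩
    · rw [Lp.tendsto_Lp_iff_tendsto_eLpNorm'] at h1
      refine h1.congr fun n => eLpNorm_congr_ae ?_
      filter_upwards [coeFn_resMap Ω (f n)] with x hx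
      rw [Pi.sub_apply, hx]
    · have key : ∀ {F : Type} [NormedAddCommGroup F] [NormedSpace ℝ F]
          (A : 𝓢(EuclideanSpace ℝ (Fin N), ℝ) →ₗ[ℝ] F) (l : F),
          Tendsto (fun n => A (f n)) atTop (𝓝 l) →
          Tendsto (fun q : ℕ × ℕ => ‖A (f q.1 - f q.2)‖ₑ) atTop (𝓝 0) := by
        intro F _ _ A l hl
        have h3 : Tendsto (fun q : ℕ × ℕ => A (f q.1) - A (f q.2)) atTop (𝓝 (l - l)) := by
          rw [← prod_atTop_atTop_eq]
          exact (hl.comp tendsto_fst).sub (hl.comp tendsto_snd)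
        have h4 := h3.enorm
        simpa using h4
      have h5 := ENNReal.Tendsto.const_mul ((key (resMap Ω) u h1).add (key (derivMap m) w h2))
        (Or.inr (ENNReal.natCast_ne_top (Fintype.card (Fin k → Fin N))))
      rw [add_zero, mul_zero] at h5
      refine tendsto_of_tendsto_of_tendsto_of_le_of_le tendsto_const_nhds h5
        (fun q => zero_le) fun q => ?_
      have h6 : (f q.1 : EuclideanSpace ℝ (Fin N) → ℝ) - f q.2 = (f q.1 - f q.2 : 𝓢(_, ℝ)) := rfl
      rw [h6]
      exact eLpNorm_iteratedFDeriv_le hk ((testSpace Ω).sub_mem (hf q.1) (hf q.2))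

theorem exists_subseq_weakly_convergent {H : Type*} [NormedAddCommGroup H] [InnerProductSpace ℝ H]
    [CompleteSpace H] [TopologicalSpace.SeparableSpace H] {a : ℕ → H} {C : ℝ}
    (ha : ∀ n, ‖a n‖ ≤ C) :
    ∃ φ : ℕ → ℕ, StrictMono φ ∧ ∀ v, ∃ l, Tendsto (fun n => ⟪v, a (φ n)⟫_ℝ) atTop (𝓝 l) := by
  obtain ⟨y, -, φ, hφ, hy⟩ := WeakDual.isSeqCompact_closedBall ℝ H 0 C
    (x := fun n => StrongDual.toWeakDual (InnerProductSpace.toDual ℝ H (a n))) (fun n => by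
      simpa using ha n)
  refine ⟨φ, hφ, fun v => ⟨y v, ?_⟩⟩
  refine (((WeakDual.eval_continuous v).tendsto y).comp hy).congr fun n => ?_
  simp [real_inner_comm]

/-- The function `x ↦ h (2π ⟨x, ξ⟩)` on `Ω`, for a bounded continuous function `h`. -/
noncomputable def waveFun [IsFiniteMeasure (volume.restrict Ω)] {h : ℝ → ℝ} (hc : Continuous h)
    (hb : ∀ t, |h t| ≤ 1) (ξ : EuclideanSpace ℝ (Fin N)) : L2 Ω :=
  MemLp.toLp (fun x => h (2 * Real.pi * ⟪x, ξ⟫_ℝ))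
    (MemLp.of_bound (by fun_prop) 1 (Eventually.of_forall fun _ => hb _))

theorem norm_waveFun_le [IsFiniteMeasure (volume.restrict Ω)] {h : ℝ → ℝ} (hc : Continuous h)
    (hb : ∀ t, |h t| ≤ 1) (ξ : EuclideanSpace ℝ (Fin N)) :
    ‖(waveFun hc hb ξ : L2 Ω)‖ ≤
      ((volume.restrict Ω).real Set.univ) ^ ((2 : ENNReal).toReal)⁻¹ * 1 := by
  refine Lp.norm_le_of_ae_bound zero_le_one ?_
  filter_upwards [MemLp.coeFn_toLp (MemLp.of_bound (μ := volume.restrict Ω) (p := 2)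
    (f := fun x => h (2 * Real.pi * ⟪x, ξ⟫_ℝ)) (by fun_prop) 1
    (Eventually.of_forall fun _ => hb _))] with x hx
  rw [waveFun, hx]
  exact hb _

theorem inner_waveFun_resMap [IsFiniteMeasure (volume.restrict Ω)] {h : ℝ → ℝ}
    (hc : Continuous h) (hb : ∀ t, |h t| ≤ 1) (ξ : EuclideanSpace ℝ (Fin N))
    {f : 𝓢(EuclideanSpace ℝ (Fin N), ℝ)} (hf : f ∈ testSpace Ω) :
    ⟪waveFun hc hb ξ, resMap Ω f⟫_ℝ = ∫ x, h (2 * Real.pi * ⟪x, ξ⟫_ℝ) * f x := by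
  rw [inner_resMap, ← setIntegral_eq_integral_of_forall_compl_eq_zero (s := Ω)
    (f := fun x => h (2 * Real.pi * ⟪x, ξ⟫_ℝ) * f x)]
  · refine integral_congr_ae ?_
    filter_upwards [MemLp.coeFn_toLp (MemLp.of_bound (μ := volume.restrict Ω) (p := 2)
      (f := fun x => h (2 * Real.pi * ⟪x, ξ⟫_ℝ)) (by fun_prop) 1
      (Eventually.of_forall fun _ => hb _))] with x hx
    rw [waveFun, hx]
  · intro x hx
    rw [IsTest.eq_zero_of_notMem hf hx, mul_zero]

/-- As `f` is supported in `Ω`, which has finite measure, each Fourier value is a pairing in `L²(Ω)`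
with fixed waves. Weak convergence therefore implies pointwise convergence of the Fourier
transforms. -/
theorem fourier_complexify_eq_inner [IsFiniteMeasure (volume.restrict Ω)]
    {f : 𝓢(EuclideanSpace ℝ (Fin N), ℝ)} (hf : f ∈ testSpace Ω)
    (ξ : EuclideanSpace ℝ (Fin N)) :
    𝓕 (complexify f) ξ =
      (⟪(waveFun Real.continuous_cos Real.abs_cos_le_one ξ : L2 Ω), resMap Ω f⟫_ℝ : ℂ) -
      Complex.I * (⟪(waveFun Real.continuous_sin Real.abs_sin_le_one ξ : L2 Ω),
        resMap Ω f⟫_ℝ : ℂ) := by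
  have hint : ∀ h : ℝ → ℝ, Continuous h → (∀ t, |h t| ≤ 1) →
      Integrable fun x => ((h (2 * Real.pi * ⟪x, ξ⟫_ℝ) * f x : ℝ) : ℂ) := by
    intro h hc hb
    refine Integrable.ofReal (f.integrable.bdd_mul (c := 1) ?_ (Eventually.of_forall fun x => hb _))
    exact Continuous.aestronglyMeasurable (by fun_prop)
  rw [inner_waveFun_resMap _ _ _ hf, inner_waveFun_resMap _ _ _ hf, ← integral_complex_ofReal,
    ← integral_complex_ofReal, ← integral_const_mul, ← integral_sub
      (hint _ Real.continuous_cos Real.abs_cos_le_one)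
      ((hint _ Real.continuous_sin Real.abs_sin_le_one).const_mul _),
    SchwartzMap.fourier_coe, Real.fourier_eq']
  refine integral_congr_ae (Eventually.of_forall fun x => ?_)
  simp only [complexify_apply, smul_eq_mul]
  rw [Complex.exp_mul_I, ← Complex.ofReal_cos, ← Complex.ofReal_sin]
  rw [show -2 * Real.pi * ⟪x, ξ⟫_ℝ = -(2 * Real.pi * ⟪x, ξ⟫_ℝ) by ring, Real.cos_neg, Real.sin_neg]
  push_cast
  ring

/-- A bounded sequence of test functions in `H₀ᵐ(Ω)`, `m ≥ 1`, has a subsequence that is Cauchy in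
`L²(Ω)`. -/
theorem exists_subseq_cauchySeq_resMap [IsFiniteMeasure (volume.restrict Ω)] {m : ℕ} (hm : 0 < m)
    {f : ℕ → 𝓢(EuclideanSpace ℝ (Fin N), ℝ)} (hf : ∀ n, f n ∈ testSpace Ω) {C : ℝ}
    (h1 : ∀ n, ‖resMap Ω (f n)‖ ≤ C) (h2 : ∀ n, ‖derivMap m (f n)‖ ≤ C) :
    ∃ φ : ℕ → ℕ, StrictMono φ ∧ CauchySeq fun n => resMap Ω (f (φ n)) := by
  have : Fact ((2 : ENNReal) ≠ ⊤) := ⟨ENNReal.ofNat_ne_top⟩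
  obtain ⟨φ, hφ, hw⟩ := exists_subseq_weakly_convergent h1
  refine ⟨φ, hφ, ?_⟩
  have hC : 0 ≤ C := (norm_nonneg _).trans (h1 0)
  set d : ℕ × ℕ → 𝓢(EuclideanSpace ℝ (Fin N), ℝ) := fun q => f (φ q.1) - f (φ q.2) with hd
  have hdt : ∀ q, d q ∈ testSpace Ω := fun q => (testSpace Ω).sub_mem (hf _) (hf _)
  set B : ℝ := ((volume.restrict Ω).real Set.univ) ^ ((2 : ENNReal).toReal)⁻¹ * 1 with hB
  have hB0 : 0 ≤ B := by positivity
  have hdres : ∀ q, ‖resMap Ω (d q)‖ ≤ 2 * C := fun q => by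
    rw [hd, map_sub]
    refine (norm_sub_le _ _).trans ?_
    linarith [h1 (φ q.1), h1 (φ q.2)]
  have hdder : ∀ q, ‖derivMap m (d q)‖ ≤ 2 * C := fun q => by
    rw [hd, map_sub]
    refine (norm_sub_le _ _).trans ?_
    linarith [h2 (φ q.1), h2 (φ q.2)]
  have hbound : ∀ q ξ, ‖𝓕 (complexify (d q)) ξ‖ ≤ 4 * B * C := by
    intro q ξ
    rw [fourier_complexify_eq_inner (hdt q)]
    refine (norm_sub_le _ _).trans ?_
    rw [norm_mul, Complex.norm_I, one_mul, Complex.norm_real, Complex.norm_real]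
    have h3 : ∀ v : L2 Ω, ‖v‖ ≤ B → ‖⟪v, resMap Ω (d q)⟫_ℝ‖ ≤ B * (2 * C) := fun v hv =>
      (norm_inner_le_norm _ _).trans (mul_le_mul hv (hdres q) (norm_nonneg _) hB0)
    have h4 := h3 _ (norm_waveFun_le Real.continuous_cos Real.abs_cos_le_one ξ)
    have h5 := h3 _ (norm_waveFun_le Real.continuous_sin Real.abs_sin_le_one ξ)
    linarith
  have hpt : ∀ ξ, Tendsto (fun q => ‖𝓕 (complexify (d q)) ξ‖ ^ 2) atTop (𝓝 0) := by
    intro ξ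
    have h3 : ∀ v : L2 Ω, Tendsto (fun q => ⟪v, resMap Ω (d q)⟫_ℝ) atTop (𝓝 0) := by
      intro v
      obtain ⟨l, hl⟩ := hw v
      have : Tendsto (fun q : ℕ × ℕ => ⟪v, resMap Ω (f (φ q.1))⟫_ℝ -
          ⟪v, resMap Ω (f (φ q.2))⟫_ℝ) atTop (𝓝 (l - l)) := by
        rw [← prod_atTop_atTop_eq]
        exact (hl.comp tendsto_fst).sub (hl.comp tendsto_snd)
      rw [sub_self] at this
      refine this.congr fun q => ?_
      rw [hd, map_sub, inner_sub_right]
    simp only [fun q => fourier_complexify_eq_inner (hdt q) ξ]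
    have h4 := ((Complex.continuous_ofReal.tendsto 0).comp (h3 (waveFun Real.continuous_cos
      Real.abs_cos_le_one ξ))).sub (((Complex.continuous_ofReal.tendsto 0).comp
      (h3 (waveFun Real.continuous_sin Real.abs_sin_le_one ξ))).const_mul Complex.I)
    have h5 := h4.norm.pow 2
    simpa using h5
  have hball : ∀ R : ℝ, Tendsto (fun q => ∫ ξ in Metric.closedBall 0 R,
      ‖𝓕 (complexify (d q)) ξ‖ ^ 2) atTop (𝓝 0) := by
    intro R
    have := tendsto_integral_filter_of_dominated_convergence
      (μ := volume.restrict (Metric.closedBall (0 : EuclideanSpace ℝ (Fin N)) R))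
      (l := (atTop : Filter (ℕ × ℕ))) (F := fun q ξ => ‖𝓕 (complexify (d q)) ξ‖ ^ 2)
      (f := fun _ => 0) (fun _ => (4 * B * C) ^ 2)
      (Eventually.of_forall fun q =>
        ((𝓕 (complexify (d q))).continuous.norm.pow 2).aestronglyMeasurable)
      (Eventually.of_forall fun q => Eventually.of_forall fun ξ => by
        rw [norm_pow, norm_norm]
        exact pow_le_pow_left₀ (norm_nonneg _) (hbound q ξ) 2)
      (integrableOn_const (measure_closedBall_lt_top.ne))
      (Eventually.of_forall hpt)
    simpa using this
  -- Low frequencies tend to zero by dominated convergence on a ball. Outside it `(2π‖ξ‖)^(2m) ≥ R`,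
  -- as `m ≥ 1`, so the bound on the `m`-th derivatives makes the tail `O(1/R)` uniformly in `q`. No
  -- regularity of the boundary is used.
  have hest : ∀ R ≥ 1, ∀ q, ‖resMap Ω (d q)‖ ^ 2 ≤
      (∫ ξ in Metric.closedBall 0 R, ‖𝓕 (complexify (d q)) ξ‖ ^ 2) + 1 / R * (2 * C) ^ 2 := by
    intro R hR q
    have hi0 : Integrable fun ξ => ‖𝓕 (complexify (d q)) ξ‖ ^ 2 := by
      simpa using integrable_weighted_fourier 0 (d q)
    have him := integrable_weighted_fourier m (d q)
    have h3 : 1 / R * ‖derivMap m (d q)‖ ^ 2 ≤ 1 / R * (2 * C) ^ 2 := by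
      gcongr
      exact hdder q
    refine le_trans ?_ (add_le_add_right h3 _)
    rw [norm_resMap_sq (hdt q), norm_derivMap_sq, energyForm_self_eq, energyForm_self_eq,
      ← integral_indicator Metric.isClosed_closedBall.measurableSet, ← integral_const_mul,
      ← integral_add (hi0.indicator Metric.isClosed_closedBall.measurableSet)
        (him.const_mul _)]
    refine integral_mono (integrable_weighted_fourier 0 (d q))
      ((hi0.indicator Metric.isClosed_closedBall.measurableSet).add (him.const_mul _)) fun ξ => ?_
    simp only [mul_zero, pow_zero, one_mul]
    by_cases hξ : ξ ∈ Metric.closedBall (0 : EuclideanSpace ℝ (Fin N)) R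
    · rw [Set.indicator_of_mem hξ]
      exact le_add_of_nonneg_right (by positivity)
    · rw [Set.indicator_of_notMem hξ, zero_add, ← mul_assoc]
      have hR' : R < ‖ξ‖ := by simpa using hξ
      refine le_mul_of_one_le_left (by positivity) ?_
      rw [one_div, ← div_eq_inv_mul, one_le_div (by linarith)]
      calc R ≤ ‖ξ‖ := hR'.le
        _ ≤ 2 * Real.pi * ‖ξ‖ := by nlinarith [Real.pi_gt_three, norm_nonneg ξ]
        _ ≤ (2 * Real.pi * ‖ξ‖) ^ (2 * m) :=
          le_self_pow₀ (by nlinarith [Real.pi_gt_three, norm_nonneg ξ]) (by omega)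
  have hfin : Tendsto (fun q => ‖resMap Ω (d q)‖ ^ 2) atTop (𝓝 0) := by
    rw [tendsto_order]
    refine ⟨fun a ha => Eventually.of_forall fun q => ha.trans_le (by positivity),
      fun ε hε => ?_⟩
    set R : ℝ := max 1 (2 * ((2 * C) ^ 2 + 1) / ε) with hR
    have hR1 : 1 ≤ R := le_max_left _ _
    have hR2 : 1 / R * (2 * C) ^ 2 < ε / 2 := by
      have h3 : 2 * ((2 * C) ^ 2 + 1) / ε ≤ R := le_max_right _ _
      rw [div_le_iff₀ hε] at h3
      rw [one_div, inv_mul_lt_iff₀ (by linarith)]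
      nlinarith
    filter_upwards [(hball R).eventually_lt_const (half_pos hε)] with q hq
    linarith [hest R hR1 q]
  rw [cauchySeq_iff_tendsto_dist_atTop_0]
  have h3 := (Real.continuous_sqrt.tendsto 0).comp hfin
  rw [Real.sqrt_zero] at h3
  refine h3.congr fun q => ?_
  rw [Function.comp_apply, Real.sqrt_sq (norm_nonneg _), hd, map_sub, dist_eq_norm]

end Rellich

/-! ### The Dirichlet realization of `(-1)^(m+1) Δ^m` -/

section DirichletDomain

variable {N : ℕ} {Ω : Set (EuclideanSpace ℝ (Fin N))} {m : ℕ}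

theorem isFiniteMeasure_restrict_of_isBounded (hΩ : Bornology.IsBounded Ω) :
    IsFiniteMeasure (volume.restrict Ω) :=
  ⟨by simpa using hΩ.measure_lt_top⟩

variable (Ω m) in
/-- The embedding of the domain into `L²(Ω)`. -/
noncomputable def toL2CLM : dirichletDomain Ω m →L[ℝ] L2 Ω :=
  ContinuousLinearMap.fst ℝ (L2 Ω) (L2 Ω) ∘L (dirichletDomain Ω m).subtypeL

variable (Ω m) in
/-- The operator `(-1)^(m+1) Δ^m` as a bounded operator on its domain. -/
noncomputable def polyLaplacianCLM : dirichletDomain Ω m →L[ℝ] L2 Ω :=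
  ContinuousLinearMap.snd ℝ (L2 Ω) (L2 Ω) ∘L (dirichletDomain Ω m).subtypeL

theorem toL2CLM_apply (x : dirichletDomain Ω m) : toL2CLM Ω m x = toL2 x := rfl

theorem polyLaplacianCLM_apply (x : dirichletDomain Ω m) :
    polyLaplacianCLM Ω m x = polyLaplacian x := rfl

theorem norm_eq_max (x : dirichletDomain Ω m) :
    ‖x‖ = max ‖toL2CLM Ω m x‖ ‖polyLaplacianCLM Ω m x‖ := rfl

theorem norm_toL2CLM_le (x : dirichletDomain Ω m) : ‖toL2CLM Ω m x‖ ≤ ‖x‖ := le_max_left _ _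

theorem norm_polyLaplacianCLM_le (x : dirichletDomain Ω m) : ‖polyLaplacianCLM Ω m x‖ ≤ ‖x‖ :=
  le_max_right _ _

theorem tendsto_dirichletDomain_iff {β : Type*} {l : Filter β} {x : β → dirichletDomain Ω m}
    {y : dirichletDomain Ω m} : Tendsto x l (𝓝 y) ↔
      Tendsto (fun b => toL2CLM Ω m (x b)) l (𝓝 (toL2CLM Ω m y)) ∧
      Tendsto (fun b => polyLaplacianCLM Ω m (x b)) l (𝓝 (polyLaplacianCLM Ω m y)) := by
  rw [tendsto_subtype_rng, Prod.tendsto_iff]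
  rfl

theorem inner_eq_of_mem_dirichletDomain {x y : L2 Ω × L2 Ω} (hx : x ∈ dirichletDomain Ω m)
    {w z : DerivSpace N m} (hw : (x.1, w) ∈ formGraph Ω m) (hz : (y.1, z) ∈ formGraph Ω m) :
    ⟪x.2, y.1⟫_ℝ = -⟪w, z⟫_ℝ :=
  inner_eq_of_mem_formGraph hw hx.2 hz

theorem norm_sq_eq_of_mem_dirichletDomain {x : L2 Ω × L2 Ω} (hx : x ∈ dirichletDomain Ω m)
    {w : DerivSpace N m} (hw : (x.1, w) ∈ formGraph Ω m) : ‖w‖ ^ 2 = -⟪x.2, x.1⟫_ℝ := by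
  rw [inner_eq_of_mem_dirichletDomain hx hw hw, real_inner_self_eq_norm_sq, neg_neg]

/-- By Green's formula `‖w‖² = -⟪x.2, x.1⟫`, so the graph norm controls the `m`-th derivatives.
Completeness of the domain and its compact embedding rest on this. -/
theorem norm_le_of_mem_dirichletDomain {x : L2 Ω × L2 Ω} (hx : x ∈ dirichletDomain Ω m)
    {w : DerivSpace N m} (hw : (x.1, w) ∈ formGraph Ω m) : ‖w‖ ≤ ‖x‖ := by
  refine le_of_sq_le_sq ?_ (norm_nonneg _)
  rw [norm_sq_eq_of_mem_dirichletDomain hx hw, pow_two]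
  calc -⟪x.2, x.1⟫_ℝ ≤ ‖⟪x.2, x.1⟫_ℝ‖ := neg_le_abs _
    _ ≤ ‖x.2‖ * ‖x.1‖ := norm_inner_le_norm _ _
    _ ≤ ‖x‖ * ‖x‖ :=
      mul_le_mul (norm_snd_le x) (norm_fst_le x) (norm_nonneg _) (norm_nonneg _)

theorem inner_polyLaplacianCLM_symm (x y : dirichletDomain Ω m) :
    ⟪polyLaplacianCLM Ω m x, toL2CLM Ω m y⟫_ℝ = ⟪polyLaplacianCLM Ω m y, toL2CLM Ω m x⟫_ℝ := by
  obtain ⟨w, hw⟩ := memH0_iff.1 x.2.1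
  obtain ⟨z, hz⟩ := memH0_iff.1 y.2.1
  have h1 := inner_eq_of_mem_dirichletDomain (y := y.1) x.2 hw hz
  have h2 := inner_eq_of_mem_dirichletDomain (y := x.1) y.2 hz hw
  rw [real_inner_comm z w] at h1
  exact h1.trans h2.symm

theorem inner_polyLaplacianCLM_nonpos (x : dirichletDomain Ω m) :
    ⟪polyLaplacianCLM Ω m x, toL2CLM Ω m x⟫_ℝ ≤ 0 := by
  obtain ⟨w, hw⟩ := memH0_iff.1 x.2.1
  have h := norm_sq_eq_of_mem_dirichletDomain x.2 hw
  have : 0 ≤ -⟪x.1.2, x.1.1⟫_ℝ := by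
    rw [← h]
    positivity
  exact neg_nonneg.1 this

theorem isClosed_setOf_isWeakPolyharmonic :
    IsClosed {x : L2 Ω × L2 Ω | IsWeakPolyharmonic Ω m x.1 x.2} := by
  simp only [isWeakPolyharmonic_iff, Set.ofPred_forall]
  refine isClosed_iInter fun f => isClosed_iInter fun _ => isClosed_eq ?_ ?_
  · exact continuous_snd.inner continuous_const
  · exact continuous_const.mul (continuous_fst.inner continuous_const)

theorem isClosed_dirichletDomain : IsClosed (dirichletDomain Ω m : Set (L2 Ω × L2 Ω)) := by
  refine isSeqClosed_iff_isClosed.1 fun x y hx hxy => ?_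
  choose w hw using fun n => memH0_iff.1 (hx n).1
  have hcau : CauchySeq w := by
    rw [Metric.cauchySeq_iff]
    intro ε hε
    obtain ⟨n₀, hn₀⟩ := Metric.cauchySeq_iff.1 hxy.cauchySeq ε hε
    refine ⟨n₀, fun i hi j hj => lt_of_le_of_lt ?_ (hn₀ i hi j hj)⟩
    rw [dist_eq_norm, dist_eq_norm]
    exact norm_le_of_mem_dirichletDomain ((dirichletDomain Ω m).sub_mem (hx i) (hx j))
      ((formGraph Ω m).sub_mem (hw i) (hw j))
  obtain ⟨z, hz⟩ := cauchySeq_tendsto_of_complete hcau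
  refine ⟨memH0_iff.2 ⟨z, ?_⟩, ?_⟩
  · have hcl : IsClosed (formGraph Ω m : Set (L2 Ω × DerivSpace N m)) :=
      Submodule.isClosed_topologicalClosure _
    exact hcl.mem_of_tendsto (((continuous_fst.tendsto y).comp hxy).prodMk_nhds hz)
      (Eventually.of_forall hw)
  · exact isClosed_setOf_isWeakPolyharmonic.mem_of_tendsto hxy
      (Eventually.of_forall fun n => (hx n).2)

theorem exists_tendsto_of_tendsto {β : Type*} {l : Filter β} [l.NeBot]
    {x : β → dirichletDomain Ω m} {a b : L2 Ω}
    (ha : Tendsto (fun n => toL2CLM Ω m (x n)) l (𝓝 a))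
    (hb : Tendsto (fun n => polyLaplacianCLM Ω m (x n)) l (𝓝 b)) :
    ∃ y : dirichletDomain Ω m, Tendsto x l (𝓝 y) ∧ toL2CLM Ω m y = a ∧
      polyLaplacianCLM Ω m y = b := by
  have hmem : (a, b) ∈ dirichletDomain Ω m :=
    isClosed_dirichletDomain.mem_of_tendsto (ha.prodMk_nhds hb)
      (Eventually.of_forall fun n => (x n).2)
  exact ⟨⟨(a, b), hmem⟩, tendsto_dirichletDomain_iff.2 ⟨ha, hb⟩, rfl, rfl⟩

/-- The second component is a distributional derivative of the first and hence determined by it, by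
the du Bois-Reymond lemma on the open set `Ω`. -/
theorem injective_toL2CLM (hΩ : IsOpen Ω) : Function.Injective (toL2CLM Ω m) := by
  rw [injective_iff_map_eq_zero]
  intro x hx
  have hx1 : x.1.1 = 0 := hx
  have hweak := x.2.2
  rw [hx1] at hweak
  have hzero : ∀ φ, IsTest Ω φ → ∫ y in Ω, x.1.2 y * φ y = 0 := by
    intro φ hφ
    rw [hweak φ hφ, integral_congr_ae (g := fun _ => (0 : ℝ)), integral_zero, mul_zero]
    filter_upwards [Lp.coeFn_zero ℝ 2 (volume.restrict Ω)] with y hy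
    rw [hy, Pi.zero_apply, zero_mul]
  have hloc : LocallyIntegrableOn (fun y => x.1.2 y) Ω (volume.restrict Ω) :=
    ((Lp.memLp x.1.2).locallyIntegrable one_le_two).locallyIntegrableOn _
  have hae := hΩ.ae_eq_zero_of_integral_contDiff_smul_eq_zero hloc fun φ h1 h2 h3 => by
    rw [← hzero φ ⟨h1, h2, h3⟩]
    simp only [smul_eq_mul, mul_comm]
  have h2 : x.1.2 = 0 := by
    rw [Lp.eq_zero_iff_ae_eq_zero]
    filter_upwards [hae, ae_restrict_mem hΩ.measurableSet] with y hy hyΩ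
    exact hy hyΩ
  exact Subtype.ext (Prod.ext hx1 h2)

/-- The embedding of the domain into `L²(Ω)` is compact. -/
theorem exists_subseq_tendsto_toL2CLM [IsFiniteMeasure (volume.restrict Ω)] (hm : 0 < m)
    {x : ℕ → dirichletDomain Ω m} {C : ℝ} (hx : ∀ n, ‖x n‖ ≤ C) :
    ∃ a, ∃ φ : ℕ → ℕ, StrictMono φ ∧ Tendsto (fun n => toL2CLM Ω m (x (φ n))) atTop (𝓝 a) := by
  choose w hw using fun n => memH0_iff.1 (x n).2.1
  -- Test functions at distance `1/(n+1)` carry the compactness over to the domain.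
  have happ : ∀ n : ℕ, ∃ f ∈ testSpace Ω, ‖resMap Ω f - (x n).1.1‖ < 1 / ((n : ℝ) + 1) ∧
      ‖derivMap m f - w n‖ < 1 / ((n : ℝ) + 1) := by
    intro n
    obtain ⟨f, hf, h1, h2⟩ := mem_formGraph_iff.1 (hw n)
    have hn : (0 : ℝ) < 1 / ((n : ℝ) + 1) := by positivity
    have h3 := (tendsto_iff_norm_sub_tendsto_zero.1 h1).eventually_lt_const hn
    have h4 := (tendsto_iff_norm_sub_tendsto_zero.1 h2).eventually_lt_const hn
    obtain ⟨k, hk1, hk2⟩ := (h3.and h4).exists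
    exact ⟨f k, hf k, hk1, hk2⟩
  choose f hf h1 h2 using happ
  have hle : ∀ n : ℕ, 1 / ((n : ℝ) + 1) ≤ 1 := fun n => by
    rw [div_le_one (by positivity)]
    linarith [(Nat.cast_nonneg n : (0 : ℝ) ≤ n)]
  obtain ⟨φ, hφ, hcau⟩ := exists_subseq_cauchySeq_resMap hm hf (C := C + 1)
    (fun n => by
      have h3 := norm_le_norm_add_norm_sub (x n).1.1 (resMap Ω (f n))
      have h4 : ‖(x n).1.1‖ ≤ C := (norm_fst_le _).trans (hx n)
      rw [norm_sub_rev] at h3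
      linarith [h1 n, hle n])
    (fun n => by
      have h3 := norm_le_norm_add_norm_sub (w n) (derivMap m (f n))
      have h4 : ‖w n‖ ≤ C := (norm_le_of_mem_dirichletDomain (x n).2 (hw n)).trans (hx n)
      rw [norm_sub_rev] at h3
      linarith [h2 n, hle n])
  obtain ⟨a, ha⟩ := cauchySeq_tendsto_of_complete hcau
  refine ⟨a, φ, hφ, ?_⟩
  have h0 : Tendsto (fun n => resMap Ω (f (φ n)) - (x (φ n)).1.1) atTop (𝓝 0) :=
    squeeze_zero_norm (fun n => (h1 (φ n)).le)
      (tendsto_one_div_add_atTop_nhds_zero_nat.comp hφ.tendsto_atTop)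
  have := ha.sub h0
  rw [sub_zero] at this
  refine this.congr fun n => ?_
  rw [sub_sub_cancel]
  rfl

end DirichletDomain

/-! ### Superposition operators and their potentials -/

section Superposition

variable {N : ℕ} {Ω : Set (EuclideanSpace ℝ (Fin N))} [IsFiniteMeasure (volume.restrict Ω)]
  {g : ℝ → ℝ} {L : NNReal}

theorem norm_sq_eq_integral (u : L2 Ω) : ‖u‖ ^ 2 = ∫ x in Ω, u x ^ 2 := by
  rw [← real_inner_self_eq_norm_sq, L2.inner_def]
  refine integral_congr_ae (Eventually.of_forall fun x => ?_)
  simp only [real_inner_self_eq_norm_sq, Real.norm_eq_abs, sq_abs]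

theorem inner_eq_integral (u v : L2 Ω) : ⟪u, v⟫_ℝ = ∫ x in Ω, u x * v x := by
  rw [L2.inner_def]
  refine integral_congr_ae (Eventually.of_forall fun x => ?_)
  simp only [RCLike.inner_apply]
  simp [mul_comm]

theorem integrable_sq_L2 (u : L2 Ω) : Integrable (fun x => u x ^ 2) (volume.restrict Ω) :=
  (Lp.memLp u).integrable_sq

theorem integrable_mul_L2 (u v : L2 Ω) : Integrable (fun x => u x * v x) (volume.restrict Ω) :=
  MemLp.integrable_mul (p := 2) (q := 2) (Lp.memLp u) (Lp.memLp v)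

theorem memLp_comp_lipschitz (hg : LipschitzWith L g) (u : L2 Ω) :
    MemLp (fun x => g (u x)) 2 (volume.restrict Ω) := by
  have hbd : MemLp (fun x => |g 0| + L * ‖u x‖) 2 (volume.restrict Ω) := by
    have h1 : MemLp (fun _ : EuclideanSpace ℝ (Fin N) => |g 0|) 2 (volume.restrict Ω) :=
      memLp_const _
    have h2 : MemLp (fun x => (L : ℝ) * ‖u x‖) 2 (volume.restrict Ω) :=
      (Lp.memLp u).norm.const_mul _
    exact h1.add h2
  refine hbd.mono' (hg.continuous.comp_aestronglyMeasurable (Lp.aestronglyMeasurable u))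
    (Eventually.of_forall fun x => ?_)
  have h := hg.norm_sub_le (u x) 0
  rw [sub_zero] at h
  have h2 := norm_le_norm_add_norm_sub (g 0) (g (u x))
  rw [norm_sub_rev] at h2
  exact h2.trans (add_le_add_right h _)

/-- The superposition operator `u ↦ g ∘ u` on `L²(Ω)`. -/
noncomputable def superposition (hg : LipschitzWith L g) (u : L2 Ω) : L2 Ω :=
  (memLp_comp_lipschitz hg u).toLp _

theorem coeFn_superposition (hg : LipschitzWith L g) (u : L2 Ω) :
    superposition hg u =ᵐ[volume.restrict Ω] fun x => g (u x) :=
  (memLp_comp_lipschitz hg u).coeFn_toLp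

theorem norm_superposition_sub_le (hg : LipschitzWith L g) (u v : L2 Ω) :
    ‖superposition hg u - superposition hg v‖ ≤ L * ‖u - v‖ := by
  refine Lp.norm_le_mul_norm_of_ae_le_mul ?_
  filter_upwards [coeFn_superposition hg u, coeFn_superposition hg v,
    Lp.coeFn_sub (superposition hg u) (superposition hg v), Lp.coeFn_sub u v] with x h1 h2 h3 h4
  rw [h3, h4, Pi.sub_apply, Pi.sub_apply, h1, h2]
  exact hg.norm_sub_le _ _

theorem continuous_superposition (hg : LipschitzWith L g) :
    Continuous (superposition hg : L2 Ω → L2 Ω) :=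
  (LipschitzWith.of_dist_le_mul fun u v => by
    simpa only [dist_eq_norm] using norm_superposition_sub_le hg u v).continuous

theorem abs_primitive_sub_le (hg : LipschitzWith L g) (s r : ℝ) :
    |(∫ q in (0 : ℝ)..s, g q) - (∫ q in (0 : ℝ)..r, g q) - g r * (s - r)| ≤ L * (s - r) ^ 2 := by
  have hi : ∀ a b, IntervalIntegrable g volume a b := fun a b =>
    hg.continuous.intervalIntegrable a b
  have h1 : (∫ q in (0 : ℝ)..s, g q) - (∫ q in (0 : ℝ)..r, g q) - g r * (s - r) =
      ∫ q in r..s, (g q - g r) := by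
    rw [intervalIntegral.integral_interval_sub_left (hi _ _) (hi _ _),
      intervalIntegral.integral_sub (hi _ _) intervalIntegrable_const,
      intervalIntegral.integral_const, smul_eq_mul, mul_comm]
  rw [h1, ← Real.norm_eq_abs]
  refine (intervalIntegral.norm_integral_le_of_norm_le_const (C := L * |s - r|)
    fun q hq => ?_).trans (le_of_eq ?_)
  · refine (hg.norm_sub_le q r).trans ?_
    gcongr
    exact Set.abs_sub_left_of_mem_uIcc (Set.uIoc_subset_uIcc hq)
  · rw [mul_assoc, abs_mul_abs_self, pow_two]

theorem integrable_primitive (hg : LipschitzWith L g) (u : L2 Ω) :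
    Integrable (fun x => ∫ q in (0 : ℝ)..(u x), g q) (volume.restrict Ω) := by
  have hc : Continuous fun s : ℝ => ∫ q in (0 : ℝ)..s, g q :=
    intervalIntegral.continuous_primitive (fun a b => hg.continuous.intervalIntegrable a b) 0
  have hu : Integrable (fun x => u x) (volume.restrict Ω) :=
    (Lp.memLp u).integrable one_le_two
  refine Integrable.mono' (g := fun x => L * u x ^ 2 + |g 0| * |u x|)
    (((integrable_sq_L2 u).const_mul _).add (hu.abs.const_mul _))
    (hc.comp_aestronglyMeasurable (Lp.aestronglyMeasurable u)) (Eventually.of_forall fun x => ?_)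
  have h := abs_primitive_sub_le hg (u x) 0
  rw [intervalIntegral.integral_same, sub_zero, sub_zero] at h
  rw [Real.norm_eq_abs, ← abs_mul]
  have h2 := abs_sub_abs_le_abs_sub (∫ q in (0 : ℝ)..(u x), g q) (g 0 * u x)
  linarith

/-- The potential of the superposition operator. -/
noncomputable def potential (_hg : LipschitzWith L g) (u : L2 Ω) : ℝ :=
  ∫ x in Ω, ∫ q in (0 : ℝ)..(u x), g q

/-- The pointwise Taylor remainder of a primitive of a Lipschitz function is quadratic, so it
integrates to a squared `L²` norm. The potential thus expands well although the superposition
operator itself need not be differentiable. -/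
theorem abs_potential_sub_le (hg : LipschitzWith L g) (u v : L2 Ω) :
    |potential hg u - potential hg v - ⟪superposition hg v, u - v⟫_ℝ| ≤ L * ‖u - v‖ ^ 2 := by
  have hF : ∀ u v : L2 Ω, Integrable (fun x => (∫ q in (0 : ℝ)..(u x), g q) -
      ∫ q in (0 : ℝ)..(v x), g q) (volume.restrict Ω) := fun u v =>
    (integrable_primitive hg u).sub (integrable_primitive hg v)
  rw [potential, potential, inner_eq_integral,
    ← integral_sub (integrable_primitive hg u) (integrable_primitive hg v),
    ← integral_sub (hF u v) (integrable_mul_L2 _ _), norm_sq_eq_integral, ← integral_const_mul, ← Real.norm_eq_abs]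
  refine norm_integral_le_of_norm_le ((integrable_sq_L2 _).const_mul _) ?_
  filter_upwards [coeFn_superposition hg v, Lp.coeFn_sub u v] with x h1 h2
  rw [h1, h2, Pi.sub_apply]
  exact abs_primitive_sub_le hg _ _

theorem abs_potential_le (hg : LipschitzWith L g) {u : L2 Ω} {R : ℝ} (hu : ‖u‖ ≤ R) :
    |potential hg u| ≤ |potential hg (0 : L2 Ω)| + ‖superposition hg (0 : L2 Ω)‖ * R +
      L * R ^ 2 := by
  have h := abs_potential_sub_le hg u 0
  rw [sub_zero] at h
  have h1 : |⟪superposition hg (0 : L2 Ω), u⟫_ℝ| ≤ ‖superposition hg (0 : L2 Ω)‖ * R :=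
    (abs_real_inner_le_norm _ _).trans (by gcongr)
  have h2 : (L : ℝ) * ‖u‖ ^ 2 ≤ L * R ^ 2 := by gcongr
  rw [abs_le] at h h1
  have h3 := neg_abs_le (potential hg (0 : L2 Ω))
  have h4 := le_abs_self (potential hg (0 : L2 Ω))
  rw [abs_le]
  constructor <;> linarith

end Superposition

/-! ### The semilinear flow with a Lipschitz nonlinearity -/

section Semilinear

variable {N : ℕ} {Ω : Set (EuclideanSpace ℝ (Fin N))} [IsFiniteMeasure (volume.restrict Ω)]
  {m : ℕ} {g : ℝ → ℝ} {L : NNReal}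

/-- The right-hand side `(-1)^(m+1) Δ^m u + g(u)`. -/
noncomputable def vectorField (hg : LipschitzWith L g) (x : dirichletDomain Ω m) : L2 Ω :=
  polyLaplacianCLM Ω m x + superposition hg (toL2CLM Ω m x)

theorem continuous_vectorField (hg : LipschitzWith L g) :
    Continuous (vectorField hg : dirichletDomain Ω m → L2 Ω) :=
  (polyLaplacianCLM Ω m).continuous.add
    ((continuous_superposition hg).comp (toL2CLM Ω m).continuous)

/-- The energy functional. -/
noncomputable def energy (hg : LipschitzWith L g) (x : dirichletDomain Ω m) : ℝ :=
  ⟪polyLaplacianCLM Ω m x, toL2CLM Ω m x⟫_ℝ / 2 + potential hg (toL2CLM Ω m x)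

/-- By symmetry of the operator the quadratic part expands exactly. One factor of the remainder is
an `L²` norm, because orbits are differentiable only in `L²`. -/
theorem abs_energy_sub_le (hg : LipschitzWith L g) (x y : dirichletDomain Ω m) :
    |energy hg x - energy hg y - ⟪vectorField hg y, toL2CLM Ω m (x - y)⟫_ℝ| ≤
      (1 / 2 + L) * ‖x - y‖ * ‖toL2CLM Ω m (x - y)‖ := by
  have h1 := abs_potential_sub_le hg (toL2CLM Ω m x) (toL2CLM Ω m y)
  have h2 : |⟪polyLaplacianCLM Ω m (x - y), toL2CLM Ω m (x - y)⟫_ℝ| ≤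
      ‖x - y‖ * ‖toL2CLM Ω m (x - y)‖ :=
    (abs_real_inner_le_norm _ _).trans (by
      gcongr
      exact norm_polyLaplacianCLM_le _)
  have h3 : energy hg x - energy hg y - ⟪vectorField hg y, toL2CLM Ω m (x - y)⟫_ℝ =
      ⟪polyLaplacianCLM Ω m (x - y), toL2CLM Ω m (x - y)⟫_ℝ / 2 +
      (potential hg (toL2CLM Ω m x) - potential hg (toL2CLM Ω m y) -
        ⟪superposition hg (toL2CLM Ω m y), toL2CLM Ω m x - toL2CLM Ω m y⟫_ℝ) := by
    have h4 := inner_polyLaplacianCLM_symm x y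
    simp only [energy, vectorField, map_sub, inner_add_left, inner_sub_left, inner_sub_right]
    rw [h4]
    ring
  rw [h3]
  refine (abs_add_le _ _).trans ?_
  rw [abs_div, abs_two]
  rw [← map_sub (toL2CLM Ω m) x y] at h1 ⊢
  have h5 : (L : ℝ) * ‖toL2CLM Ω m (x - y)‖ ^ 2 ≤ L * (‖x - y‖ * ‖toL2CLM Ω m (x - y)‖) := by
    rw [pow_two]
    gcongr
    exact norm_toL2CLM_le _
  linarith

theorem abs_energy_sub_le_sq (hg : LipschitzWith L g) (x : dirichletDomain Ω m)
    {y : dirichletDomain Ω m} (hy : vectorField hg y = 0) :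
    |energy hg x - energy hg y| ≤ (1 / 2 + L) * ‖x - y‖ ^ 2 := by
  have h := abs_energy_sub_le hg x y
  rw [hy, inner_zero_left, sub_zero] at h
  refine h.trans ?_
  rw [mul_assoc, pow_two]
  gcongr
  exact norm_toL2CLM_le _

/-- The quadratic part is nonpositive, so the energy is bounded above by the `L²` norm alone; no
lower bound is needed for an increasing energy. -/
theorem energy_le (hg : LipschitzWith L g) {x : dirichletDomain Ω m} {R : ℝ}
    (hx : ‖toL2CLM Ω m x‖ ≤ R) :
    energy hg x ≤ |potential hg (0 : L2 Ω)| + ‖superposition hg (0 : L2 Ω)‖ * R + L * R ^ 2 := by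
  have h1 := inner_polyLaplacianCLM_nonpos x
  have h2 := (le_abs_self _).trans (abs_potential_le hg hx)
  rw [energy]
  linarith

/-! ### Energy, speed and compactness along a solution. -/

variable {u : ℝ → dirichletDomain Ω m}

theorem hasDerivAt_energy (hg : LipschitzWith L g) (hc : ContinuousOn u (Set.Ioi 0))
    (hu : ∀ t > 0, HasDerivAt (fun s => toL2CLM Ω m (u s)) (vectorField hg (u t)) t) {t : ℝ}
    (ht : 0 < t) :
    HasDerivAt (fun s => energy hg (u s)) (‖vectorField hg (u t)‖ ^ 2) t := by
  have hct : ContinuousAt u t := hc.continuousAt (Ioi_mem_nhds ht)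
  have hv := hu t ht
  have h1 : HasDerivAt (fun s => ⟪vectorField hg (u t), toL2CLM Ω m (u s)⟫_ℝ)
      (‖vectorField hg (u t)‖ ^ 2) t := by
    have := (hasDerivAt_const t (vectorField hg (u t))).inner ℝ hv
    simpa only [inner_zero_left, add_zero, real_inner_self_eq_norm_sq] using this
  have h2 : HasDerivAt (fun s => energy hg (u s) -
      ⟪vectorField hg (u t), toL2CLM Ω m (u s)⟫_ℝ) 0 t := by
    rw [hasDerivAt_iff_isLittleO]
    have h3 : (fun s => energy hg (u s) - ⟪vectorField hg (u t), toL2CLM Ω m (u s)⟫_ℝ -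
        (energy hg (u t) - ⟪vectorField hg (u t), toL2CLM Ω m (u t)⟫_ℝ) - (s - t) • (0 : ℝ))
        =o[𝓝 t] fun s => toL2CLM Ω m (u s) - toL2CLM Ω m (u t) := by
      rw [Asymptotics.isLittleO_iff]
      intro ε hε
      have h4 : Tendsto (fun s => (1 / 2 + (L : ℝ)) * ‖u s - u t‖) (𝓝 t) (𝓝 0) := by
        have := ((hct.tendsto.sub_const (u t)).norm).const_mul (1 / 2 + (L : ℝ))
        simpa using this
      filter_upwards [h4.eventually_lt_const hε] with s hs
      have h5 := abs_energy_sub_le hg (u s) (u t)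
      rw [map_sub, inner_sub_right] at h5
      rw [Real.norm_eq_abs, smul_zero, sub_zero]
      refine le_trans (le_of_eq ?_) (h5.trans (by gcongr))
      congr 1
      ring
    exact h3.trans_isBigO hv.isBigO_sub
  refine ((h2.add h1).congr_deriv (zero_add _)).congr_of_eventuallyEq
    (Eventually.of_forall fun s => ?_)
  simp

/-- The linear part is dissipative, and the nonlinear part is Lipschitz. -/
theorem inner_vectorField_sub_le (hg : LipschitzWith L g) (x y : dirichletDomain Ω m) :
    ⟪toL2CLM Ω m x - toL2CLM Ω m y, vectorField hg x - vectorField hg y⟫_ℝ ≤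
      L * ‖toL2CLM Ω m x - toL2CLM Ω m y‖ ^ 2 := by
  have h1 := inner_polyLaplacianCLM_nonpos (x - y)
  have h2 : ⟪toL2CLM Ω m x - toL2CLM Ω m y,
      superposition hg (toL2CLM Ω m x) - superposition hg (toL2CLM Ω m y)⟫_ℝ ≤
      L * ‖toL2CLM Ω m x - toL2CLM Ω m y‖ ^ 2 := by
    refine (real_inner_le_norm _ _).trans ?_
    rw [pow_two, mul_comm, ← mul_assoc]
    gcongr
    exact norm_superposition_sub_le hg _ _
  have h3 : vectorField hg x - vectorField hg y = polyLaplacianCLM Ω m (x - y) +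
      (superposition hg (toL2CLM Ω m x) - superposition hg (toL2CLM Ω m y)) := by
    rw [vectorField, vectorField, map_sub]
    abel
  rw [h3, inner_add_right]
  rw [map_sub (toL2CLM Ω m), real_inner_comm] at h1
  linarith

/-- The speed of the flow grows at most exponentially. -/
theorem norm_vectorField_le (hg : LipschitzWith L g)
    (hu : ∀ t > 0, HasDerivAt (fun s => toL2CLM Ω m (u s)) (vectorField hg (u t)) t) {s t : ℝ}
    (hs : 0 < s) (hst : s ≤ t) :
    ‖vectorField hg (u t)‖ ≤ Real.exp (L * (t - s)) * ‖vectorField hg (u s)‖ := by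
  set v : ℝ → L2 Ω := fun s => toL2CLM Ω m (u s) with hv
  -- By Grönwall, two time shifts of the same solution separate at most at the rate `L`; dividing by
  -- `h` and letting `h → 0` yields the bound on the velocity.
  have hdiff : ∀ h > 0, ‖v (t + h) - v t‖ ≤ Real.exp (L * (t - s)) * ‖v (s + h) - v s‖ := by
    intro h hh
    have hd : ∀ r > 0, HasDerivAt (fun r => Real.exp (-(2 * L * r)) * ‖v (r + h) - v r‖ ^ 2)
        (Real.exp (-(2 * L * r)) * (-(2 * L)) * ‖v (r + h) - v r‖ ^ 2 +
          Real.exp (-(2 * L * r)) * (2 * ⟪v (r + h) - v r,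
            vectorField hg (u (r + h)) - vectorField hg (u r)⟫_ℝ)) r := by
      intro r hr
      have h1 : HasDerivAt (fun r => v (r + h)) (vectorField hg (u (r + h))) r :=
        (hu (r + h) (by linarith)).comp_add_const r h
      have h2 : HasDerivAt (fun r : ℝ => -(2 * (L : ℝ) * r)) (-(2 * L)) r := by
        have := ((hasDerivAt_id r).const_mul (2 * (L : ℝ))).neg
        rw [mul_one] at this
        exact this
      exact h2.exp.mul ((h1.sub (hu r hr)).norm_sq)
    have hanti : AntitoneOn (fun r => Real.exp (-(2 * L * r)) * ‖v (r + h) - v r‖ ^ 2)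
        (Set.Icc s t) := by
      refine antitoneOn_of_deriv_nonpos (convex_Icc s t)
        (fun r hr => (hd r (hs.trans_le hr.1)).continuousAt.continuousWithinAt)
        (fun r hr => ?_) (fun r hr => ?_)
      · rw [interior_Icc] at hr
        exact (hd r (hs.trans hr.1)).differentiableAt.differentiableWithinAt
      · rw [interior_Icc] at hr
        rw [(hd r (hs.trans hr.1)).deriv]
        have h3 := inner_vectorField_sub_le hg (u (r + h)) (u r)
        have h4 := mul_le_mul_of_nonneg_left h3 (Real.exp_pos (-(2 * L * r))).le
        simp only [hv]
        linarith
    have h5 := hanti (Set.left_mem_Icc.2 hst) (Set.right_mem_Icc.2 hst) hst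
    simp only at h5
    refine le_of_sq_le_sq ?_ (by positivity)
    rw [mul_pow, ← Real.exp_nat_mul]
    have h6 : Real.exp ((2 : ℕ) * (L * (t - s))) = Real.exp (2 * L * t) *
        Real.exp (-(2 * L * s)) := by
      rw [← Real.exp_add]
      congr 1
      push_cast
      ring
    have h7 : Real.exp (2 * L * t) * Real.exp (-(2 * L * t)) = 1 := by
      rw [← Real.exp_add, add_neg_cancel, Real.exp_zero]
    have h8 := mul_le_mul_of_nonneg_left h5 (Real.exp_pos (2 * L * t)).le
    rw [← mul_assoc, h7, one_mul, ← mul_assoc, ← h6] at h8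
    exact h8
  have h1 := (hu t (hs.trans_le hst)).tendsto_slope_zero_right.norm
  have h2 := ((hu s hs).tendsto_slope_zero_right.norm).const_mul (Real.exp (L * (t - s)))
  refine le_of_tendsto_of_tendsto h1 h2 ?_
  filter_upwards [self_mem_nhdsWithin] with h hh
  have hh : 0 < h := hh
  rw [norm_smul, norm_smul, mul_left_comm]
  gcongr
  exact hdiff h hh

theorem exists_tendsto_energy (hg : LipschitzWith L g) (hc : ContinuousOn u (Set.Ioi 0))
    (hu : ∀ t > 0, HasDerivAt (fun s => toL2CLM Ω m (u s)) (vectorField hg (u t)) t) {R : ℝ}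
    (hR : ∀ t > 0, ‖toL2CLM Ω m (u t)‖ ≤ R) :
    ∃ c, Tendsto (fun t => energy hg (u t)) atTop (𝓝 c) := by
  have hmono := monotoneOn_energy fun t ht => hasDerivAt_energy hg hc hu (t := t) ht
  -- The energy is monotone only at positive times, hence the cut-off `max t 1`.
  have h1 : ∀ t : ℝ, 0 < max t 1 := fun t => one_pos.trans_le (le_max_right _ _)
  have h2 : Monotone fun t => energy hg (u (max t 1)) := fun s t hst =>
    hmono (h1 s) (h1 t) (max_le_max_right _ hst)
  refine ⟨_, (tendsto_atTop_ciSup h2 ⟨|potential hg (0 : L2 Ω)| +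
    ‖superposition hg (0 : L2 Ω)‖ * R + L * R ^ 2, ?_⟩).congr' ?_⟩
  · rintro _ ⟨t, rfl⟩
    exact energy_le hg (hR _ (h1 t))
  · filter_upwards [eventually_ge_atTop 1] with t ht
    rw [max_eq_left ht]

/-- The speed at time `t` is at most `e^L` times the speed at any time in `(t-1, t)`, so its square
is at most `e^(2L)` times the energy gained on `[t-1, t]`, which tends to zero. -/
theorem tendsto_vectorField (hg : LipschitzWith L g) (hc : ContinuousOn u (Set.Ioi 0))
    (hu : ∀ t > 0, HasDerivAt (fun s => toL2CLM Ω m (u s)) (vectorField hg (u t)) t) {R : ℝ}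
    (hR : ∀ t > 0, ‖toL2CLM Ω m (u t)‖ ≤ R) :
    Tendsto (fun t => vectorField hg (u t)) atTop (𝓝 0) := by
  obtain ⟨c, hE⟩ := exists_tendsto_energy hg hc hu hR
  have hdE : ∀ t > 0, HasDerivAt (fun s => energy hg (u s)) (‖vectorField hg (u t)‖ ^ 2) t :=
    fun t ht => hasDerivAt_energy hg hc hu ht
  have hshift : Tendsto (fun t : ℝ => t - 1) atTop atTop :=
    tendsto_atTop_add_const_right atTop (-1 : ℝ) tendsto_id
  have hdiff : Tendsto (fun t => Real.exp (2 * L) * (energy hg (u t) - energy hg (u (t - 1))))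
      atTop (𝓝 0) := by
    have := (hE.sub (hE.comp hshift)).const_mul (Real.exp (2 * L))
    simpa using this
  have hsq : Tendsto (fun t => ‖vectorField hg (u t)‖ ^ 2) atTop (𝓝 0) := by
    refine squeeze_zero' (Eventually.of_forall fun t => by positivity) ?_ hdiff
    filter_upwards [eventually_gt_atTop 1] with t ht
    have h1 : Real.exp (-(2 * L)) * ‖vectorField hg (u t)‖ ^ 2 * (t - (t - 1)) ≤
        energy hg (u t) - energy hg (u (t - 1)) := by
      refine mul_le_energy_sub hdE (by linarith) (by linarith) fun r hr => ?_
      have h2 := norm_vectorField_le hg hu (show 0 < r by linarith [hr.1]) hr.2.le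
      have h3 : Real.exp (L * (t - r)) ≤ Real.exp L := by
        refine Real.exp_le_exp.2 ?_
        have : (L : ℝ) * (t - r) ≤ L * 1 := by
          gcongr
          linarith [hr.1]
        linarith
      have h4 : ‖vectorField hg (u t)‖ ≤ Real.exp L * ‖vectorField hg (u r)‖ :=
        h2.trans (by gcongr)
      have h5 : ‖vectorField hg (u t)‖ ^ 2 ≤ (Real.exp L * ‖vectorField hg (u r)‖) ^ 2 := by
        gcongr
      rw [mul_pow, ← Real.exp_nat_mul] at h5
      rw [Real.exp_neg, inv_mul_le_iff₀ (Real.exp_pos _)]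
      exact_mod_cast h5
    rw [sub_sub_cancel, mul_one, Real.exp_neg, inv_mul_le_iff₀ (Real.exp_pos _)] at h1
    exact h1
  rw [tendsto_zero_iff_norm_tendsto_zero]
  have h3 := (Real.continuous_sqrt.tendsto 0).comp hsq
  rw [Real.sqrt_zero] at h3
  exact h3.congr fun t => Real.sqrt_sq (norm_nonneg _)

/-- The equation expresses `Δ^m u` through the vanishing speed and `g(u)`. So the orbit is
eventually bounded in the graph norm, a subsequence converges in `L²`, and then `Δ^m u` converges
along it as well. -/
theorem precompactAtTop_of_semilinear (hm : 0 < m) (hg : LipschitzWith L g)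
    (hc : ContinuousOn u (Set.Ioi 0))
    (hu : ∀ t > 0, HasDerivAt (fun s => toL2CLM Ω m (u s)) (vectorField hg (u t)) t) {R : ℝ}
    (hR : ∀ t > 0, ‖toL2CLM Ω m (u t)‖ ≤ R) : PrecompactAtTop u := by
  intro s hs
  have hV := tendsto_vectorField hg hc hu hR
  have hAeq : ∀ x : dirichletDomain Ω m, polyLaplacianCLM Ω m x =
      vectorField hg x - superposition hg (toL2CLM Ω m x) := fun x => by
    rw [vectorField, add_sub_cancel_right]
  have hev : ∀ᶠ n in atTop, 0 < s n ∧ ‖vectorField hg (u (s n))‖ < 1 :=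
    (hs.eventually_gt_atTop 0).and
      (hs.eventually ((tendsto_zero_iff_norm_tendsto_zero.1 hV).eventually_lt_const one_pos))
  obtain ⟨n₀, hn₀⟩ := eventually_atTop.1 hev
  obtain ⟨a, φ, hφ, ha⟩ := exists_subseq_tendsto_toL2CLM hm (x := fun n => u (s (n + n₀)))
    (C := max R (1 + (‖superposition hg (0 : L2 Ω)‖ + L * R))) (fun n => by
      obtain ⟨h1, h2⟩ := hn₀ (n + n₀) (Nat.le_add_left _ _)
      rw [norm_eq_max]
      refine max_le_max (hR _ h1) ?_
      rw [hAeq]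
      refine (norm_sub_le _ _).trans (add_le_add h2.le ?_)
      have h3 := norm_superposition_sub_le hg (toL2CLM Ω m (u (s (n + n₀)))) 0
      rw [sub_zero] at h3
      have h4 := norm_le_norm_add_norm_sub (superposition hg (0 : L2 Ω))
        (superposition hg (toL2CLM Ω m (u (s (n + n₀)))))
      rw [norm_sub_rev] at h4
      have h5 : (L : ℝ) * ‖toL2CLM Ω m (u (s (n + n₀)))‖ ≤ L * R := by
        gcongr
        exact hR _ h1
      linarith)
  have hφ' : StrictMono fun n => φ n + n₀ := fun i j hij => Nat.add_lt_add_right (hφ hij) _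
  have hA : Tendsto (fun n => polyLaplacianCLM Ω m (u (s (φ n + n₀)))) atTop
      (𝓝 (0 - superposition hg a)) := by
    simp only [hAeq]
    exact ((hV.comp hs).comp hφ'.tendsto_atTop).sub
      (((continuous_superposition hg).tendsto a).comp ha)
  obtain ⟨y, hy, -⟩ := exists_tendsto_of_tendsto ha hA
  exact ⟨y, _, hφ', hy⟩

end Semilinear

/-! ### Linearization of the semilinear operator -/

/-- An operator that is proper on bounded sets at `0` is semi-Fredholm. -/
theorem isSemiFredholm_of_exists_subseq {H X : Type*} [NormedAddCommGroup H] [NormedSpace ℝ H]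
    [NormedAddCommGroup X] [NormedSpace ℝ X] {L : X →L[ℝ] H}
    (hL : ∀ x : ℕ → X, (∀ n, ‖x n‖ ≤ 1) → Tendsto (fun n => L (x n)) atTop (𝓝 0) →
      ∃ y, ∃ φ : ℕ → ℕ, StrictMono φ ∧ Tendsto (fun n => x (φ n)) atTop (𝓝 y)) :
    IsSemiFredholm L := by
  -- Riesz: the unit ball of the kernel is compact.
  have hfin : FiniteDimensional ℝ L.ker := by
    refine FiniteDimensional.of_isCompact_closedBall₀ ℝ one_pos ?_
    refine IsSeqCompact.isCompact fun x hx => ?_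
    obtain ⟨y, φ, hφ, hy⟩ := hL (fun n => (x n : X)) (fun n => by simpa using hx n) (by
      have : ∀ n, L (x n) = 0 := fun n => (x n).2
      simp [this])
    have hyk : y ∈ L.ker := L.isClosed_ker.mem_of_tendsto hy
      (Eventually.of_forall fun n => (x (φ n)).2)
    refine ⟨⟨y, hyk⟩, ?_, φ, hφ, tendsto_subtype_rng.2 hy⟩
    exact Metric.isClosed_closedBall.mem_of_tendsto (tendsto_subtype_rng.2 hy)
      (Eventually.of_forall fun n => hx (φ n))
  obtain ⟨P, hP⟩ := Submodule.ClosedComplemented.of_finiteDimensional L.ker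
  refine ⟨hfin, P, hP, ?_⟩
  -- If no constant `n` works, there are unit vectors in the complement with `L` tending to zero; a
  -- limit is a unit vector lying in both the kernel and the complement.
  by_contra! hcon
  choose w hw1 hw2 using fun n : ℕ => hcon n
  have hw0 : ∀ n, 0 < ‖w n‖ := fun n => lt_of_le_of_lt (by positivity) (hw2 n)
  have hz1 : ∀ n, ‖‖w n‖⁻¹ • w n‖ = 1 := fun n => by
    rw [norm_smul, norm_inv, norm_norm, inv_mul_cancel₀ (hw0 n).ne']
  obtain ⟨z, φ, hφ, hz⟩ := hL (fun n => ‖w n‖⁻¹ • w n) (fun n => (hz1 n).le) (by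
    refine squeeze_zero_norm' ?_ (tendsto_inv_atTop_zero.comp tendsto_natCast_atTop_atTop)
    filter_upwards [eventually_gt_atTop 0] with n hn
    have hn : (0 : ℝ) < n := Nat.cast_pos.2 hn
    rw [map_smul, norm_smul, norm_inv, norm_norm, Function.comp_apply, inv_mul_le_iff₀ (hw0 n),
      ← div_eq_mul_inv, le_div_iff₀ hn, mul_comm]
    exact (hw2 n).le)
  have hnorm : ‖z‖ = 1 := tendsto_nhds_unique hz.norm (by simp only [hz1]; exact tendsto_const_nhds)
  have hPz : P z = 0 := by
    refine tendsto_nhds_unique ((P.continuous.tendsto z).comp hz) ?_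
    refine tendsto_const_nhds.congr fun n => ?_
    simp [hw1]
  have hLz : L z = 0 := by
    refine tendsto_nhds_unique ((L.continuous.tendsto z).comp hz) ?_
    refine squeeze_zero_norm' ?_
      ((tendsto_inv_atTop_zero.comp tendsto_natCast_atTop_atTop).comp hφ.tendsto_atTop)
    filter_upwards [hφ.tendsto_atTop.eventually_gt_atTop 0] with n hn
    have hn : (0 : ℝ) < φ n := Nat.cast_pos.2 hn
    simp only [Function.comp_apply]
    rw [map_smul, norm_smul, norm_inv, norm_norm, inv_mul_le_iff₀ (hw0 _),
      ← div_eq_mul_inv, le_div_iff₀ hn, mul_comm]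
    exact (hw2 _).le
  have hzk := hP ⟨z, hLz⟩
  rw [hPz] at hzk
  have : z = 0 := congrArg Subtype.val hzk.symm
  rw [this, norm_zero] at hnorm
  exact zero_ne_one hnorm

section Linearization

variable {N : ℕ} {Ω : Set (EuclideanSpace ℝ (Fin N))} {m : ℕ}

/-- Multiplication by a bounded function on `L²(Ω)`. -/
noncomputable def mulCLM (b : Lp ℝ ⊤ (volume.restrict Ω)) : L2 Ω →L[ℝ] L2 Ω :=
  (ContinuousLinearMap.mul ℝ ℝ).holderL (volume.restrict Ω) ⊤ 2 2 b

theorem coeFn_mulCLM (b : Lp ℝ ⊤ (volume.restrict Ω)) (v : L2 Ω) :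
    mulCLM b v =ᵐ[volume.restrict Ω] fun x => b x * v x :=
  ContinuousLinearMap.coeFn_holder _ _ _

/-- The operator `(-1)^(m+1) Δ^m + b`. -/
noncomputable def linearization (m : ℕ) (b : Lp ℝ ⊤ (volume.restrict Ω)) :
    dirichletDomain Ω m →L[ℝ] L2 Ω :=
  polyLaplacianCLM Ω m + mulCLM b ∘L toL2CLM Ω m

/-- Multiplication by `b` is a compact perturbation on the domain: once a subsequence converges in
`L²`, so does its image under the polyharmonic operator. -/
theorem isSemiFredholm_linearization [IsFiniteMeasure (volume.restrict Ω)] (hm : 0 < m)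
    (b : Lp ℝ ⊤ (volume.restrict Ω)) : IsSemiFredholm (linearization m b) := by
  refine isSemiFredholm_of_exists_subseq fun x hx hLx => ?_
  obtain ⟨a, φ, hφ, ha⟩ := exists_subseq_tendsto_toL2CLM hm hx
  have hA : Tendsto (fun n => polyLaplacianCLM Ω m (x (φ n))) atTop (𝓝 (0 - mulCLM b a)) := by
    refine ((hLx.comp hφ.tendsto_atTop).sub
      (((mulCLM b).continuous.tendsto a).comp ha)).congr fun n => ?_
    simp [linearization]
  obtain ⟨y, hy, -⟩ := exists_tendsto_of_tendsto ha hA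
  exact ⟨y, φ, hφ, hy⟩

theorem exists_subseq_ae_tendsto {a : ℕ → L2 Ω} {l : L2 Ω} (ha : Tendsto a atTop (𝓝 l)) :
    ∃ φ : ℕ → ℕ, StrictMono φ ∧
      ∀ᵐ x ∂(volume.restrict Ω), Tendsto (fun n => a (φ n) x) atTop (𝓝 (l x)) :=
  (tendstoInMeasure_of_tendsto_Lp ha).exists_seq_tendsto_ae

theorem isClosed_setOf_ae_abs_le (M : ℝ) :
    IsClosed {a : L2 Ω | ∀ᵐ x ∂(volume.restrict Ω), |a x| ≤ M} := by
  refine isSeqClosed_iff_isClosed.1 fun a l ha hl => ?_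
  obtain ⟨φ, -, hae⟩ := exists_subseq_ae_tendsto hl
  have hall : ∀ᵐ x ∂(volume.restrict Ω), ∀ n, |a (φ n) x| ≤ M :=
    ae_all_iff.2 fun n => ha (φ n)
  filter_upwards [hae, hall] with x h1 h2
  exact le_of_tendsto h1.abs (Eventually.of_forall h2)

/-- Split `β z = β (z - l) + β l`: the first term is small by the uniform bound on `β`, the second
by dominated convergence. -/
theorem tendsto_mul_L2_of_dominated [IsFiniteMeasure (volume.restrict Ω)]
    {β : ℕ → EuclideanSpace ℝ (Fin N) → ℝ} {z : ℕ → L2 Ω}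
    {r : ℕ → L2 Ω} {l : L2 Ω} {c : ℝ} (hr : ∀ n, r n =ᵐ[volume.restrict Ω] fun x => β n x * z n x)
    (hmeas : ∀ n, AEStronglyMeasurable (β n) (volume.restrict Ω))
    (hc : ∀ n, ∀ᵐ x ∂(volume.restrict Ω), |β n x| ≤ c)
    (hβ : ∀ᵐ x ∂(volume.restrict Ω), Tendsto (fun n => β n x) atTop (𝓝 0))
    (hz : Tendsto z atTop (𝓝 l)) : Tendsto r atTop (𝓝 0) := by
  have hI : Tendsto (fun n => ∫ x in Ω, (β n x * l x) ^ 2) atTop (𝓝 0) := by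
    have := tendsto_integral_of_dominated_convergence (μ := volume.restrict Ω)
      (F := fun n x => (β n x * l x) ^ 2) (f := fun _ => 0) (fun x => c ^ 2 * l x ^ 2)
      (fun n => ((hmeas n).mul (Lp.aestronglyMeasurable l)).pow 2)
      ((integrable_sq_L2 l).const_mul _)
      (fun n => by
        filter_upwards [hc n] with x hx
        rw [mul_pow, Real.norm_of_nonneg (by positivity)]
        refine mul_le_mul_of_nonneg_right ?_ (sq_nonneg _)
        rw [← sq_abs]
        gcongr)
      (by
        filter_upwards [hβ] with x hx
        have := (hx.mul_const (l x)).pow 2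
        simpa using this)
    simpa using this
  have hint : ∀ n, Integrable (fun x => (β n x * l x) ^ 2) (volume.restrict Ω) := fun n => by
    refine ((integrable_sq_L2 l).const_mul (c ^ 2)).mono'
      (((hmeas n).mul (Lp.aestronglyMeasurable l)).pow 2) ?_
    filter_upwards [hc n] with x hx
    rw [mul_pow, Real.norm_of_nonneg (by positivity)]
    refine mul_le_mul_of_nonneg_right ?_ (sq_nonneg _)
    rw [← sq_abs]
    gcongr
  have hbound : ∀ n, ‖r n‖ ^ 2 ≤ 2 * c ^ 2 * ‖z n - l‖ ^ 2 +
      2 * ∫ x in Ω, (β n x * l x) ^ 2 := by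
    intro n
    rw [norm_sq_eq_integral, norm_sq_eq_integral, ← integral_const_mul, ← integral_const_mul,
      ← integral_add ((integrable_sq_L2 _).const_mul _) ((hint n).const_mul _)]
    refine integral_mono_ae (integrable_sq_L2 _)
      (((integrable_sq_L2 _).const_mul _).add ((hint n).const_mul _)) ?_
    filter_upwards [hr n, hc n, Lp.coeFn_sub (z n) l] with x h1 h2 h3
    rw [h1, h3, Pi.sub_apply]
    have h4 : β n x ^ 2 ≤ c ^ 2 := by
      rw [← sq_abs]
      gcongr
    have h5 := mul_le_mul_of_nonneg_right h4 (sq_nonneg (z n x - l x))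
    nlinarith [sq_nonneg (β n x * (z n x - l x) - β n x * l x)]
  have hsq : Tendsto (fun n => ‖r n‖ ^ 2) atTop (𝓝 0) := by
    refine squeeze_zero (fun n => by positivity) hbound ?_
    have h1 := (((tendsto_iff_norm_sub_tendsto_zero.1 hz).pow 2).const_mul (2 * c ^ 2)).add
      (hI.const_mul 2)
    simpa using h1
  rw [tendsto_zero_iff_norm_tendsto_zero]
  have h3 := (Real.continuous_sqrt.tendsto 0).comp hsq
  rw [Real.sqrt_zero] at h3
  exact h3.congr fun n => Real.sqrt_sq (norm_nonneg _)

theorem ae_remainder_eq [IsFiniteMeasure (volume.restrict Ω)] {f g : ℝ → ℝ} {L : NNReal}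
    (hg : LipschitzWith L g) {K : ℝ} (hfg : ∀ s, |s| ≤ K → g s = f s) {ψ : L2 Ω}
    {b : Lp ℝ ⊤ (volume.restrict Ω)} (hb : b =ᵐ[volume.restrict Ω] fun p => deriv f (ψ p))
    {x y : L2 Ω} (hx : ∀ᵐ p ∂(volume.restrict Ω), |x p| ≤ K)
    (hy : ∀ᵐ p ∂(volume.restrict Ω), |y p| ≤ K) (d : ℝ) :
    ∀ᵐ p ∂(volume.restrict Ω),
      (d • (x - y)) p = d * (x p - y p) ∧
      (d • (superposition hg x - superposition hg y - mulCLM b (x - y))) p =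
        d * (f (x p) - f (y p) - deriv f (ψ p) * (x p - y p)) ∧
      |f (x p) - f (y p)| ≤ L * |x p - y p| := by
  filter_upwards [Lp.coeFn_smul d (superposition hg x - superposition hg y - mulCLM b (x - y)),
    Lp.coeFn_sub (superposition hg x - superposition hg y) (mulCLM b (x - y)),
    Lp.coeFn_sub (superposition hg x) (superposition hg y), Lp.coeFn_sub x y,
    coeFn_mulCLM b (x - y), hb, coeFn_superposition hg x, coeFn_superposition hg y, hx, hy,
    Lp.coeFn_smul d (x - y)] with p h1 h2 h3 h4 h5 h6 h7 h8 h9 h10 h11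
  have e1 : g (x p) = f (x p) := hfg _ h9
  have e2 : g (y p) = f (y p) := hfg _ h10
  refine ⟨?_, ?_, ?_⟩
  · rw [h11, Pi.smul_apply, h4, Pi.sub_apply, smul_eq_mul]
  · rw [h1, Pi.smul_apply, h2, Pi.sub_apply, h3, Pi.sub_apply, h5, h4, Pi.sub_apply, h6, h7, h8,
      smul_eq_mul, e1, e2]
  · rw [← e1, ← e2]
    exact hg.norm_sub_le (x p) (y p)

/-- The scaled remainder is `β z`, where `z` is the scaled increment and `β` the difference between
a difference quotient of `f` and `f'(ψ)`. By strict differentiability `β → 0` almost everywhere, and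
`|β| ≤ L + ‖b‖`. -/
theorem tendsto_remainder_of_ae [IsFiniteMeasure (volume.restrict Ω)]
    {f g : ℝ → ℝ} {L : NNReal} (hf : ContDiff ℝ 1 f) (hg : LipschitzWith L g) {K : ℝ}
    (hfg : ∀ s, |s| ≤ K → g s = f s) {ψ : L2 Ω} {b : Lp ℝ ⊤ (volume.restrict Ω)}
    (hb : b =ᵐ[volume.restrict Ω] fun p => deriv f (ψ p)) {x y : ℕ → L2 Ω}
    (hx : ∀ n, ∀ᵐ p ∂(volume.restrict Ω), |x n p| ≤ K)
    (hy : ∀ n, ∀ᵐ p ∂(volume.restrict Ω), |y n p| ≤ K)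
    (hxψ : ∀ᵐ p ∂(volume.restrict Ω), Tendsto (fun n => x n p) atTop (𝓝 (ψ p)))
    (hyψ : ∀ᵐ p ∂(volume.restrict Ω), Tendsto (fun n => y n p) atTop (𝓝 (ψ p)))
    {d : ℕ → ℝ} (hd : ∀ n, 0 < d n) {l : L2 Ω}
    (hl : Tendsto (fun n => d n • (x n - y n)) atTop (𝓝 l)) :
    Tendsto (fun n => d n • (superposition hg (x n) - superposition hg (y n) -
      mulCLM b (x n - y n))) atTop (𝓝 0) := by
  have hae : ∀ᵐ p ∂(volume.restrict Ω), ∀ n, _ :=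
    ae_all_iff.2 fun n => ae_remainder_eq hg hfg hb (hx n) (hy n) (d n)
  have hbb : ∀ᵐ p ∂(volume.restrict Ω), |deriv f (ψ p)| ≤ ‖b‖ := by
    filter_upwards [hb, ae_le_eLpNormEssSup (f := b) (μ := volume.restrict Ω)] with p h1 h2
    rw [← h1, ← Real.norm_eq_abs, Lp.norm_def, eLpNorm_exponent_top, ← toReal_enorm]
    refine ENNReal.toReal_mono ?_ h2
    rw [← eLpNorm_exponent_top]
    exact Lp.eLpNorm_ne_top b
  generalize hz : (fun n => d n • (x n - y n)) = z at hl
  generalize hr : (fun n => d n • (superposition hg (x n) - superposition hg (y n) -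
      mulCLM b (x n - y n))) = r
  have hzr : ∀ᵐ p ∂(volume.restrict Ω), ∀ n, z n p = d n * (x n p - y n p) ∧
      r n p = d n * (f (x n p) - f (y n p) - deriv f (ψ p) * (x n p - y n p)) ∧
      |f (x n p) - f (y n p)| ≤ L * |x n p - y n p| := by
    subst hz hr
    exact hae
  clear hae hz hr
  refine tendsto_mul_L2_of_dominated (β := fun n p => r n p / z n p) (z := z) (l := l)
    (c := L + ‖b‖) (fun n => ?_) (fun n => ?_) (fun n => ?_) ?_ hl
  · filter_upwards [hzr] with p h
    obtain ⟨h1, h2, -⟩ := h n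
    by_cases h0 : z n p = 0
    · have h3 : x n p - y n p = 0 := by
        rw [h1] at h0
        exact (mul_eq_zero.1 h0).resolve_left (hd n).ne'
      rw [h0, mul_zero, h2, h3, sub_eq_zero.1 h3]
      simp
    · rw [div_mul_cancel₀ _ h0]
  · exact ((Lp.aestronglyMeasurable (r n)).aemeasurable.div
      (Lp.aestronglyMeasurable (z n)).aemeasurable).aestronglyMeasurable
  · filter_upwards [hzr, hbb] with p h h3
    obtain ⟨h1, h2, h4⟩ := h n
    rw [abs_div]
    refine div_le_of_le_mul₀ (abs_nonneg _) (by positivity) ?_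
    rw [h2, h1, abs_mul, abs_mul, abs_of_pos (hd n), mul_left_comm]
    refine mul_le_mul_of_nonneg_left ?_ (hd n).le
    refine (abs_sub _ _).trans ?_
    rw [abs_mul, add_mul]
    gcongr
  · filter_upwards [hzr, hxψ, hyψ] with p h h3 h4
    have hs : HasStrictDerivAt f (deriv f (ψ p)) (ψ p) :=
      hf.contDiffAt.hasStrictDerivAt one_ne_zero
    rw [Metric.tendsto_nhds]
    intro η hη
    have hlo := hs.isLittleO.def (half_pos hη)
    filter_upwards [(h3.prodMk_nhds h4).eventually hlo] with n hn
    obtain ⟨h1, h2, -⟩ := h n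
    rw [Real.dist_0_eq_abs, abs_div]
    refine lt_of_le_of_lt (div_le_of_le_mul₀ (abs_nonneg _) (half_pos hη).le ?_)
      (half_lt_self hη)
    rw [h2, h1, abs_mul, abs_mul, abs_of_pos (hd n), mul_left_comm]
    refine mul_le_mul_of_nonneg_left ?_ (hd n).le
    simpa [Real.norm_eq_abs, mul_comm] using hn

/-- Differentiability of the superposition operator at `ψ`, relative to the uniformly bounded
elements of the domain. -/
theorem eventually_norm_superposition_sub_le [IsFiniteMeasure (volume.restrict Ω)] (hm : 0 < m)
    {f g : ℝ → ℝ} {L : NNReal} (hf : ContDiff ℝ 1 f) (hg : LipschitzWith L g) {K : ℝ}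
    (hfg : ∀ s, |s| ≤ K → g s = f s) {ψ : dirichletDomain Ω m} {b : Lp ℝ ⊤ (volume.restrict Ω)}
    (hb : b =ᵐ[volume.restrict Ω] fun x => deriv f (toL2CLM Ω m ψ x)) {ε : ℝ} (hε : 0 < ε) :
    ∀ᶠ q : dirichletDomain Ω m × dirichletDomain Ω m in 𝓝 (ψ, ψ),
      BoundedBy K q.1 → BoundedBy K q.2 →
      ‖superposition hg (toL2CLM Ω m q.1) - superposition hg (toL2CLM Ω m q.2) -
        mulCLM b (toL2CLM Ω m (q.1 - q.2))‖ ≤ ε * ‖q.1 - q.2‖ := by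
  -- Increments along a violating sequence, normalized in the graph norm, are precompact in `L²`;
  -- this compactness is what the graph norm on the right-hand side buys. Passing to subsequences,
  -- both sequences of functions also converge to `ψ` almost everywhere.
  by_contra hcon
  rw [not_eventually] at hcon
  obtain ⟨q, hq, hqp⟩ := exists_seq_forall_of_frequently hcon
  push Not at hqp
  have hw0 : ∀ n, 0 < ‖(q n).1 - (q n).2‖ := by
    intro n
    by_contra h
    have h0 : (q n).1 - (q n).2 = 0 := norm_le_zero_iff.1 (not_lt.1 h)
    have := (hqp n).2.2
    rw [h0, sub_eq_zero.1 h0, sub_self, map_zero, map_zero, sub_zero, norm_zero, norm_zero,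
      mul_zero] at this
    exact lt_irrefl _ this
  obtain ⟨l, φ, hφ, hl⟩ := exists_subseq_tendsto_toL2CLM hm (C := 1)
    (x := fun n => ‖(q n).1 - (q n).2‖⁻¹ • ((q n).1 - (q n).2)) (fun n => by
      rw [norm_smul, norm_inv, norm_norm, inv_mul_cancel₀ (hw0 n).ne'])
  have hq1 : Tendsto (fun n => toL2CLM Ω m (q (φ n)).1) atTop (𝓝 (toL2CLM Ω m ψ)) :=
    (((toL2CLM Ω m).continuous.comp continuous_fst).tendsto (ψ, ψ)).comp
      (hq.comp hφ.tendsto_atTop)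
  have hq2 : Tendsto (fun n => toL2CLM Ω m (q (φ n)).2) atTop (𝓝 (toL2CLM Ω m ψ)) :=
    (((toL2CLM Ω m).continuous.comp continuous_snd).tendsto (ψ, ψ)).comp
      (hq.comp hφ.tendsto_atTop)
  obtain ⟨φ₁, hφ₁, hae1⟩ := exists_subseq_ae_tendsto hq1
  obtain ⟨φ₂, hφ₂, hae2⟩ := exists_subseq_ae_tendsto (hq2.comp hφ₁.tendsto_atTop)
  have hl' := hl.comp (hφ₁.tendsto_atTop.comp hφ₂.tendsto_atTop)
  have hrt := tendsto_remainder_of_ae (x := fun n => toL2CLM Ω m (q (φ (φ₁ (φ₂ n)))).1)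
    (y := fun n => toL2CLM Ω m (q (φ (φ₁ (φ₂ n)))).2)
    (d := fun n => ‖(q (φ (φ₁ (φ₂ n)))).1 - (q (φ (φ₁ (φ₂ n)))).2‖⁻¹) (l := l) hf hg hfg hb
    (fun n => (hqp _).1) (fun n => (hqp _).2.1)
    (by
      filter_upwards [hae1] with p hp
      exact hp.comp hφ₂.tendsto_atTop)
    hae2 (fun n => inv_pos.2 (hw0 _))
    (hl'.congr fun n => by simp only [Function.comp_apply, map_smul, map_sub])
  obtain ⟨n, hn⟩ := ((tendsto_zero_iff_norm_tendsto_zero.1 hrt).eventually_lt_const hε).exists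
  have h1 := (hqp (φ (φ₁ (φ₂ n)))).2.2
  rw [norm_smul, norm_inv, norm_norm, inv_mul_lt_iff₀ (hw0 _), ← map_sub (toL2CLM Ω m),
    mul_comm] at hn
  exact lt_asymm h1 hn

end Linearization

/-! ### Convergence of bounded solutions of the parabolic equation -/

section Parabolic

/-- A `C¹` nonlinearity agrees on a bounded interval with a globally Lipschitz one. -/
theorem exists_lipschitzWith_eq_of_abs_le {f : ℝ → ℝ} (hf : ContDiff ℝ 1 f) {K : ℝ} (hK : 0 ≤ K) :
    ∃ (g : ℝ → ℝ) (L : NNReal), LipschitzWith L g ∧ ∀ s, |s| ≤ K → g s = f s := by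
  obtain ⟨L, hL⟩ := hf.contDiffOn.exists_lipschitzOnWith one_ne_zero (convex_Icc (-K) K)
    isCompact_Icc
  have hle : -K ≤ K := by linarith
  -- Constant continuation outside `[-K, K]`; the projection onto the interval has Lipschitz
  -- constant 1.
  refine ⟨Set.IccExtend hle ((Set.Icc (-K) K).domRestrict f), L * 1, ?_, fun s hs => ?_⟩
  · exact hL.to_restrict.comp (LipschitzWith.projIcc hle)
  · exact Set.IccExtend_of_mem hle _ (Set.mem_Icc.2 (abs_le.1 hs))

variable {N : ℕ} {Ω : Set (EuclideanSpace ℝ (Fin N))} {m : ℕ}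

theorem BoundedBy.mono {M K : ℝ} (h : M ≤ K) {x : dirichletDomain Ω m} (hx : BoundedBy M x) :
    BoundedBy K x :=
  Eventually.mono hx fun _ hp => hp.trans h

theorem BoundedBy.of_mapClusterPt {M : ℝ} {u : ℝ → dirichletDomain Ω m}
    (hu : ∀ t > 0, BoundedBy M (u t)) {x : dirichletDomain Ω m} (hx : MapClusterPt x atTop u) :
    BoundedBy M x := by
  have hcl : IsClosed {y : dirichletDomain Ω m | BoundedBy M y} :=
    (isClosed_setOf_ae_abs_le M).preimage (toL2CLM Ω m).continuous
  exact hcl.mem_of_mapClusterPt hx ((eventually_gt_atTop 0).mono hu)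

theorem exists_coefficient {f : ℝ → ℝ} (hf : ContDiff ℝ 1 f) {M : ℝ} {ψ : dirichletDomain Ω m}
    (hψ : BoundedBy M ψ) :
    ∃ b : Lp ℝ ⊤ (volume.restrict Ω),
      b =ᵐ[volume.restrict Ω] fun p => deriv f (toL2CLM Ω m ψ p) := by
  have hc : Continuous (deriv f) := hf.continuous_deriv le_rfl
  obtain ⟨B, hB⟩ := (isCompact_Icc (a := -M) (b := M)).exists_bound_of_continuousOn hc.continuousOn
  have hmem : MemLp (fun p => deriv f (toL2CLM Ω m ψ p)) ⊤ (volume.restrict Ω) :=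
    memLp_top_of_bound (hc.comp_aestronglyMeasurable (Lp.aestronglyMeasurable _)) B
      (Eventually.mono hψ fun p hp => hB _ (abs_le.1 hp))
  exact ⟨hmem.toLp _, hmem.coeFn_toLp⟩

theorem ker_linearization {f : ℝ → ℝ} {ψ : dirichletDomain Ω m}
    {b : Lp ℝ ⊤ (volume.restrict Ω)}
    (hb : b =ᵐ[volume.restrict Ω] fun p => deriv f (toL2CLM Ω m ψ p)) :
    (linearization m b).ker = pdeKernel f ψ := by
  ext v
  have h : linearization m b v =ᵐ[volume.restrict Ω]
      fun p => polyLaplacian v p + deriv f (toL2 ψ p) * toL2 v p := by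
    filter_upwards [hb, Lp.coeFn_add (polyLaplacianCLM Ω m v) (mulCLM b (toL2CLM Ω m v)),
      coeFn_mulCLM b (toL2CLM Ω m v)] with p h1 h2 h3
    change (polyLaplacianCLM Ω m v + mulCLM b (toL2CLM Ω m v) : L2 Ω) p = _
    rw [h2, Pi.add_apply, h3, h1]
    rfl
  have h0 : v ∈ (linearization m b).ker ↔ linearization m b v = 0 := Iff.rfl
  rw [h0, Lp.eq_zero_iff_ae_eq_zero]
  constructor
  · intro h0
    change ∀ᵐ p ∂(volume.restrict Ω), _
    filter_upwards [h, h0] with p h1 h2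
    rw [← h1, h2, Pi.zero_apply]
  · intro h0
    change ∀ᵐ p ∂(volume.restrict Ω), _ at h0
    filter_upwards [h, h0] with p h1 h2
    rw [h1, h2, Pi.zero_apply]

variable [IsFiniteMeasure (volume.restrict Ω)]

theorem BoundedBy.norm_toL2CLM_le {M : ℝ} {x : dirichletDomain Ω m} (hx : BoundedBy M x) :
    ‖toL2CLM Ω m x‖ ≤ (volume.restrict Ω).real Set.univ ^ (2 : ENNReal).toReal⁻¹ * |M| :=
  Lp.norm_le_of_ae_bound (abs_nonneg M) (Eventually.mono hx fun _ hp => hp.trans (le_abs_self M))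

theorem BoundedBy.coeFn_vectorField {f g : ℝ → ℝ} {L : NNReal} (hg : LipschitzWith L g) {K : ℝ}
    (hfg : ∀ s, |s| ≤ K → g s = f s) {x : dirichletDomain Ω m} (hx : BoundedBy K x) :
    vectorField hg x =ᵐ[volume.restrict Ω] fun p => polyLaplacian x p + f (toL2 x p) := by
  filter_upwards [hx, Lp.coeFn_add (polyLaplacianCLM Ω m x) (superposition hg (toL2CLM Ω m x)),
    coeFn_superposition hg (toL2CLM Ω m x)] with p h1 h2 h3
  rw [vectorField, h2, Pi.add_apply, h3, polyLaplacianCLM_apply, toL2CLM_apply, hfg _ h1]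

theorem mem_pdeEquilibria_iff {f g : ℝ → ℝ} {L : NNReal} (hg : LipschitzWith L g) {K M : ℝ}
    (hMK : M ≤ K) (hfg : ∀ s, |s| ≤ K → g s = f s) {x : dirichletDomain Ω m} :
    x ∈ pdeEquilibria Ω m f M ↔ BoundedBy M x ∧ vectorField hg x = 0 := by
  refine and_congr_right fun hx => ?_
  rw [Lp.eq_zero_iff_ae_eq_zero]
  have h := (hx.mono hMK).coeFn_vectorField hg hfg
  constructor
  · intro h0
    filter_upwards [h, h0] with p h1 h2
    rw [h1, h2, Pi.zero_apply]
  · intro h0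
    filter_upwards [h, h0] with p h1 h2
    rw [← h1, h2, Pi.zero_apply]

theorem IsPdeOrbit.hasDerivAt {f g : ℝ → ℝ} {L : NNReal} (hg : LipschitzWith L g) {K : ℝ}
    (hfg : ∀ s, |s| ≤ K → g s = f s) {u : ℝ → dirichletDomain Ω m} (hu : IsPdeOrbit f u)
    (hK : ∀ t > 0, BoundedBy K (u t)) {t : ℝ} (ht : 0 < t) :
    HasDerivAt (fun s => toL2CLM Ω m (u s)) (vectorField hg (u t)) t := by
  obtain ⟨w, hw, hae⟩ := hu.equation t ht
  have : vectorField hg (u t) = w := by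
    refine Lp.ext ?_
    filter_upwards [hae, (hK t ht).coeFn_vectorField hg hfg] with p h1 h2
    rw [h1, h2]
  rw [this]
  exact hw

/-- Continuity at equilibria is all that identifies the limit of the energy, and there the quadratic
bound gives it at once. -/
theorem continuousAt_energy_of_vectorField_eq_zero {g : ℝ → ℝ} {L : NNReal}
    (hg : LipschitzWith L g) {x : dirichletDomain Ω m} (hx : vectorField hg x = 0) :
    ContinuousAt (energy hg) x := by
  rw [ContinuousAt, tendsto_iff_norm_sub_tendsto_zero]
  refine squeeze_zero (fun _ => norm_nonneg _) (fun y => abs_energy_sub_le_sq hg y hx) ?_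
  have : Continuous fun y : dirichletDomain Ω m => (1 / 2 + (L : ℝ)) * ‖y - x‖ ^ 2 := by fun_prop
  simpa using this.tendsto x

/-- The Łojasiewicz inequality with exponent `1/2` at an equilibrium through which there passes a
surface of equilibria of the dimension of the kernel. -/
theorem lojasiewicz_of_pde_surface (hm : 0 < m) {f g : ℝ → ℝ} {L : NNReal}
    (hf : ContDiff ℝ 1 f) (hg : LipschitzWith L g) {K M : ℝ} (hMK : M ≤ K)
    (hfg : ∀ s, |s| ≤ K → g s = f s) {ψ : dirichletDomain Ω m} (hψ : ψ ∈ pdeEquilibria Ω m f M)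
    (hsurf : HasSurfaceThrough (pdeEquilibria Ω m f M) ψ (Module.finrank ℝ (pdeKernel f ψ))) :
    ∃ C, ∀ᶠ x in 𝓝 ψ, BoundedBy K x → |energy hg x - energy hg ψ| ≤ C * ‖vectorField hg x‖ ^ 2 := by
  obtain ⟨b, hb⟩ := exists_coefficient hf hψ.1
  have hΦ : ∀ y ∈ pdeEquilibria Ω m f M, vectorField hg y = 0 := fun y hy =>
    ((mem_pdeEquilibria_iff hg hMK hfg).1 hy).2
  rw [← ker_linearization hb] at hsurf
  refine lojasiewicz_of_surface (S := {x | BoundedBy K x}) (K := 1 / 2 + L)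
    (isSemiFredholm_linearization hm b) hΦ (fun y hy => hy.1.mono hMK) hψ (fun ε hε => ?_)
    (Eventually.of_forall fun q _ hq => abs_energy_sub_le_sq hg q.1 (hΦ _ hq)) hsurf
  filter_upwards [eventually_norm_superposition_sub_le hm hf hg hfg hb hε] with q hq h1 h2
  refine le_trans (le_of_eq (congrArg norm ?_)) (hq h1 (h2.1.mono hMK))
  simp only [vectorField, linearization, add_apply,
    ContinuousLinearMap.comp_apply, map_sub]
  abel

theorem IsPdeOrbit.exists_tendsto (hΩ : IsOpen Ω) (hm : 0 < m) {f : ℝ → ℝ} (hf : ContDiff ℝ 1 f)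
    (hR : PdeResonanceBranching Ω m f) {u : ℝ → dirichletDomain Ω m} {M : ℝ}
    (hu : IsPdeOrbit f u) (hM : ∀ t > 0, BoundedBy M (u t)) :
    ∃ ψ ∈ pdeEquilibria Ω m f M, Tendsto u atTop (𝓝 ψ) ∧
      (pdeKernel f ψ = ⊥ ∨ PdeBranchingAt f ψ →
        ConvergesExponentially (fun t => toL2 (u t)) (toL2 ψ)) := by
  have hnorm := fun t ht => (hM t ht).norm_toL2CLM_le
  obtain ⟨hpre, heq⟩ : PrecompactAtTop u ∧
      ∀ x, MapClusterPt x atTop u → x ∈ pdeEquilibria Ω m f M := by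
    -- Truncating at the level of the solution is enough for compactness and for identifying the
    -- limit points.
    obtain ⟨g, L, hg, hfg⟩ := exists_lipschitzWith_eq_of_abs_le hf (abs_nonneg M)
    have hd : ∀ t > 0, HasDerivAt (fun s => toL2CLM Ω m (u s)) (vectorField hg (u t)) t :=
      fun t ht => hu.hasDerivAt hg hfg (fun t ht => (hM t ht).mono (le_abs_self M)) ht
    refine ⟨precompactAtTop_of_semilinear hm hg hu.continuousOn hd hnorm, fun x hx => ?_⟩
    refine (mem_pdeEquilibria_iff hg (le_abs_self M) hfg).2
      ⟨BoundedBy.of_mapClusterPt hM hx, ?_⟩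
    have h1 : MapClusterPt (vectorField hg x) atTop (fun t => vectorField hg (u t)) :=
      hx.continuousAt_comp (continuous_vectorField hg).continuousAt
    have h2 := tendsto_vectorField hg hu.continuousOn hd hnorm
    exact eq_of_nhds_neBot (h1.clusterPt.neBot.mono (inf_le_inf_left _ h2))
  obtain ⟨ψ, hψ⟩ := hpre.exists_mapClusterPt
  refine ⟨ψ, heq ψ hψ, ?_⟩
  by_cases hcase : pdeKernel f ψ = ⊥ ∨ PdeBranchingAt f ψ
  · obtain ⟨M', hsurf⟩ : ∃ M', HasSurfaceThrough (pdeEquilibria Ω m f M') ψ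
        (Module.finrank ℝ (pdeKernel f ψ)) := by
      by_cases hk : Module.finrank ℝ (pdeKernel f ψ) = 0
      · rw [hk]
        exact ⟨M, hasSurfaceThrough_zero (heq ψ hψ)⟩
      · refine hR M ψ (heq ψ hψ) (hcase.resolve_left fun h => hk ?_)
          (Nat.one_le_iff_ne_zero.2 hk)
        rw [h]
        exact finrank_bot ℝ _
    have hψM' : ψ ∈ pdeEquilibria Ω m f M' := by
      obtain ⟨p, hp0, -, -, hp⟩ := hsurf
      rw [← hp0]
      exact hp.self_of_nhds
    -- The equilibria on the surface may have a larger bound `M'`, so `f` is truncated anew at a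
    -- level covering both the orbit and the surface.
    obtain ⟨g, L, hg, hfg⟩ := exists_lipschitzWith_eq_of_abs_le hf
      (le_max_of_le_left (abs_nonneg M) : 0 ≤ max |M| M')
    have hMK : M ≤ max |M| M' := (le_abs_self M).trans (le_max_left _ _)
    have hd : ∀ t > 0, HasDerivAt (fun s => toL2CLM Ω m (u s)) (vectorField hg (u t)) t :=
      fun t ht => hu.hasDerivAt hg hfg (fun t ht => (hM t ht).mono hMK) ht
    have hE : ∀ t > 0, HasDerivAt (fun s => energy hg (u s)) (‖vectorField hg (u t)‖ ^ 2) t :=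
      fun t ht => hasDerivAt_energy hg hu.continuousOn hd ht
    have hψ0 : vectorField hg ψ = 0 := ((mem_pdeEquilibria_iff hg hMK hfg).1 (heq ψ hψ)).2
    have hlim : Tendsto (fun t => energy hg (u t)) atTop (𝓝 (energy hg ψ)) :=
      tendsto_of_monotoneOn_of_mapClusterPt (monotoneOn_energy hE)
        (hψ.continuousAt_comp (continuousAt_energy_of_vectorField_eq_zero hg hψ0))
    obtain ⟨C, hC⟩ := lojasiewicz_of_pde_surface hm hf hg (le_max_right _ _) hfg hψM' hsurf
    have hloj : ∀ᶠ t in atTop ⊓ comap u (𝓝 ψ),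
        energy hg ψ - energy hg (u t) ≤ C * ‖vectorField hg (u t)‖ ^ 2 := by
      filter_upwards [((eventually_gt_atTop 0).filter_mono inf_le_left :
        ∀ᶠ t : ℝ in atTop ⊓ comap u (𝓝 ψ), 0 < t), (hC.comap u).filter_mono inf_le_right]
        with t ht0 ht
      have := ht ((hM t ht0).mono hMK)
      rw [abs_sub_comm] at this
      exact (le_abs_self _).trans this
    have := hpre.tendsto_of_lojasiewicz (injective_toL2CLM hΩ) hd hE hlim hψ hloj ⟨_, hnorm⟩
    exact ⟨this.1, fun _ => this.2⟩
  · push Not at hcase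
    exact ⟨hpre.tendsto_of_isolated hu.continuousOn heq hψ fun h => hcase.2 ⟨M, h⟩,
      fun h => absurd h (by push Not; exact hcase)⟩

end Parabolic

end GradientFlow

/-! ### The two convergence theorems. -/

theorem mainTheorem2 :
    -- smooth gradient systems in a separable Hilbert space
    (∀ (H : Type*) [NormedAddCommGroup H] [InnerProductSpace ℝ H] [CompleteSpace H]
        [TopologicalSpace.SeparableSpace H]
        (X : Type*) [NormedAddCommGroup X] [NormedSpace ℝ X] [CompleteSpace X]
        (ι : X →L[ℝ] H) (V : X → ℝ) (V' : X → H),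
      GradientFlow.IsGradientSystem ι V V' →
      (∀ ψ ∈ GradientFlow.equilibria V',
        GradientFlow.IsFredholmIndexZero (fderiv ℝ V' ψ) ∧
        GradientFlow.HasDiscreteSelfAdjointExtension ι (fderiv ℝ V' ψ)) →
      GradientFlow.ResonanceBranching V' →
      ∀ u : ℝ → X, GradientFlow.IsSmoothOrbit ι V' u →
        Bornology.IsBounded (u '' Set.Ioi 0) →
        ∃ ψ ∈ GradientFlow.equilibria V',
          Tendsto u atTop (𝓝 ψ) ∧
          ((fderiv ℝ V' ψ).ker = ⊥ ∨ AccPt ψ (𝓟 (GradientFlow.equilibria V')) →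
            GradientFlow.ConvergesExponentially (fun t => ι (u t)) (ι ψ))) ∧
    -- parabolic equations of order `2m`
    (∀ (N m : ℕ) (Ω : Set (EuclideanSpace ℝ (Fin N))) (f : ℝ → ℝ),
      0 < N → 0 < m → IsOpen Ω → Bornology.IsBounded Ω → ContDiff ℝ 1 f →
      GradientFlow.PdeResonanceBranching Ω m f →
      ∀ (u : ℝ → GradientFlow.dirichletDomain Ω m) (M : ℝ), GradientFlow.IsPdeOrbit f u →
        (∀ t > 0, GradientFlow.BoundedBy M (u t)) →
        ∃ ψ ∈ GradientFlow.pdeEquilibria Ω m f M,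
          Tendsto u atTop (𝓝 ψ) ∧
          (GradientFlow.pdeKernel f ψ = ⊥ ∨ GradientFlow.PdeBranchingAt f ψ →
            GradientFlow.ConvergesExponentially
              (fun t => GradientFlow.toL2 (u t)) (GradientFlow.toL2 ψ))) := by
  refine ⟨?_, ?_⟩
  · intro H _ _ _ _ X _ _ _ ι V V' hS hF hR u hu hb
    exact hS.exists_tendsto (fun ψ hψ => (hF ψ hψ).1.1) hR hu hb
  · intro N m Ω f _ hm hΩ hΩb hf hR u M hu hM
    have := GradientFlow.isFiniteMeasure_restrict_of_isBounded hΩb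
    exact hu.exists_tendsto hΩ hm hf hR hM
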